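/- For $n\ge 1$ let $K_n$ be the transition matrix of an irreducible birth and death chain on $\{0,1,\dots,n\}$ (so $K_n(i,j)=0$ when $|i-j|>1$), with stationary distribution $\pi_n$, and let $\lambda_n$ be the smallest non-zero eigenvalue of $I-K_n$. Let $(X^{(n)}_m)_{m\ge 0}$ be a Markov chain with transition matrix $K_n$ and $(N_t)_{t\ge 0}$ an independent Poisson process with parameter $1$. For $i\in\{0,\dots,n\}$ set $$\tau^{(n)}_i=\inf\{m\ge 0: X^{(n)}_m=i\},\qquad \widetilde\tau^{(n)}_i=\inf\{t\ge 0: X^{(n)}_{N_t}=i\},$$ and let $\mathbb{E}_j,\mathrm{Var}_j$ be the expectation and variance given $X^{(n)}_0=j$. Let $\mathrm{sep}(\mu,\nu)=\max_x\{1-\mu(x)/\nu(x)\}$ and $H_{n,t}=e^{-t(I-K_n)}$. For $\epsilon\in(0,1)$ the separation mixing times from state $0$ are $$T_n(\epsilon)=\min\{m\in\{0,1,2,\dots\}: \mathrm{sep}(K_n^m(0,\cdot),\pi_n)\le\epsilon\},\qquad T^{(c)}_n(\epsilon)=\min\{t\ge 0: \mathrm{sep}(H_{n,t}(0,\cdot),\pi_n)\le\epsilon\}$$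 in discrete time (family $\mathcal F^L$) and in continuous time (family $\mathcal F^L_c$), respectively. A family with mixing times $T_n(\epsilon)$ has a separation cutoff if there are $t_n>0$ with $T_n(\epsilon)/t_n\to 1$ for all $\epsilon\in(0,1)$. For sequences $t_n,b_n$ it has a $(t_n,b_n)$ separation cutoff if it has a separation cutoff, $t_n>0$, $b_n>0$, $b_n/t_n\to 0$ and $\limsup_n |T_n(\epsilon)-t_n|/b_n<\infty$ for all $\epsilon\in(0,1)$. **Theorem 1.3.** Let $M_n\in\{0,1,\dots,n\}$ satisfy $$\inf_{n\ge 1}\pi_n([0,M_n])>0,\qquad \inf_{n\ge 1}\pi_n([M_n,n])>0 .$$ Then $\tau^{(n)}_{M_n}$ and $\widetilde\tau^{(n)}_{M_n}$, started at $0$ or at $n$, are almost surely finite with finite second moments, and $$s_n:=\mathbb{E}_0\widetilde\tau^{(n)}_{M_n}+\mathbb{E}_n\widetilde\tau^{(n)}_{M_n}=\mathbb{E}_0\tau^{(n)}_{M_n}+\mathbb{E}_n\tau^{(n)}_{M_n}.$$ Define $b_n,c_n\ge 0$ by $$b_n^2=\mathrm{Var}_0\widetilde\tau^{(n)}_{M_n}+\mathrm{Var}_n\widetilde\tau^{(n)}_{M_n},\qquad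 c_n^2=\mathrm{Var}_0\tau^{(n)}_{M_n}+\mathrm{Var}_n\tau^{(n)}_{M_n}.$$ 1. $\mathcal F^L_c$ has a separation cutoff if and only if $s_n\lambda_n\to\infty$, if and only if $s_n/b_n\to\infty$. Furthermore, if $s_n/b_n\to\infty$, then $\mathcal F^L_c$ has an $(s_n,b_n)$ separation cutoff. 2. Assume that $K_n(i,i+1)+K_n(i+1,i)\le 1$ for all $n\ge 1$ and $0\le i<n$. Then $\mathcal F^L$ has a separation cutoff if and only if $s_n\lambda_n\to\infty$, if and only if $s_n/c_n\to\infty$. Furthermore, if $s_n/c_n\to\infty$, then $\mathcal F^L$ has an $(s_n,\max\{c_n,1/\lambda_n\})$ separation cutoff. -/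

import Mathlib

open MeasureTheory ProbabilityTheory Filter Topology
open scoped NNReal ENNReal

namespace BDCutoff

/-! ### Birth and death chains on `{0, …, n}` -/

/-- Transition matrix of a birth and death chain on `{0, …, n}`: a stochastic matrix whose only
nonzero entries are `K i (i+1)`, `K i (i-1)` and `K i i`. -/
structure IsBirthDeath {n : ℕ} (K : Matrix (Fin (n + 1)) (Fin (n + 1)) ℝ) : Prop where
  stochastic : K ∈ Matrix.rowStochastic ℝ (Fin (n + 1))
  nearest : ∀ i j : Fin (n + 1), (i : ℕ) + 1 < j ∨ (j : ℕ) + 1 < i → K i j = 0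

/-- `μ` is a probability vector with `μ K = μ`. -/
structure IsStationary {n : ℕ} (K : Matrix (Fin (n + 1)) (Fin (n + 1)) ℝ)
    (μ : Fin (n + 1) → ℝ) : Prop where
  nonneg : ∀ i, 0 ≤ μ i
  sum_eq_one : ∑ i, μ i = 1
  invariant : Matrix.vecMul μ K = μ

/-- The smallest nonzero eigenvalue of `I - K` (the minimum of a finite set, nonempty for
irreducible `K` and `n ≥ 1`). -/
noncomputable def spectralGap {n : ℕ} (K : Matrix (Fin (n + 1)) (Fin (n + 1)) ℝ) : ℝ :=
  sInf {l : ℝ | l ≠ 0 ∧ Module.End.HasEigenvalue (Matrix.toLin' (1 - K)) l}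

/-! ### Separation and mixing times -/

/-- `sep(μ, ν) = max_x (1 - μ x / ν x)`. -/
noncomputable def sep {n : ℕ} (μ ν : Fin (n + 1) → ℝ) : ℝ :=
  ⨆ x, (1 - μ x / ν x)

/-- Transition semigroup `H_t = exp(-t (I - K))` of the associated continuous time chain. -/
noncomputable def heat {n : ℕ} (K : Matrix (Fin (n + 1)) (Fin (n + 1)) ℝ) (t : ℝ) :
    Matrix (Fin (n + 1)) (Fin (n + 1)) ℝ :=
  NormedSpace.exp ((-t) • (1 - K))

/-- Discrete time separation mixing time started at `x`:
`min {m ≥ 0 | sep(K^m(x,·), μ) ≤ ε}`. -/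
noncomputable def sepTime {n : ℕ} (K : Matrix (Fin (n + 1)) (Fin (n + 1)) ℝ)
    (μ : Fin (n + 1) → ℝ) (x : Fin (n + 1)) (ε : ℝ) : ℕ :=
  sInf {m : ℕ | sep ((K ^ m) x) μ ≤ ε}

/-- Continuous time separation mixing time started at `x`:
`min {t ≥ 0 | sep(H_t(x,·), μ) ≤ ε}`. -/
noncomputable def sepTimeC {n : ℕ} (K : Matrix (Fin (n + 1)) (Fin (n + 1)) ℝ)
    (μ : Fin (n + 1) → ℝ) (x : Fin (n + 1)) (ε : ℝ) : ℝ :=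
  sInf {t : ℝ | 0 ≤ t ∧ sep (heat K t x) μ ≤ ε}

/-! ### Cutoff for a family indexed by `n ≥ 1` with mixing times `T n ε` -/

/-- There is a sequence of positive numbers `t n` with `T n ε / t n → 1` for all `0 < ε < 1`. -/
def HasCutoff (T : ℕ → ℝ → ℝ) : Prop :=
  ∃ t : ℕ → ℝ, (∀ n, 1 ≤ n → 0 < t n) ∧
    ∀ ε : ℝ, 0 < ε → ε < 1 → Tendsto (fun n => T n ε / t n) atTop (𝓝 1)

/-- A `(t n, b n)` cutoff: the family has a cutoff, `t n, b n > 0`, `b n / t n → 0`, and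
`limsup |T n ε - t n| / b n < ∞` for all `0 < ε < 1`. -/
structure HasCutoffWindow (T : ℕ → ℝ → ℝ) (t b : ℕ → ℝ) : Prop where
  cutoff : HasCutoff T
  time_pos : ∀ n, 1 ≤ n → 0 < t n
  window_pos : ∀ n, 1 ≤ n → 0 < b n
  window_small : Tendsto (fun n => b n / t n) atTop (𝓝 0)
  window : ∀ ε : ℝ, 0 < ε → ε < 1 → ∃ C : ℝ, ∀ᶠ n in atTop, |T n ε - t n| / b n ≤ C

/-! ### The Markov chain, the Poisson process and the hitting times -/

section Processes

variable {Ω : Type*} [MeasurableSpace Ω]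

/-- Under `P`, the process `X` is a Markov chain with transition matrix `K` and `X 0 = j`:
the probability of following a path `x 0, …, x (m+1)` is that of following `x 0, …, x m` times
`K (x m) (x (m+1))`. -/
structure IsMarkovChain {n : ℕ} (K : Matrix (Fin (n + 1)) (Fin (n + 1)) ℝ) (j : Fin (n + 1))
    (X : ℕ → Ω → Fin (n + 1)) (P : Measure Ω) : Prop where
  measurable : ∀ m, Measurable (X m)
  init : ∀ᵐ ω ∂P, X 0 ω = j
  step : ∀ (m : ℕ) (x : ℕ → Fin (n + 1)),
    P {ω | ∀ k ≤ m + 1, X k ω = x k} =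
      P {ω | ∀ k ≤ m, X k ω = x k} * ENNReal.ofReal (K (x m) (x (m + 1)))

/-- Under `P`, the process `N` is a Poisson process with parameter `1`: it counts almost surely
the terms, up to time `t`, of a strictly increasing sequence of positive arrival times tending to
infinity, its increments are independent, and `N t - N s` is Poisson with mean `t - s`. -/
structure IsPoissonProcess (N : ℝ≥0 → Ω → ℕ) (P : Measure Ω) : Prop where
  measurable : ∀ t, Measurable (N t)
  counting : ∀ᵐ ω ∂P, ∃ S : ℕ → ℝ≥0, 0 < S 0 ∧ StrictMono S ∧ Tendsto S atTop atTop ∧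
    ∀ t, N t ω = {k : ℕ | S k ≤ t}.ncard
  indep : HasIndepIncrements N P
  law : ∀ s t : ℝ≥0, s ≤ t → P.map (fun ω => N t ω - N s ω) = poissonMeasure (t - s)

/-- `τ_i = inf {m ≥ 0 | X_m = i}`, with value `∞` if `i` is never visited. -/
noncomputable def hit {n : ℕ} (X : ℕ → Ω → Fin (n + 1)) (i : Fin (n + 1)) (ω : Ω) : ℝ≥0∞ :=
  ⨅ (m : ℕ) (_ : X m ω = i), (m : ℝ≥0∞)

/-- `inf {t ≥ 0 | X_{N_t} = i}`, with value `∞` if `i` is never visited. -/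
noncomputable def hitC {n : ℕ} (X : ℕ → Ω → Fin (n + 1)) (N : ℝ≥0 → Ω → ℕ) (i : Fin (n + 1))
    (ω : Ω) : ℝ≥0∞ :=
  ⨅ (t : ℝ≥0) (_ : X (N t ω) ω = i), (t : ℝ≥0∞)

/-- The `[0,∞]`-valued random time `τ` is almost surely finite and square integrable, so that its
mean and variance are meaningful. -/
def HasMeanVar (τ : Ω → ℝ≥0∞) (P : Measure Ω) : Prop :=
  (∀ᵐ ω ∂P, τ ω ≠ ∞) ∧ MemLp (fun ω => (τ ω).toReal) 2 P

/-- Expectation of a random time. -/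
noncomputable def mean (τ : Ω → ℝ≥0∞) (P : Measure Ω) : ℝ :=
  ∫ ω, (τ ω).toReal ∂P

/-- Variance of a random time. -/
noncomputable def var (τ : Ω → ℝ≥0∞) (P : Measure Ω) : ℝ :=
  variance (fun ω => (τ ω).toReal) P

/-- `E_0 τ + E_n τ`, where `P j` is the law given that the chain starts at `j`. -/
noncomputable def endMean {n : ℕ} (P : Fin (n + 1) → Measure Ω) (τ : Ω → ℝ≥0∞) : ℝ :=
  mean τ (P 0) + mean τ (P (Fin.last n))

/-- `(Var_0 τ + Var_n τ)^{1/2}`, where `P j` is the law given that the chain starts at `j`. -/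
noncomputable def endDev {n : ℕ} (P : Fin (n + 1) → Measure Ω) (τ : Ω → ℝ≥0∞) : ℝ :=
  Real.sqrt (var τ (P 0) + var τ (P (Fin.last n)))

end Processes

end BDCutoff

/-! Write `h` for the density of the point mass at `0` minus one (`startDensity`). Reversibility
turns `1 - A(0,x)/μ(x)` into `-(A h)(x)` for every transition operator `A` reversible for `μ`. If
`A` also preserves decreasing functions, the maximum over `x` sits at the right end, so separation
equals `-(A h)(n)` (`MonotoneOp.sep_eq`). Under the hypothesis of part 2 this applies to the powers
of `K`. It always applies to the heat semigroup, which is a Poisson mixture of powers of the lazy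
chain `(I + K)/2`.

Separation then behaves like the tail function of a random time, whose iterated integrals or sums
come from solving `(I - K) u = h` and `(I - K) z = u` (`exists_potentials`). The mean is `sepMean`;
the variance is `sepVar` in continuous time and `sepVar - sepMean` in discrete time. Chebyshev's
inequality places the mixing times within a constant multiple of the standard deviation of
`sepMean`, up to rounding in discrete time.

All quantities are computed in edge coordinates. A mean zero function is determined by its gradient
`d`; its squared norm is the quadratic form of `cov` at `d`, and its Dirichlet form is `∑ flow * d ^
2`. The gap `λ` is therefore the inverse of the top of `cov` relative to `flow` (`gap_spec`). The
means and variances of the hitting times of `M` are also edge sums, `hitMean` and `hitVar`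
(`exists_hitting_potentials`, `end_moments`).

The link between the two pictures is `hitMean = sepMean + meanGap`, with `meanGap` bounded both by a
multiple of `1/λ` and by a multiple of the square root of `hitVar`, together with `sepVar ≤ hitVar +
meanGap ^ 2`. The mass condition on `M` and the Poincaré inequality give `λ * hitVar ≤ (2/δ) *
hitMean`, while `1 ≤ λ ^ 2 * sepVar`. Hence `b ^ 2` lies between constant multiples of `1/λ ^ 2` and
`s/λ`, and `s λ → ∞` is equivalent to `s / b → ∞`. Conversely, separation is at least `exp (-t λ)`;
if `s λ` stayed bounded along a subsequence, mixing times at small levels would be too large for a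
cutoff (`tendsto_of_hasCutoff`). -/

namespace BDCutoff

/-! ### Gradients of functions on a path -/

section Path

variable {n : ℕ}

/-- The decrease of `f` across the edge `{i, i+1}`. -/
def grad (f : Fin (n + 1) → ℝ) (i : Fin n) : ℝ := f i.castSucc - f i.succ

/-- The indicator function of the vertices on the left of the edge `{i, i+1}`. -/
def below (i : Fin n) (j : Fin (n + 1)) : ℝ := if j ≤ i.castSucc then 1 else 0

/-- The mass on the left of the edge `{i, i+1}`. -/
def cum (μ : Fin (n + 1) → ℝ) (i : Fin n) : ℝ := ∑ j, μ j * below i j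

lemma below_nonneg (i : Fin n) (j : Fin (n + 1)) : 0 ≤ below i j := by
  unfold below; split_ifs <;> norm_num

lemma below_le_one (i : Fin n) (j : Fin (n + 1)) : below i j ≤ 1 := by
  unfold below; split_ifs <;> norm_num

lemma below_last (i : Fin n) : below i (Fin.last n) = 0 := by
  have : ¬ Fin.last n ≤ i.castSucc := not_le.2 (Fin.castSucc_lt_last i)
  simp [below, this]

lemma below_zero (i : Fin n) : below i 0 = 1 := by simp [below]

lemma below_castSucc (i j : Fin n) :
    below i j.castSucc = below i j.succ + if i = j then 1 else 0 := by
  unfold below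
  simp only [Fin.le_def, Fin.val_castSucc, Fin.val_succ, Fin.ext_iff]
  split_ifs <;> first | omega | norm_num

lemma grad_below (i k : Fin n) : grad (below i) k = if i = k then 1 else 0 := by
  rw [grad, below_castSucc]; ring

lemma eq_last_add_sum_grad (f : Fin (n + 1) → ℝ) (j : Fin (n + 1)) :
    f j = f (Fin.last n) + ∑ i, below i j * grad f i := by
  induction j using Fin.reverseInduction with
  | last => simp [below_last]
  | cast j ih =>
    have : f j.castSucc = f j.succ + grad f j := by simp [grad]
    rw [this, ih]
    simp [below_castSucc, add_mul, Finset.sum_add_distrib, add_assoc]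

/-- The function with gradient `d` that vanishes at the right end. -/
def potential (d : Fin n → ℝ) (j : Fin (n + 1)) : ℝ := ∑ i, below i j * d i

lemma grad_potential (d : Fin n → ℝ) (i : Fin n) : grad (potential d) i = d i := by
  simp [grad, potential, below_castSucc, add_mul, Finset.sum_add_distrib]

lemma grad_add_const (f : Fin (n + 1) → ℝ) (a : ℝ) (i : Fin n) :
    grad (fun j => f j + a) i = grad f i := by simp [grad]

lemma exists_grad_eq (d : Fin n → ℝ) (k : Fin (n + 1)) :
    ∃ f : Fin (n + 1) → ℝ, (∀ i, grad f i = d i) ∧ f k = 0 :=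
  ⟨fun j => potential d j + -potential d k,
    fun i => by rw [grad_add_const, grad_potential], by ring⟩

lemma antitone_iff_grad_nonneg {f : Fin (n + 1) → ℝ} : Antitone f ↔ ∀ i, 0 ≤ grad f i := by
  simp [Fin.antitone_iff_succ_le, grad]

/-- Expansion of a nearest neighbour double array along the edges. -/
lemma sum_eq_sum_edges {Ψ : Fin (n + 1) → Fin (n + 1) → ℝ} (hd : ∀ x, Ψ x x = 0)
    (hn : ∀ x y : Fin (n + 1), (x : ℕ) + 1 < y ∨ (y : ℕ) + 1 < x → Ψ x y = 0) (x : Fin (n + 1)) :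
    ∑ y, Ψ x y = ∑ i : Fin n, ((if x = i.castSucc then Ψ i.castSucc i.succ else 0) +
      if x = i.succ then Ψ i.succ i.castSucc else 0) := by
  have key : ∀ y, Ψ x y = ∑ i : Fin n,
      ((if y = i.succ then if x = i.castSucc then Ψ i.castSucc i.succ else 0 else 0) +
        if y = i.castSucc then if x = i.succ then Ψ i.succ i.castSucc else 0 else 0) := by
    intro y
    rcases lt_trichotomy x y with h | h | h
    · obtain ⟨i, rfl⟩ := Fin.exists_succ_eq.2 (Fin.ne_zero_of_lt h)
      rw [Finset.sum_eq_single i]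
      · by_cases hx : x = i.castSucc
        · subst hx
          simp [Fin.ext_iff]
        · rw [hn]
          · simp [hx]
            intro h1; simp [Fin.ext_iff] at h1
          · simp only [Fin.lt_def, Fin.ext_iff, Fin.val_castSucc, Fin.val_succ] at *; omega
      · intro k _ hk
        have h1 : ¬ i.succ = k.succ := fun e => hk (Fin.succ_injective _ e).symm
        have h2 : ¬ (i.succ = k.castSucc ∧ x = k.succ) := by
          rintro ⟨h3, h4⟩
          simp only [Fin.lt_def, Fin.ext_iff, Fin.val_castSucc, Fin.val_succ] at *; omega
        simp only [h1, if_false, zero_add]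
        split_ifs with h3 h4
        · exact absurd ⟨h3, h4⟩ h2
        all_goals rfl
      · simp
    · subst h
      rw [hd, Finset.sum_eq_zero]
      intro i _
      split_ifs with h1 h2 h3 <;> try simp
      all_goals
        simp only [Fin.ext_iff, Fin.val_castSucc, Fin.val_succ] at *
        omega
    · obtain ⟨i, rfl⟩ := Fin.exists_succ_eq.2 (Fin.ne_zero_of_lt h)
      rw [Finset.sum_eq_single i]
      · by_cases hx : y = i.castSucc
        · subst hx
          simp [Fin.ext_iff]
        · rw [hn]
          · simp [hx]
            intro _ h1; simp [Fin.ext_iff] at h1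
          · simp only [Fin.lt_def, Fin.ext_iff, Fin.val_castSucc, Fin.val_succ] at *; omega
      · intro k _ hk
        have h1 : ¬ i.succ = k.succ := fun e => hk (Fin.succ_injective _ e).symm
        have h2 : ¬ (y = k.succ ∧ i.succ = k.castSucc) := by
          rintro ⟨h3, h4⟩
          simp only [Fin.lt_def, Fin.ext_iff, Fin.val_castSucc, Fin.val_succ] at *; omega
        simp only [h1, if_false]
        by_cases h3 : y = k.succ
        · have h4 : ¬ i.succ = k.castSucc := fun h4 => h2 ⟨h3, h4⟩
          simp [h4]
        · simp [h3]
      · simp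
  rw [Finset.sum_congr rfl fun y _ => key y, Finset.sum_comm]
  refine Finset.sum_congr rfl fun i _ => ?_
  rw [Finset.sum_add_distrib]
  simp

end Path

/-! ### Reversible birth and death chains -/

/-- A birth and death chain all of whose nearest neighbour steps are possible, together with its
reversible probability measure. -/
structure Chain {n : ℕ} (K : Matrix (Fin (n + 1)) (Fin (n + 1)) ℝ) (μ : Fin (n + 1) → ℝ) :
    Prop where
  nonneg : ∀ x y, 0 ≤ K x y
  row_sum : ∀ x, ∑ y, K x y = 1
  nearest : ∀ i j : Fin (n + 1), (i : ℕ) + 1 < j ∨ (j : ℕ) + 1 < i → K i j = 0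
  up_pos : ∀ i : Fin n, 0 < K i.castSucc i.succ
  down_pos : ∀ i : Fin n, 0 < K i.succ i.castSucc
  pos : ∀ x, 0 < μ x
  sum_eq_one : ∑ x, μ x = 1
  balance : ∀ i : Fin n, μ i.castSucc * K i.castSucc i.succ = μ i.succ * K i.succ i.castSucc

section Generator

variable {n : ℕ} {K : Matrix (Fin (n + 1)) (Fin (n + 1)) ℝ} {μ : Fin (n + 1) → ℝ}

/-- The generator `I - K` acting on functions. -/
def gen (K : Matrix (Fin (n + 1)) (Fin (n + 1)) ℝ) (f : Fin (n + 1) → ℝ) : Fin (n + 1) → ℝ :=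
  Matrix.mulVec (1 - K) f

lemma gen_eq (K : Matrix (Fin (n + 1)) (Fin (n + 1)) ℝ) (f : Fin (n + 1) → ℝ)
    (x : Fin (n + 1)) : gen K f x = f x - Matrix.mulVec K f x := by
  simp [gen, Matrix.sub_mulVec]

lemma gen_eq_sum_grad (hrow : ∀ x, ∑ y, K x y = 1)
    (hnear : ∀ i j : Fin (n + 1), (i : ℕ) + 1 < j ∨ (j : ℕ) + 1 < i → K i j = 0)
    (f : Fin (n + 1) → ℝ) (x : Fin (n + 1)) :
    gen K f x = ∑ i : Fin n, grad f i * ((if x = i.castSucc then K i.castSucc i.succ else 0) -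
      if x = i.succ then K i.succ i.castSucc else 0) := by
  have h1 : gen K f x = ∑ y, K x y * (f x - f y) := by
    rw [gen_eq]
    simp only [mul_sub, Finset.sum_sub_distrib, ← Finset.sum_mul, hrow, one_mul]
    rfl
  rw [h1, sum_eq_sum_edges (Ψ := fun x y => K x y * (f x - f y))]
  · refine Finset.sum_congr rfl fun i _ => ?_
    unfold grad
    split_ifs <;> ring
  · simp
  · intro x y h
    simp [hnear x y h]

/-- The chain of an irreducible birth and death matrix and its stationary law. -/
theorem Chain.of_irreducible (hK : IsBirthDeath K) (hirr : K.IsIrreducible)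
    (hμ : IsStationary K μ) : Chain K μ := by
  have hnn : ∀ x y, 0 ≤ K x y := fun x y => Matrix.nonneg_of_mem_rowStochastic hK.stochastic
  have hrow : ∀ x, ∑ y, K x y = 1 := Matrix.sum_row_of_mem_rowStochastic hK.stochastic
  have hpow := (Matrix.isIrreducible_iff_exists_pow_pos hnn).1 hirr
  -- Irreducibility enters only through this: a set of states that the chain cannot leave is empty
  -- or everything.
  have closed : ∀ S : Fin (n + 1) → Prop, (∀ x y, S x → ¬ S y → K x y = 0) →
      ∀ x y, S x → ¬ S y → False := by
    intro S hS x y hx hy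
    obtain ⟨k, -, hk⟩ := hpow x y
    have : ∀ k x, S x → (K ^ k) x y = 0 := by
      intro k
      induction k with
      | zero =>
        intro x hx
        rw [pow_zero, Matrix.one_apply_ne]
        rintro rfl; exact hy hx
      | succ k ih =>
        intro x hx
        rw [pow_succ', Matrix.mul_apply]
        refine Finset.sum_eq_zero fun z _ => ?_
        by_cases hz : S z
        · rw [ih z hz, mul_zero]
        · rw [hS x z hx hz, zero_mul]
    exact hk.ne' (this k x hx)
  have hup : ∀ i : Fin n, 0 < K i.castSucc i.succ := by
    intro i
    refine lt_of_le_of_ne (hnn _ _) fun h0 => ?_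
    refine closed (fun x => x ≤ i.castSucc) ?_ i.castSucc i.succ le_rfl (by simp)
    intro x y hx hy
    by_cases h : (x : ℕ) + 1 < y
    · exact hK.nearest x y (Or.inl h)
    · have h1 : x = i.castSucc := by
        simp only [Fin.le_def, Fin.ext_iff, Fin.val_castSucc] at *; omega
      have h2 : y = i.succ := by
        simp only [Fin.le_def, Fin.ext_iff, Fin.val_castSucc, Fin.val_succ] at *; omega
      rw [h1, h2, ← h0]
  have hdown : ∀ i : Fin n, 0 < K i.succ i.castSucc := by
    intro i
    refine lt_of_le_of_ne (hnn _ _) fun h0 => ?_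
    refine closed (fun x => i.succ ≤ x) ?_ i.succ i.castSucc le_rfl (by simp)
    intro x y hx hy
    by_cases h : (y : ℕ) + 1 < x
    · exact hK.nearest x y (Or.inr h)
    · have h1 : x = i.succ := by
        simp only [Fin.le_def, Fin.ext_iff, Fin.val_succ] at *; omega
      have h2 : y = i.castSucc := by
        simp only [Fin.le_def, Fin.ext_iff, Fin.val_castSucc, Fin.val_succ] at *; omega
      rw [h1, h2, ← h0]
  -- Stationarity is tested against the indicator of the left side of an edge. Its image under the
  -- generator lives on the two ends of that edge, which yields detailed balance there.
  have hbal : ∀ i : Fin n,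
      μ i.castSucc * K i.castSucc i.succ = μ i.succ * K i.succ i.castSucc := by
    intro k
    have h1 : ∑ x, μ x * gen K (below k) x = 0 := by
      have : ∑ x, μ x * Matrix.mulVec K (below k) x = ∑ x, μ x * below k x := by
        change μ ⬝ᵥ Matrix.mulVec K (below k) = μ ⬝ᵥ below k
        rw [Matrix.dotProduct_mulVec, hμ.invariant]
      simp only [gen_eq, mul_sub, Finset.sum_sub_distrib, this, sub_self]
    have h2 : ∀ x, gen K (below k) x = (if x = k.castSucc then K k.castSucc k.succ else 0) -
        if x = k.succ then K k.succ k.castSucc else 0 := by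
      intro x
      rw [gen_eq_sum_grad hrow hK.nearest]
      simp [grad_below]
    simp only [h2, mul_sub, Finset.sum_sub_distrib, mul_ite, mul_zero, Finset.sum_ite_eq',
      Finset.mem_univ, if_true] at h1
    linarith
  refine ⟨hnn, hrow, hK.nearest, hup, hdown, ?_, hμ.sum_eq_one, hbal⟩
  have hz : ∀ i : Fin n, μ i.castSucc = 0 ↔ μ i.succ = 0 := by
    intro i
    have := hbal i
    constructor <;> intro h <;> rw [h, zero_mul] at this
    · exact (mul_eq_zero.1 this.symm).resolve_right (hdown i).ne'
    · exact (mul_eq_zero.1 this).resolve_right (hup i).ne'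
  have hz0 : ∀ x, μ x = 0 ↔ μ 0 = 0 := by
    intro x
    induction x using Fin.induction with
    | zero => rfl
    | succ i ih => rw [← ih, hz]
  intro x
  refine lt_of_le_of_ne (hμ.nonneg x) fun h => ?_
  have h0 := (hz0 x).1 h.symm
  have := hμ.sum_eq_one
  rw [Finset.sum_eq_zero fun y _ => (hz0 y).2 h0] at this
  exact zero_ne_one this

end Generator

/-! ### Edge coordinates: flow, covariance form and the equation `(I - K) f = y`. -/

section Cov

variable {n : ℕ} {K : Matrix (Fin (n + 1)) (Fin (n + 1)) ℝ} {μ : Fin (n + 1) → ℝ}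

/-- The stationary flow across the edge `{i, i+1}`. -/
def flow (K : Matrix (Fin (n + 1)) (Fin (n + 1)) ℝ) (μ : Fin (n + 1) → ℝ) (i : Fin n) : ℝ :=
  μ i.castSucc * K i.castSucc i.succ

/-- The covariance under `μ` of the indicator functions of the left sides of two edges. -/
def cov (μ : Fin (n + 1) → ℝ) (i k : Fin n) : ℝ :=
  min (cum μ i) (cum μ k) * (1 - max (cum μ i) (cum μ k))

lemma cov_symm (i k : Fin n) : cov μ i k = cov μ k i := by
  rw [cov, cov, min_comm, max_comm]

/-- Trace of the inverse of `I - K` on mean zero functions, in terms of flow and covariance. -/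
noncomputable def sepMean (K : Matrix (Fin (n + 1)) (Fin (n + 1)) ℝ)
    (μ : Fin (n + 1) → ℝ) : ℝ :=
  ∑ i, cum μ i * (1 - cum μ i) / flow K μ i

/-- Trace of the squared inverse of `I - K` on mean zero functions. -/
noncomputable def sepVar (K : Matrix (Fin (n + 1)) (Fin (n + 1)) ℝ)
    (μ : Fin (n + 1) → ℝ) : ℝ :=
  ∑ i, ∑ k, cov μ i k ^ 2 / (flow K μ i * flow K μ k)

/-- The density of the point mass at `0` with respect to `μ`, minus one. -/
noncomputable def startDensity (μ : Fin (n + 1) → ℝ) (j : Fin (n + 1)) : ℝ :=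
  (if j = 0 then 1 / μ 0 else 0) - 1

namespace Chain

lemma flow_pos (hC : Chain K μ) (i : Fin n) : 0 < flow K μ i := mul_pos (hC.pos _) (hC.up_pos i)

lemma flow_eq (hC : Chain K μ) (i : Fin n) : flow K μ i = μ i.succ * K i.succ i.castSucc :=
  hC.balance i

lemma le_one (hC : Chain K μ) (x y : Fin (n + 1)) : K x y ≤ 1 := by
  rw [← hC.row_sum x]
  exact Finset.single_le_sum (fun z _ => hC.nonneg x z) (Finset.mem_univ y)

lemma le_cum (hC : Chain K μ) (i : Fin n) : μ i.castSucc ≤ cum μ i := by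
  have := Finset.single_le_sum (f := fun j => μ j * below i j)
    (fun j _ => mul_nonneg (hC.pos j).le (below_nonneg i j)) (Finset.mem_univ i.castSucc)
  simpa [cum, below] using this

lemma one_sub_cum (hC : Chain K μ) (i : Fin n) : 1 - cum μ i = ∑ j, μ j * (1 - below i j) := by
  simp only [mul_sub, Finset.sum_sub_distrib, mul_one, hC.sum_eq_one, cum]

lemma le_one_sub_cum (hC : Chain K μ) (i : Fin n) : μ i.succ ≤ 1 - cum μ i := by
  rw [hC.one_sub_cum]
  have := Finset.single_le_sum (f := fun j => μ j * (1 - below i j))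
    (fun j _ => mul_nonneg (hC.pos j).le (sub_nonneg.2 (below_le_one i j)))
    (Finset.mem_univ i.succ)
  have h : ¬ i.succ ≤ i.castSucc := by simp
  simpa [below, h] using this

lemma cum_pos (hC : Chain K μ) (i : Fin n) : 0 < cum μ i := (hC.pos _).trans_le (hC.le_cum i)

lemma cum_lt_one (hC : Chain K μ) (i : Fin n) : cum μ i < 1 := by
  have := (hC.pos _).trans_le (hC.le_one_sub_cum i)
  linarith

lemma flow_le_cum (hC : Chain K μ) (i : Fin n) : flow K μ i ≤ cum μ i :=
  (mul_le_of_le_one_right (hC.pos _).le (hC.le_one _ _)).trans (hC.le_cum i)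

lemma flow_le_one_sub_cum (hC : Chain K μ) (i : Fin n) : flow K μ i ≤ 1 - cum μ i := by
  rw [hC.flow_eq]
  exact (mul_le_of_le_one_right (hC.pos _).le (hC.le_one _ _)).trans (hC.le_one_sub_cum i)

lemma cum_mono (hC : Chain K μ) : Monotone (cum μ) := by
  intro i k h
  refine Finset.sum_le_sum fun j _ => mul_le_mul_of_nonneg_left ?_ (hC.pos j).le
  unfold below
  split_ifs with h1 h2 <;> norm_num
  exact h2 (h1.trans (Fin.castSucc_le_castSucc_iff.2 h))

lemma cov_pos (hC : Chain K μ) (i k : Fin n) : 0 < cov μ i k :=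
  mul_pos (lt_min (hC.cum_pos i) (hC.cum_pos k))
    (sub_pos.2 (max_lt (hC.cum_lt_one i) (hC.cum_lt_one k)))

lemma sum_below_mul_below (hC : Chain K μ) (i k : Fin n) :
    ∑ j, μ j * below i j * below k j = min (cum μ i) (cum μ k) := by
  wlog h : i ≤ k generalizing i k
  · rw [min_comm, ← this k i (le_of_not_ge h)]
    exact Finset.sum_congr rfl fun j _ => by ring
  rw [min_eq_left (hC.cum_mono h)]
  refine Finset.sum_congr rfl fun j _ => ?_
  unfold below
  have := Fin.castSucc_le_castSucc_iff.2 h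
  split_ifs with h1 h2 <;> norm_num
  exact absurd (h1.trans this) h2

lemma cov_eq (hC : Chain K μ) (i k : Fin n) :
    cov μ i k = ∑ j, μ j * below i j * (below k j - cum μ k) := by
  simp only [mul_sub, Finset.sum_sub_distrib, hC.sum_below_mul_below, ← Finset.sum_mul]
  change _ = _ - cum μ i * cum μ k
  rw [← min_mul_max (cum μ i), cov]; ring

/-- The mean zero condition fixes the additive constant left free by the gradient. -/
lemma eq_sum_of_mean_zero (hC : Chain K μ) {f : Fin (n + 1) → ℝ} (hf : ∑ j, μ j * f j = 0)
    (j : Fin (n + 1)) : f j = ∑ k, (below k j - cum μ k) * grad f k := by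
  have h1 : f (Fin.last n) = - ∑ k, cum μ k * grad f k := by
    have h : ∀ j, μ j * f j =
        μ j * f (Fin.last n) + ∑ k, μ j * below k j * grad f k := by
      intro j
      rw [eq_last_add_sum_grad f j, mul_add, Finset.mul_sum]
      simp only [mul_assoc]
    rw [Finset.sum_congr rfl fun j _ => h j, Finset.sum_add_distrib, ← Finset.sum_mul,
      hC.sum_eq_one, Finset.sum_comm] at hf
    simp only [← Finset.sum_mul] at hf
    simp only [cum]
    linarith
  rw [eq_last_add_sum_grad f j, h1]
  simp only [sub_mul, Finset.sum_sub_distrib]; ring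

/-- Thus `cov` is the matrix that takes the gradient of `f` to the masses of `μ f` on the left of
the edges. -/
lemma sum_mul_below (hC : Chain K μ) {f : Fin (n + 1) → ℝ} (hf : ∑ j, μ j * f j = 0)
    (i : Fin n) : ∑ j, μ j * f j * below i j = ∑ k, cov μ i k * grad f k := by
  simp only [hC.cov_eq, Finset.sum_mul]
  rw [Finset.sum_comm]
  refine Finset.sum_congr rfl fun j _ => ?_
  rw [hC.eq_sum_of_mean_zero hf j, Finset.mul_sum, Finset.sum_mul]
  exact Finset.sum_congr rfl fun k _ => by ring

lemma sum_mul_sq (hC : Chain K μ) {f : Fin (n + 1) → ℝ} (hf : ∑ j, μ j * f j = 0) :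
    ∑ j, μ j * f j ^ 2 = ∑ i, ∑ k, cov μ i k * grad f i * grad f k := by
  have h : ∀ i, ∑ k, cov μ i k * grad f i * grad f k =
      ∑ j, μ j * f j * below i j * grad f i := by
    intro i
    rw [← Finset.sum_mul, hC.sum_mul_below hf, Finset.sum_mul]
    exact Finset.sum_congr rfl fun k _ => by ring
  rw [Finset.sum_congr rfl fun i _ => h i, Finset.sum_comm]
  have h2 : ∀ j, ∑ i, μ j * f j * below i j * grad f i = μ j * f j * (f j - f (Fin.last n)) := by
    intro j
    rw [show f j - f (Fin.last n) = ∑ i, below i j * grad f i by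
      rw [eq_last_add_sum_grad f j]; ring, Finset.mul_sum]
    exact Finset.sum_congr rfl fun k _ => by ring
  simp only [h2, mul_sub, Finset.sum_sub_distrib, ← Finset.sum_mul, hf, zero_mul, sub_zero]
  exact Finset.sum_congr rfl fun k _ => by ring

lemma gen_eq_sum_grad (hC : Chain K μ) (f : Fin (n + 1) → ℝ) (x : Fin (n + 1)) :
    gen K f x = ∑ i : Fin n, grad f i * ((if x = i.castSucc then K i.castSucc i.succ else 0) -
      if x = i.succ then K i.succ i.castSucc else 0) :=
  BDCutoff.gen_eq_sum_grad hC.row_sum hC.nearest f x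

lemma mul_gen (hC : Chain K μ) (f : Fin (n + 1) → ℝ) (x : Fin (n + 1)) :
    μ x * gen K f x = ∑ i, flow K μ i * grad f i * grad (Pi.single x 1) i := by
  rw [hC.gen_eq_sum_grad, Finset.mul_sum]
  refine Finset.sum_congr rfl fun i _ => ?_
  simp only [grad, Pi.single_apply, eq_comm (a := x)]
  have := hC.flow_eq i
  split_ifs with h1 h2 h2
  · exact absurd (h1.trans h2.symm) (by simp [Fin.ext_iff])
  · rw [flow, h1]; ring
  · rw [this, h2]; ring
  · ring

lemma sum_gen_mul (hC : Chain K μ) (f g : Fin (n + 1) → ℝ) :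
    ∑ x, μ x * gen K f x * g x = ∑ i, flow K μ i * grad f i * grad g i := by
  simp only [hC.mul_gen, Finset.sum_mul]
  rw [Finset.sum_comm]
  refine Finset.sum_congr rfl fun i _ => ?_
  simp only [mul_assoc, ← Finset.mul_sum]
  congr 2
  simp [grad, Pi.single_apply, sub_mul, Finset.sum_sub_distrib]

/-- On a path the equation `(I - K) f = y` decouples over the edges: the current `flow * grad f`
across an edge must carry the total source `μ y` lying on its left. -/
lemma gen_eq_of_grad (hC : Chain K μ) {f y : Fin (n + 1) → ℝ} (hy : ∑ j, μ j * y j = 0)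
    (h : ∀ i, grad f i = (∑ j, μ j * y j * below i j) / flow K μ i) : gen K f = y := by
  funext x
  have h1 : μ x * gen K f x = μ x * y x := by
    rw [hC.mul_gen]
    have : ∀ i, flow K μ i * grad f i * grad (Pi.single x 1) i =
        ∑ j, μ j * y j * (below i j * grad (Pi.single x 1) i) := by
      intro i
      rw [h, mul_div_cancel₀ _ (hC.flow_pos i).ne', Finset.sum_mul]
      simp only [mul_assoc]
    rw [Finset.sum_congr rfl fun i _ => this i, Finset.sum_comm]
    simp only [← Finset.mul_sum]
    have h2 : ∀ j, ∑ i, below i j * grad (Pi.single x (1 : ℝ)) i =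
        (Pi.single x (1 : ℝ) : Fin (n + 1) → ℝ) j -
          (Pi.single x (1 : ℝ) : Fin (n + 1) → ℝ) (Fin.last n) := by
      intro j
      rw [eq_last_add_sum_grad (Pi.single x 1) j]; ring
    simp only [h2, mul_sub, Finset.sum_sub_distrib, ← Finset.sum_mul, hy, zero_mul, sub_zero]
    simp [Pi.single_apply]
  exact mul_left_cancel₀ (hC.pos x).ne' h1

lemma sum_mul_gen (hC : Chain K μ) (f : Fin (n + 1) → ℝ) : ∑ x, μ x * gen K f x = 0 := by
  have := hC.sum_gen_mul f (fun _ => 1)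
  simpa [grad] using this

/-! ### The potentials governing the separation from the left end -/

lemma exists_mean_zero_grad (hC : Chain K μ) (d : Fin n → ℝ) :
    ∃ f : Fin (n + 1) → ℝ, (∀ i, grad f i = d i) ∧ ∑ j, μ j * f j = 0 := by
  refine ⟨fun j => potential d j + -∑ j, μ j * potential d j,
    fun i => by rw [grad_add_const, grad_potential], ?_⟩
  simp only [mul_add, Finset.sum_add_distrib, ← Finset.sum_mul, hC.sum_eq_one]
  ring

/-- The functions `u` and `z` generate the iterated sums or integrals of the separation function,
and their values at the right end are its moments. -/
lemma exists_potentials (hC : Chain K μ) :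
    ∃ u z : Fin (n + 1) → ℝ, Antitone (startDensity μ) ∧ Antitone u ∧ Antitone z ∧
      ∑ j, μ j * startDensity μ j = 0 ∧ ∑ j, μ j * u j = 0 ∧ ∑ j, μ j * z j = 0 ∧
      gen K u = startDensity μ ∧ gen K z = u ∧
      -u (Fin.last n) = sepMean K μ ∧ 2 * -z (Fin.last n) = sepVar K μ + sepMean K μ ^ 2 := by
  have hh : ∑ j, μ j * startDensity μ j = 0 := by
    simp [startDensity, mul_sub, hC.sum_eq_one, (hC.pos 0).ne']
  have hha : Antitone (startDensity μ) := by
    intro a b hab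
    have := (hC.pos 0)
    unfold startDensity
    split_ifs with h1 h2 h2
    · exact le_rfl
    · exact absurd (le_antisymm (hab.trans h1.le) (Fin.zero_le a)) h2
    · have : 0 < 1 / μ 0 := by positivity
      linarith
    · exact le_rfl
  have hhb : ∀ i : Fin n, ∑ j, μ j * startDensity μ j * below i j = 1 - cum μ i := by
    intro i
    simp [startDensity, mul_sub, sub_mul, below_zero, (hC.pos 0).ne', cum]
  obtain ⟨u, hug, hu0⟩ := hC.exists_mean_zero_grad (fun i => (1 - cum μ i) / flow K μ i)
  have hRu := hC.sum_mul_below hu0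
  simp only [hug] at hRu
  obtain ⟨z, hzg, hz0⟩ := hC.exists_mean_zero_grad
    (fun i => (∑ k, cov μ i k * ((1 - cum μ k) / flow K μ k)) / flow K μ i)
  have hq : ∀ i : Fin n, 0 < 1 - cum μ i := fun i => sub_pos.2 (hC.cum_lt_one i)
  refine ⟨u, z, hha, ?_, ?_, hh, hu0, hz0, ?_, ?_, ?_, ?_⟩
  · refine antitone_iff_grad_nonneg.2 fun i => ?_
    rw [hug]; exact div_nonneg (hq i).le (hC.flow_pos i).le
  · refine antitone_iff_grad_nonneg.2 fun i => ?_
    rw [hzg]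
    exact div_nonneg (Finset.sum_nonneg fun k _ => mul_nonneg (hC.cov_pos i k).le
      (div_nonneg (hq k).le (hC.flow_pos k).le)) (hC.flow_pos i).le
  · exact hC.gen_eq_of_grad hh fun i => by rw [hug, hhb]
  · exact hC.gen_eq_of_grad hu0 fun i => by rw [hzg, hRu]
  · rw [hC.eq_sum_of_mean_zero hu0, sepMean, ← Finset.sum_neg_distrib]
    refine Finset.sum_congr rfl fun i _ => ?_
    rw [hug, below_last]; ring
  · have h1 : -z (Fin.last n) = ∑ i, ∑ k,
        cum μ i * (1 - cum μ k) * cov μ i k / (flow K μ i * flow K μ k) := by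
      rw [hC.eq_sum_of_mean_zero hz0, ← Finset.sum_neg_distrib]
      refine Finset.sum_congr rfl fun i _ => ?_
      rw [hzg, below_last, Finset.sum_div, Finset.mul_sum, ← Finset.sum_neg_distrib]
      refine Finset.sum_congr rfl fun k _ => ?_
      have := (hC.flow_pos i).ne'
      have := (hC.flow_pos k).ne'
      field_simp
      ring
    have h2 : -z (Fin.last n) = ∑ i, ∑ k,
        cum μ k * (1 - cum μ i) * cov μ i k / (flow K μ i * flow K μ k) := by
      rw [h1, Finset.sum_comm]
      refine Finset.sum_congr rfl fun i _ => Finset.sum_congr rfl fun k _ => ?_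
      rw [cov_symm, mul_comm (flow K μ i)]
    rw [two_mul]
    nth_rewrite 1 [h1]
    rw [h2, sepVar, sepMean, sq, Finset.sum_mul_sum, ← Finset.sum_add_distrib,
      ← Finset.sum_add_distrib]
    refine Finset.sum_congr rfl fun i _ => ?_
    rw [← Finset.sum_add_distrib, ← Finset.sum_add_distrib]
    refine Finset.sum_congr rfl fun k _ => ?_
    rw [div_mul_div_comm, ← add_div, ← add_div]
    congr 1
    -- For masses `a ≤ b` the identity is `a(1-b) * (a(1-b) + b(1-a)) = (a(1-b)) ^ 2 + a(1-a) *
    -- b(1-b)`.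
    rcases le_total (cum μ i) (cum μ k) with h | h
    · rw [cov, min_eq_left h, max_eq_right h]; ring
    · rw [cov, min_eq_right h, max_eq_left h]; ring

end Chain

end Cov

/-! ### The spectral gap -/

/-- The top of a symmetric positive quadratic form relative to a diagonal one, attained at a
nonnegative vector. -/
lemma exists_top_eigenvector {ι : Type*} [Fintype ι] [DecidableEq ι] [Nonempty ι]
    {C : ι → ι → ℝ} {w : ι → ℝ} (hCs : ∀ i k, C i k = C k i) (hCp : ∀ i k, 0 < C i k)
    (hw : ∀ i, 0 < w i) :
    ∃ (β : ℝ) (g : ι → ℝ), 0 < β ∧ (∀ i, 0 ≤ g i) ∧ g ≠ 0 ∧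
      (∀ i, ∑ k, C i k * g k = β * (w i * g i)) ∧
      ∀ d : ι → ℝ, ∑ i, ∑ k, C i k * d i * d k ≤ β * ∑ i, w i * d i ^ 2 := by
  set B : (ι → ℝ) → ℝ := fun d => ∑ i, ∑ k, C i k * d i * d k with hB
  set E : (ι → ℝ) → ℝ := fun d => ∑ i, w i * d i ^ 2 with hE
  have hBc : Continuous B := by fun_prop
  have hEc : Continuous E := by fun_prop
  have hE0 : ∀ d, 0 ≤ E d := fun d =>
    Finset.sum_nonneg fun i _ => mul_nonneg (hw i).le (sq_nonneg _)
  have hEpos : ∀ d, d ≠ 0 → 0 < E d := by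
    intro d hd
    obtain ⟨i, hi⟩ := Function.ne_iff.1 hd
    exact Finset.sum_pos' (fun i _ => mul_nonneg (hw i).le (sq_nonneg _))
      ⟨i, Finset.mem_univ i, mul_pos (hw i) (sq_pos_of_ne_zero hi)⟩
  have hBs : ∀ (a : ℝ) d, B (a • d) = a ^ 2 * B d := by
    intro a d
    simp only [hB, Pi.smul_apply, smul_eq_mul, Finset.mul_sum]
    exact Finset.sum_congr rfl fun i _ => Finset.sum_congr rfl fun k _ => by ring
  have hEs : ∀ (a : ℝ) d, E (a • d) = a ^ 2 * E d := by
    intro a d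
    simp only [hE, Pi.smul_apply, smul_eq_mul, Finset.mul_sum]
    exact Finset.sum_congr rfl fun i _ => by ring
  have hcomp : IsCompact {d | E d = 1} := by
    refine (isCompact_univ_pi fun i => isCompact_Icc (a := -(1 / w i + 1))
      (b := 1 / w i + 1)).of_isClosed_subset (isClosed_eq hEc continuous_const) ?_
    intro d hd i _
    have h1 : w i * d i ^ 2 ≤ 1 := by
      rw [← show E d = 1 from hd]
      exact Finset.single_le_sum (f := fun i => w i * d i ^ 2)
        (fun i _ => mul_nonneg (hw i).le (sq_nonneg _)) (Finset.mem_univ i)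
    have h2 : d i ^ 2 ≤ 1 / w i := by
      rw [le_div_iff₀ (hw i)]; linarith
    have h3 : 0 < 1 / w i := one_div_pos.2 (hw i)
    exact abs_le.1 (abs_le_of_sq_le_sq (by nlinarith) (by positivity))
  have hne : {d | E d = 1}.Nonempty := by
    refine ⟨(Real.sqrt (E 1))⁻¹ • 1, ?_⟩
    have : 0 < E 1 := hEpos 1 one_ne_zero
    rw [Set.mem_ofPred_eq, hEs, inv_pow, Real.sq_sqrt this.le, inv_mul_cancel₀ this.ne']
  obtain ⟨g, hg1, hgmax⟩ := hcomp.exists_isMaxOn hne hBc.continuousOn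
  have hg1 : E g = 1 := hg1
  -- All entries of `C` are positive, so passing to absolute values cannot lower the form: a
  -- maximiser may be taken nonnegative, as in Perron–Frobenius.
  set g' : ι → ℝ := fun i => |g i| with hg'
  have hEg' : E g' = 1 := by rw [← hg1]; simp [hE, hg', sq_abs]
  have hBg' : B g ≤ B g' := by
    refine Finset.sum_le_sum fun i _ => Finset.sum_le_sum fun k _ => ?_
    rw [mul_assoc, mul_assoc]
    exact mul_le_mul_of_nonneg_left (by rw [hg', ← abs_mul]; exact le_abs_self _) (hCp i k).le
  have hray : ∀ d, B d ≤ B g' * E d := by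
    intro d
    by_cases hd : d = 0
    · subst hd
      simp [hB, hE]
    have hp := hEpos d hd
    have h1 : E ((Real.sqrt (E d))⁻¹ • d) = 1 := by
      rw [hEs, inv_pow, Real.sq_sqrt hp.le, inv_mul_cancel₀ hp.ne']
    have h2 : B ((Real.sqrt (E d))⁻¹ • d) ≤ B g := hgmax h1
    rw [hBs, inv_pow, Real.sq_sqrt hp.le, inv_mul_le_iff₀ hp] at h2
    nlinarith
  have hgne : g' ≠ 0 := by
    intro h
    rw [h] at hEg'
    simp [hE] at hEg'
  have hβ : 0 < B g' := by
    obtain ⟨i⟩ := ‹Nonempty ι›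
    have h1 : 0 < B 1 := by
      refine Finset.sum_pos (fun i _ => Finset.sum_pos (fun k _ => ?_) ⟨i, Finset.mem_univ i⟩)
        ⟨i, Finset.mem_univ i⟩
      simpa using hCp i k
    have h2 := hray 1
    by_contra h
    nlinarith [hE0 1]
  refine ⟨B g', g', hβ, fun i => abs_nonneg _, hgne, fun i => ?_, hray⟩
  set a : ℝ := B g' * (w i * g' i) - ∑ k, C i k * g' k with ha
  -- Perturbing the maximiser in one coordinate gives a nonnegative quadratic in `t` without
  -- constant term. Its discriminant forces the linear coefficient `a`, the defect in the
  -- eigenvector equation, to vanish.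
  have hvar : ∀ t : ℝ, 0 ≤ (B g' * w i - C i i) * (t * t) + 2 * a * t + 0 := by
    intro t
    have h1 := hray (g' + t • Pi.single i 1)
    have h2 : E (g' + t • Pi.single i 1) = E g' + 2 * t * (w i * g' i) + t * t * w i := by
      have h : ∀ j, w j * (g' + t • Pi.single i (1 : ℝ) : ι → ℝ) j ^ 2 = w j * g' j ^ 2 +
          Pi.single (M := fun _ => ℝ) i (2 * t * (w i * g' i) + t * t * w i) j := by
        intro j
        by_cases hj : j = i
        · subst hj; simp; ring
        · simp [hj]
      simp only [hE]
      rw [Finset.sum_congr rfl fun j _ => h j, Finset.sum_add_distrib, Finset.sum_pi_single']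
      simp only [Finset.mem_univ, if_true]; ring
    have h3 : B (g' + t • Pi.single i 1) =
        B g' + 2 * t * (∑ k, C i k * g' k) + t * t * C i i := by
      have h : ∀ j k, C j k * (g' + t • Pi.single i (1 : ℝ) : ι → ℝ) j *
          (g' + t • Pi.single i (1 : ℝ) : ι → ℝ) k = C j k * g' j * g' k +
          (if j = i then t * (C i k * g' k) else 0) + (if k = i then t * (C i j * g' j) else 0) +
          (if k = i then if j = i then t * t * C i i else 0 else 0) := by
        intro j k
        by_cases hj : j = i <;> by_cases hk : k = i
        · subst hj; subst hk; simp; ring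
        · subst hj; simp [hk]; ring
        · subst hk; simp [hj]; rw [hCs]; ring
        · simp [hj, hk]
      simp only [hB]
      rw [Finset.sum_congr rfl fun j _ => Finset.sum_congr rfl fun k _ => h j k]
      simp only [Finset.sum_add_distrib, Finset.sum_ite_eq', Finset.mem_univ, if_true]
      rw [Finset.sum_comm (f := fun j k => if j = i then t * (C i k * g' k) else 0)]
      simp only [Finset.sum_ite_eq', Finset.mem_univ, if_true, ← Finset.mul_sum]
      ring
    rw [h2, h3, hEg'] at h1
    rw [ha]
    linarith
  have := discrim_le_zero hvar
  simp only [discrim, mul_zero, sub_zero] at this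
  have h0 : a = 0 := by nlinarith [sq_nonneg a]
  rw [ha] at h0
  linarith

section Gap

variable {n : ℕ} {K : Matrix (Fin (n + 1)) (Fin (n + 1)) ℝ} {μ : Fin (n + 1) → ℝ}

namespace Chain

/-- The spectral gap is positive, it has a decreasing eigenfunction, and it satisfies the
Poincaré inequality. -/
lemma gap_spec (hC : Chain K μ) (hn : 1 ≤ n) :
    0 < spectralGap K ∧
    (∃ f : Fin (n + 1) → ℝ, Antitone f ∧ ∑ j, μ j * f j = 0 ∧ 0 < f 0 ∧
      gen K f = spectralGap K • f ∧
      ∃ i : Fin n, grad f i ≠ 0) ∧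
    ∀ d : Fin n → ℝ, spectralGap K * ∑ i, ∑ k, cov μ i k * d i * d k ≤
      ∑ i, flow K μ i * d i ^ 2 := by
  have : Nonempty (Fin n) := ⟨⟨0, hn⟩⟩
  obtain ⟨β, g, hβ, hg0, hgne, hgeq, hray⟩ :=
    exists_top_eigenvector (C := cov μ) (w := flow K μ) cov_symm hC.cov_pos hC.flow_pos
  obtain ⟨f, hfg, hf0⟩ := hC.exists_mean_zero_grad g
  obtain ⟨i, hi⟩ := Function.ne_iff.1 hgne
  have hfa : Antitone f := antitone_iff_grad_nonneg.2 fun i => by rw [hfg]; exact hg0 i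
  -- The relation `cov g = β * flow * g` says that the current across each edge carries `β⁻¹` times
  -- the mass of `μ f` on its left.
  have hgen : gen K f = β⁻¹ • f := by
    have hmean : ∑ j, μ j * (β⁻¹ • f) j = 0 := by
      simp only [Pi.smul_apply, smul_eq_mul, mul_left_comm _ β⁻¹, ← Finset.mul_sum, hf0, mul_zero]
    refine hC.gen_eq_of_grad hmean fun i => ?_
    have h1 : ∑ j, μ j * (β⁻¹ • f) j * below i j = β⁻¹ * ∑ j, μ j * f j * below i j := by
      rw [Finset.mul_sum]
      exact Finset.sum_congr rfl fun j _ => by rw [Pi.smul_apply, smul_eq_mul]; ring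
    rw [h1, hC.sum_mul_below hf0]
    simp only [hfg, hgeq]
    have := (hC.flow_pos i).ne'
    field_simp
  have hfpos : 0 < f 0 := by
    by_contra hcon
    have hle : ∀ j, f j ≤ 0 := fun j => (hfa (Fin.zero_le j)).trans (not_lt.1 hcon)
    have hz : ∀ j, f j = 0 := by
      intro j
      have := (Finset.sum_eq_zero_iff_of_nonpos fun j _ =>
        mul_nonpos_of_nonneg_of_nonpos (hC.pos j).le (hle j)).1 hf0 j (Finset.mem_univ j)
      exact (mul_eq_zero.1 this).resolve_left (hC.pos j).ne'
    apply hi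
    rw [← hfg i, grad, hz, hz, sub_zero]; rfl
  have hlin : ∀ φ, Matrix.toLin' (1 - K) φ = gen K φ := fun φ => by rw [Matrix.toLin'_apply]; rfl
  have hleast : IsLeast
      {l : ℝ | l ≠ 0 ∧ Module.End.HasEigenvalue (Matrix.toLin' (1 - K)) l} β⁻¹ := by
    constructor
    · refine ⟨(inv_pos.2 hβ).ne', Module.End.hasEigenvalue_of_hasEigenvector (x := f) ⟨?_, ?_⟩⟩
      · rw [Module.End.mem_eigenspace_iff, hlin, hgen]
      · rintro rfl
        exact lt_irrefl _ hfpos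
    · rintro l ⟨hl, hev⟩
      obtain ⟨φ, hφ⟩ := hev.exists_hasEigenvector
      have he : gen K φ = l • φ := by rw [← hlin]; exact hφ.apply_eq_smul
      have hm : ∑ j, μ j * φ j = 0 := by
        have := hC.sum_mul_gen φ
        simp only [he, Pi.smul_apply, smul_eq_mul, mul_left_comm _ l, ← Finset.mul_sum] at this
        exact (mul_eq_zero.1 this).resolve_left hl
      have h1 : l * ∑ j, μ j * φ j ^ 2 = ∑ i, flow K μ i * grad φ i ^ 2 := by
        have := hC.sum_gen_mul φ φ
        rw [he] at this
        rw [Finset.mul_sum]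
        calc _ = ∑ x, μ x * (l • φ) x * φ x :=
              Finset.sum_congr rfl fun j _ => by rw [Pi.smul_apply, smul_eq_mul]; ring
          _ = _ := this.trans (Finset.sum_congr rfl fun j _ => by ring)
      have h2 : 0 < ∑ j, μ j * φ j ^ 2 := by
        obtain ⟨j, hj⟩ := Function.ne_iff.1 hφ.2
        exact Finset.sum_pos' (fun j _ => mul_nonneg (hC.pos j).le (sq_nonneg _))
          ⟨j, Finset.mem_univ j, mul_pos (hC.pos j) (sq_pos_of_ne_zero hj)⟩
      have h3 := hray (grad φ)
      -- The maximality of `β` now reads `‖φ‖² ≤ β * l * ‖φ‖²`, so `l` is at least `β⁻¹`.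
      rw [← hC.sum_mul_sq hm, ← h1] at h3
      rw [inv_le_iff_one_le_mul₀ hβ]
      by_contra hcon
      nlinarith
  have hgap : spectralGap K = β⁻¹ := hleast.csInf_eq
  rw [hgap]
  refine ⟨inv_pos.2 hβ, ⟨f, hfa, hf0, hfpos, hgen, i, by rw [hfg]; exact hi⟩, fun d => ?_⟩
  rw [inv_mul_le_iff₀ hβ]
  exact hray d

end Chain

end Gap

/-! ### Comparison of hitting and separation moments with each other and with the gap. -/

section Hitting

variable {n : ℕ} {K : Matrix (Fin (n + 1)) (Fin (n + 1)) ℝ} {μ : Fin (n + 1) → ℝ}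
  {M : Fin (n + 1)} {δ : ℝ}

/-- The mass of the side of the edge `{i, i+1}` that does not contain `M`. -/
def far (μ : Fin (n + 1) → ℝ) (M : Fin (n + 1)) (i : Fin n) : ℝ :=
  if i.castSucc < M then cum μ i else 1 - cum μ i

/-- Two edges lie on the same side of the vertex `M`. -/
def SameSide (M : Fin (n + 1)) (i k : Fin n) : Prop := i.castSucc < M ↔ k.castSucc < M

instance (M : Fin (n + 1)) (i k : Fin n) : Decidable (SameSide M i k) :=
  inferInstanceAs (Decidable (_ ↔ _))

/-- Sum over both end points of the mean hitting times of `M`. -/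
noncomputable def hitMean (K : Matrix (Fin (n + 1)) (Fin (n + 1)) ℝ) (μ : Fin (n + 1) → ℝ)
    (M : Fin (n + 1)) : ℝ := ∑ i, far μ M i / flow K μ i

/-- Sum over both end points of the variances of the continuous time hitting times of `M`. -/
noncomputable def hitVar (K : Matrix (Fin (n + 1)) (Fin (n + 1)) ℝ) (μ : Fin (n + 1) → ℝ)
    (M : Fin (n + 1)) : ℝ :=
  ∑ i, ∑ k, if SameSide M i k then
    min (far μ M i) (far μ M k) ^ 2 / (flow K μ i * flow K μ k) else 0

/-- The difference between the sum of mean hitting times and the mean separation time. -/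
noncomputable def meanGap (K : Matrix (Fin (n + 1)) (Fin (n + 1)) ℝ) (μ : Fin (n + 1) → ℝ)
    (M : Fin (n + 1)) : ℝ := ∑ i, far μ M i ^ 2 / flow K μ i

namespace Chain

lemma far_pos (hC : Chain K μ) (i : Fin n) : 0 < far μ M i := by
  unfold far
  split_ifs
  · exact hC.cum_pos i
  · exact sub_pos.2 (hC.cum_lt_one i)

lemma flow_le_far (hC : Chain K μ) (i : Fin n) : flow K μ i ≤ far μ M i := by
  unfold far
  split_ifs
  · exact hC.flow_le_cum i
  · exact hC.flow_le_one_sub_cum i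

lemma le_one_sub_cum_of_lt (hC : Chain K μ) (hr : δ ≤ ∑ i ∈ Finset.Ici M, μ i) {i : Fin n}
    (h : i.castSucc < M) : δ ≤ 1 - cum μ i := by
  rw [hC.one_sub_cum]
  refine hr.trans ?_
  have h1 : ∀ j ∈ Finset.Ici M, μ j = μ j * (1 - below i j) := by
    intro j hj
    have : ¬ j ≤ i.castSucc := not_le.2 (h.trans_le (Finset.mem_Ici.1 hj))
    simp [below, this]
  rw [Finset.sum_congr rfl h1]
  exact Finset.sum_le_univ_sum_of_nonneg fun j =>
    mul_nonneg (hC.pos j).le (sub_nonneg.2 (below_le_one i j))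

lemma le_cum_of_le (hC : Chain K μ) (hl : δ ≤ ∑ i ∈ Finset.Iic M, μ i) {i : Fin n}
    (h : M ≤ i.castSucc) : δ ≤ cum μ i := by
  refine hl.trans ?_
  have h1 : ∀ j ∈ Finset.Iic M, μ j = μ j * below i j := by
    intro j hj
    simp [below, (Finset.mem_Iic.1 hj).trans h]
  rw [Finset.sum_congr rfl h1]
  exact Finset.sum_le_univ_sum_of_nonneg fun j =>
    mul_nonneg (hC.pos j).le (below_nonneg i j)

/-- For two edges on the same side of `M`, one factor of `cov` is the smaller far mass. The other is
the mass of a set containing `M` and everything beyond it, hence at least `δ`. -/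
lemma mul_min_far_le_cov (hC : Chain K μ) (hl : δ ≤ ∑ i ∈ Finset.Iic M, μ i)
    (hr : δ ≤ ∑ i ∈ Finset.Ici M, μ i) {i k : Fin n} (h : SameSide M i k) :
    δ * min (far μ M i) (far μ M k) ≤ cov μ i k := by
  unfold SameSide at h
  unfold far cov
  by_cases hi : i.castSucc < M
  · have hk := h.1 hi
    rw [if_pos hi, if_pos hk, mul_comm]
    refine mul_le_mul_of_nonneg_left ?_ (le_min (hC.cum_pos i).le (hC.cum_pos k).le)
    have h1 := hC.le_one_sub_cum_of_lt hr hi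
    have h2 := hC.le_one_sub_cum_of_lt hr hk
    rcases max_cases (cum μ i) (cum μ k) with h | h <;> rw [h.1] <;> assumption
  · have hk : ¬ k.castSucc < M := fun hk => hi (h.2 hk)
    rw [if_neg hi, if_neg hk]
    have h1 := hC.le_cum_of_le hl (not_lt.1 hi)
    have h2 := hC.le_cum_of_le hl (not_lt.1 hk)
    rw [min_sub_sub_left]
    exact mul_le_mul_of_nonneg_right (le_min h1 h2)
      (sub_nonneg.2 (max_le (hC.cum_lt_one i).le (hC.cum_lt_one k).le))

lemma cov_le_min_far (hC : Chain K μ) {i k : Fin n} (h : SameSide M i k) :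
    cov μ i k ≤ min (far μ M i) (far μ M k) := by
  unfold SameSide at h
  unfold far cov
  have hm : 0 < min (cum μ i) (cum μ k) := lt_min (hC.cum_pos i) (hC.cum_pos k)
  have hM : max (cum μ i) (cum μ k) < 1 := max_lt (hC.cum_lt_one i) (hC.cum_lt_one k)
  have hmM : min (cum μ i) (cum μ k) ≤ max (cum μ i) (cum μ k) := min_le_max
  by_cases hi : i.castSucc < M
  · rw [if_pos hi, if_pos (h.1 hi)]
    nlinarith
  · rw [if_neg hi, if_neg fun hk => hi (h.2 hk), min_sub_sub_left]
    nlinarith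

/-- For edges on opposite sides of `M` the two factors of `cov` are exactly the far masses. This is
why `sepVar` exceeds the same-side sum by a product of two edge sums. -/
lemma cov_eq_mul_far (hC : Chain K μ) {i k : Fin n} (h : ¬ SameSide M i k) :
    cov μ i k = far μ M i * far μ M k := by
  wlog hi : i.castSucc < M generalizing i k
  · rw [cov_symm, this (i := k) (k := i) (fun h' => h h'.symm), mul_comm]
    by_contra hk
    exact h ⟨fun h' => absurd h' hi, fun h' => absurd h' hk⟩
  have hk : ¬ k.castSucc < M := fun hk => h ⟨fun _ => hk, fun _ => hi⟩
  have hik : i ≤ k := by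
    rw [← Fin.castSucc_le_castSucc_iff]; exact (hi.trans_le (not_lt.1 hk)).le
  rw [far, far, if_pos hi, if_neg hk, cov, min_eq_left (hC.cum_mono hik),
    max_eq_right (hC.cum_mono hik)]

/-- A weighted Hardy bound: the Poincaré inequality at the test gradient `r / flow` on `S` reads `λ
κ A ^ 2 ≤ A`, where `A` is the sum in question. -/
lemma gap_mul_sum_le_one (hC : Chain K μ) (hn : 1 ≤ n) {κ : ℝ} {r : Fin n → ℝ}
    (S : Finset (Fin n)) (hr : ∀ i, 0 ≤ r i)
    (h_le : ∀ i ∈ S, ∀ k ∈ S, κ * (r i * r k) ≤ cov μ i k) :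
    spectralGap K * κ * ∑ i ∈ S, r i ^ 2 / flow K μ i ≤ 1 := by
  obtain ⟨hgap, -, hP⟩ := hC.gap_spec hn
  set A := ∑ i ∈ S, r i ^ 2 / flow K μ i with hA
  have hA0 : 0 ≤ A := Finset.sum_nonneg fun i _ => div_nonneg (sq_nonneg _) (hC.flow_pos i).le
  have h1 := hP (fun i => if i ∈ S then r i / flow K μ i else 0)
  have h2 : ∑ i, flow K μ i * (if i ∈ S then r i / flow K μ i else 0) ^ 2 = A := by
    have h : ∀ i, flow K μ i * (if i ∈ S then r i / flow K μ i else 0) ^ 2 =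
        if i ∈ S then r i ^ 2 / flow K μ i else 0 := by
      intro i
      have := (hC.flow_pos i).ne'
      split_ifs
      · field_simp
      · simp
    rw [Finset.sum_congr rfl fun i _ => h i, Finset.sum_ite_mem, Finset.univ_inter]
  have h3 : κ * A ^ 2 ≤ ∑ i, ∑ k, cov μ i k * (if i ∈ S then r i / flow K μ i else 0) *
      (if k ∈ S then r k / flow K μ k else 0) := by
    have h : ∀ i, (if i ∈ S then r i ^ 2 / flow K μ i else 0) =
        r i * (if i ∈ S then r i / flow K μ i else 0) := by
      intro i
      split_ifs <;> ring
    have hA' : A = ∑ i, r i * (if i ∈ S then r i / flow K μ i else 0) := by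
      simp only [← h, Finset.sum_ite_mem, Finset.univ_inter, hA]
    rw [hA', sq, Finset.sum_mul_sum, Finset.mul_sum]
    refine Finset.sum_le_sum fun i _ => ?_
    rw [Finset.mul_sum]
    refine Finset.sum_le_sum fun k _ => ?_
    by_cases hi : i ∈ S
    · by_cases hk : k ∈ S
      · have h5 := h_le i hi k hk
        have h6 : 0 ≤ r i / flow K μ i * (r k / flow K μ k) :=
          mul_nonneg (div_nonneg (hr i) (hC.flow_pos i).le) (div_nonneg (hr k) (hC.flow_pos k).le)
        simp only [hi, hk, if_true]
        nlinarith [mul_le_mul_of_nonneg_right h5 h6]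
      · simp [hk]
    · simp [hi]
  rw [h2] at h1
  have h4 : spectralGap K * (κ * A ^ 2) ≤ A := (mul_le_mul_of_nonneg_left h3 hgap.le).trans h1
  rcases hA0.eq_or_lt with h5 | h5
  · rw [← h5]; norm_num
  · have : A * (spectralGap K * κ * A) ≤ A * 1 := by nlinarith
    exact le_of_mul_le_mul_left this h5

lemma far_le_one (hC : Chain K μ) (i : Fin n) : far μ M i ≤ 1 := by
  unfold far
  split_ifs
  · exact (hC.cum_lt_one i).le
  · linarith [hC.cum_pos i]

/-- The Hardy bound is applied with `r = far` on each side of `M`, since far masses are at most one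
and their product is below their minimum. The two sides account for the 2. -/
lemma gap_mul_meanGap_le (hC : Chain K μ) (hn : 1 ≤ n) (hδ : 0 < δ)
    (hl : δ ≤ ∑ i ∈ Finset.Iic M, μ i) (hr : δ ≤ ∑ i ∈ Finset.Ici M, μ i) :
    spectralGap K * δ * meanGap K μ M ≤ 2 := by
  have key : ∀ S : Finset (Fin n), (∀ i ∈ S, ∀ k ∈ S, SameSide M i k) →
      spectralGap K * δ * ∑ i ∈ S, far μ M i ^ 2 / flow K μ i ≤ 1 := by
    intro S hS
    refine hC.gap_mul_sum_le_one hn S (fun i => (hC.far_pos i).le) fun i hi k hk => ?_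
    refine le_trans ?_ (hC.mul_min_far_le_cov hl hr (hS i hi k hk))
    refine mul_le_mul_of_nonneg_left (le_min ?_ ?_) hδ.le
    · exact mul_le_of_le_one_right (hC.far_pos i).le (hC.far_le_one k)
    · exact mul_le_of_le_one_left (hC.far_pos k).le (hC.far_le_one i)
  have h1 := key (Finset.univ.filter fun i => i.castSucc < M) (by
    intro i hi k hk
    simp only [Finset.mem_filter, Finset.mem_univ, true_and] at hi hk
    simp [SameSide, hi, hk])
  have h2 := key (Finset.univ.filter fun i => ¬ i.castSucc < M) (by
    intro i hi k hk
    simp only [Finset.mem_filter, Finset.mem_univ, true_and] at hi hk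
    simp [SameSide, hi, hk])
  rw [meanGap, ← Finset.sum_filter_add_sum_filter_not _ (fun i => i.castSucc < M)]
  linarith

/-- This bound makes the window negligible under the product condition. For fixed `k`, the edges on
the same side with smaller far mass obey a Hardy bound of size `far k`; dividing by `flow k` and
summing produces `hitMean`. Each pair of edges is charged to the one with larger far mass, hence the
factor 2. -/
lemma gap_mul_hitVar_le (hC : Chain K μ) (hn : 1 ≤ n) (hδ : 0 < δ)
    (hl : δ ≤ ∑ i ∈ Finset.Iic M, μ i) (hr : δ ≤ ∑ i ∈ Finset.Ici M, μ i) :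
    spectralGap K * δ * hitVar K μ M ≤ 2 * hitMean K μ M := by
  have key : ∀ k, spectralGap K * δ * ∑ i, (if SameSide M i k ∧ far μ M i ≤ far μ M k then
      far μ M i ^ 2 / flow K μ i else 0) ≤ far μ M k := by
    intro k
    have hk := hC.far_pos (M := M) k
    rw [← Finset.sum_filter]
    -- When both far masses are at most `far k`, their product divided by `far k` is at most their
    -- minimum; this dictates `κ`.
    have := hC.gap_mul_sum_le_one hn (κ := δ / far μ M k) (r := far μ M)
      (Finset.univ.filter fun i => SameSide M i k ∧ far μ M i ≤ far μ M k)
      (fun i => (hC.far_pos i).le) (by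
        intro i hi j hj
        simp only [Finset.mem_filter, Finset.mem_univ, true_and] at hi hj
        refine le_trans ?_ (hC.mul_min_far_le_cov hl hr (hi.1.trans hj.1.symm))
        rw [div_mul_eq_mul_div, div_le_iff₀ hk, mul_assoc]
        refine mul_le_mul_of_nonneg_left ?_ hδ.le
        have hi0 := hC.far_pos (M := M) i
        have hj0 := hC.far_pos (M := M) j
        rcases min_cases (far μ M i) (far μ M j) with h | h <;> rw [h.1]
        · exact mul_le_mul_of_nonneg_left hj.2 hi0.le
        · rw [mul_comm]; exact mul_le_mul_of_nonneg_left hi.2 hj0.le)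
    rw [← mul_div_assoc, div_mul_eq_mul_div, div_le_one hk] at this
    exact this
  have h1 : hitVar K μ M ≤ 2 * ∑ k, (∑ i, (if SameSide M i k ∧ far μ M i ≤ far μ M k then
      far μ M i ^ 2 / flow K μ i else 0)) / flow K μ k := by
    have h2 : ∀ i k, (if SameSide M i k then
        min (far μ M i) (far μ M k) ^ 2 / (flow K μ i * flow K μ k) else 0) ≤
        (if SameSide M i k ∧ far μ M i ≤ far μ M k then
          far μ M i ^ 2 / flow K μ i else 0) / flow K μ k +
        (if SameSide M k i ∧ far μ M k ≤ far μ M i then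
          far μ M k ^ 2 / flow K μ k else 0) / flow K μ i := by
      intro i k
      have hi := hC.flow_pos i
      have hk := hC.flow_pos k
      by_cases h : SameSide M i k
      · have h' : SameSide M k i := h.symm
        simp only [h, h', true_and, if_true]
        rcases le_total (far μ M i) (far μ M k) with h3 | h3
        · rw [min_eq_left h3, if_pos h3, div_div]
          refine le_add_of_nonneg_right ?_
          split_ifs <;> positivity
        · rw [min_eq_right h3, if_pos h3, div_div (far μ M k ^ 2), mul_comm (flow K μ k)]
          refine le_add_of_nonneg_left ?_
          split_ifs <;> positivity
      · have h' : ¬ SameSide M k i := fun h' => h h'.symm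
        simp [h, h']
    refine (Finset.sum_le_sum fun i _ => Finset.sum_le_sum fun k _ => h2 i k).trans ?_
    simp only [Finset.sum_add_distrib]
    rw [Finset.sum_comm, two_mul]
    simp only [Finset.sum_div]
    exact le_rfl
  have hgap := (hC.gap_spec hn).1
  calc spectralGap K * δ * hitVar K μ M ≤ spectralGap K * δ * _ :=
        mul_le_mul_of_nonneg_left h1 (mul_pos hgap hδ).le
    _ = 2 * ∑ k, (spectralGap K * δ * ∑ i, (if SameSide M i k ∧ far μ M i ≤ far μ M k then
      far μ M i ^ 2 / flow K μ i else 0)) / flow K μ k := by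
        rw [mul_left_comm, Finset.mul_sum]
        simp only [mul_div_assoc]
    _ ≤ 2 * hitMean K μ M := by
        refine mul_le_mul_of_nonneg_left (Finset.sum_le_sum fun k _ => ?_) zero_le_two
        exact div_le_div_of_nonneg_right (key k) (hC.flow_pos k).le

/-- On either side of `M` one has `cum * (1 - cum) = far - far ^ 2`. -/
lemma sepMean_add_meanGap (K : Matrix (Fin (n + 1)) (Fin (n + 1)) ℝ) (μ : Fin (n + 1) → ℝ)
    (M : Fin (n + 1)) : sepMean K μ + meanGap K μ M = hitMean K μ M := by
  rw [sepMean, meanGap, hitMean, ← Finset.sum_add_distrib]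
  refine Finset.sum_congr rfl fun i _ => ?_
  rw [← add_div]
  unfold far
  split_ifs <;> ring

lemma meanGap_nonneg (hC : Chain K μ) : 0 ≤ meanGap K μ M :=
  Finset.sum_nonneg fun i _ => div_nonneg (sq_nonneg _) (hC.flow_pos i).le

/-- Same-side pairs are bounded by the terms of `hitVar`; opposite-side pairs factor and are terms
of the square of `meanGap`. -/
lemma sepVar_le (hC : Chain K μ) : sepVar K μ ≤ hitVar K μ M + meanGap K μ M ^ 2 := by
  rw [sepVar, hitVar, meanGap, sq, Finset.sum_mul_sum, ← Finset.sum_add_distrib]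
  refine Finset.sum_le_sum fun i _ => ?_
  rw [← Finset.sum_add_distrib]
  refine Finset.sum_le_sum fun k _ => ?_
  have hi := hC.flow_pos i
  have hk := hC.flow_pos k
  rw [div_mul_div_comm]
  split_ifs with h
  · refine le_add_of_le_of_nonneg ?_ (by positivity)
    gcongr
    · exact (hC.cov_pos i k).le
    · exact hC.cov_le_min_far h
  · rw [hC.cov_eq_mul_far h, mul_pow, zero_add]

/-- The sum splits at `M` into `a + b`, and `(a + b) ^ 2 ≤ 2 * (a ^ 2 + b ^ 2)`. The squares contain
only same-side pairs, where the product of far masses is below their minimum. -/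
lemma meanGap_sq_le (hC : Chain K μ) : meanGap K μ M ^ 2 ≤ 2 * hitVar K μ M := by
  have key : (∑ i with i.castSucc < M, far μ M i ^ 2 / flow K μ i) ^ 2 +
      (∑ i with ¬ i.castSucc < M, far μ M i ^ 2 / flow K μ i) ^ 2 ≤ hitVar K μ M := by
    simp only [sq (Finset.sum _ _), Finset.sum_filter]
    rw [Finset.sum_mul_sum, Finset.sum_mul_sum, ← Finset.sum_add_distrib, hitVar]
    refine Finset.sum_le_sum fun i _ => ?_
    rw [← Finset.sum_add_distrib]
    refine Finset.sum_le_sum fun k _ => ?_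
    have hi := hC.flow_pos i
    have hk := hC.flow_pos k
    have hfi := hC.far_pos (M := M) i
    have hfk := hC.far_pos (M := M) k
    have hle : far μ M i * far μ M k ≤ min (far μ M i) (far μ M k) :=
      le_min (mul_le_of_le_one_right hfi.le (hC.far_le_one k))
        (mul_le_of_le_one_left hfk.le (hC.far_le_one i))
    have h : far μ M i ^ 2 / flow K μ i * (far μ M k ^ 2 / flow K μ k) ≤
        min (far μ M i) (far μ M k) ^ 2 / (flow K μ i * flow K μ k) := by
      rw [div_mul_div_comm, ← mul_pow]
      gcongr
    unfold SameSide
    by_cases h1 : i.castSucc < M <;> by_cases h2 : k.castSucc < M <;> simp [h1, h2, h]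
  rw [meanGap, ← Finset.sum_filter_add_sum_filter_not _ (fun i => i.castSucc < M)]
  nlinarith [sq_nonneg ((∑ i with i.castSucc < M, far μ M i ^ 2 / flow K μ i) -
    (∑ i with ¬ i.castSucc < M, far μ M i ^ 2 / flow K μ i))]

/-- The Hilbert–Schmidt norm of the inverse of `I - K` dominates its top eigenvalue `1/λ`:
Cauchy–Schwarz over pairs of edges, applied to the gradient of the gap eigenfunction. -/
lemma one_le_gap_sq_mul_sepVar (hC : Chain K μ) (hn : 1 ≤ n) :
    1 ≤ spectralGap K ^ 2 * sepVar K μ := by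
  obtain ⟨hgap, ⟨f, hfa, hf0, -, hgen, i, hi⟩, -⟩ := hC.gap_spec hn
  set D := ∑ i, flow K μ i * grad f i ^ 2 with hD
  have hDpos : 0 < D := Finset.sum_pos' (fun i _ => mul_nonneg (hC.flow_pos i).le (sq_nonneg _))
    ⟨i, Finset.mem_univ i, mul_pos (hC.flow_pos i) (sq_pos_of_ne_zero hi)⟩
  have h1 : D = spectralGap K * ∑ i, ∑ k, cov μ i k * grad f i * grad f k := by
    rw [← hC.sum_mul_sq hf0, Finset.mul_sum]
    have := hC.sum_gen_mul f f
    rw [hgen] at this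
    rw [hD]
    refine (Finset.sum_congr rfl fun j _ => by ring).trans (this.symm.trans ?_)
    exact Finset.sum_congr rfl fun j _ => by rw [Pi.smul_apply, smul_eq_mul]; ring
  have h2 : (∑ i, ∑ k, cov μ i k * grad f i * grad f k) ^ 2 ≤ sepVar K μ * D ^ 2 := by
    rw [sq D, hD, Finset.sum_mul_sum, sepVar, ← Finset.sum_product', ← Finset.sum_product',
      ← Finset.sum_product']
    refine Finset.sum_sq_le_sum_mul_sum_of_sq_le_mul _ ?_ ?_ ?_
    · intro p _
      have := hC.flow_pos p.1
      have := hC.flow_pos p.2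
      positivity
    · intro p _
      have := hC.flow_pos p.1
      have := hC.flow_pos p.2
      positivity
    · intro p _
      have := (hC.flow_pos p.1).ne'
      have := (hC.flow_pos p.2).ne'
      refine le_of_eq ?_
      field_simp
  have h3 : D ^ 2 * 1 ≤ D ^ 2 * (spectralGap K ^ 2 * sepVar K μ) := by
    nth_rewrite 1 [h1]
    rw [mul_pow]
    nlinarith [mul_le_mul_of_nonneg_left h2 (sq_nonneg (spectralGap K))]
  exact le_of_mul_le_mul_left h3 (by positivity)

/-- Reaching `M` from both ends takes at least `n` steps in total. The consequence `s n → ∞` is used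
in the cutoff criteria. -/
lemma le_hitMean (hC : Chain K μ) : (n : ℝ) ≤ hitMean K μ M := by
  have : ∑ _i : Fin n, (1 : ℝ) ≤ hitMean K μ M :=
    Finset.sum_le_sum fun i _ => (one_le_div (hC.flow_pos i)).2 (hC.flow_le_far i)
  simpa using this

/-- A gradient supported on one edge is the test function. The bound keeps the window `1/λ` at least
`1/2`, enough to absorb integer rounding. -/
lemma gap_le_two (hC : Chain K μ) (hn : 1 ≤ n) : spectralGap K ≤ 2 := by
  obtain ⟨hgap, -, hP⟩ := hC.gap_spec hn
  have h1 := hP (Pi.single ⟨0, hn⟩ 1)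
  set i : Fin n := ⟨0, hn⟩
  have h2 : spectralGap K * (cum μ i * (1 - cum μ i)) ≤ flow K μ i := by
    have e1 : ∑ j, ∑ k, cov μ j k * (Pi.single i 1 : Fin n → ℝ) j * (Pi.single i 1 : Fin n → ℝ) k =
        cum μ i * (1 - cum μ i) := by
      simp [Pi.single_apply, cov]
    have e2 : ∑ j, flow K μ j * (Pi.single i 1 : Fin n → ℝ) j ^ 2 = flow K μ i := by
      simp [Pi.single_apply]
    rwa [e1, e2] at h1
  have h3 := hC.flow_le_cum i
  have h4 := hC.flow_le_one_sub_cum i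
  have h5 := hC.cum_pos i
  have h6 := hC.cum_lt_one i
  by_contra hcon
  rw [not_le] at hcon
  rcases le_total (cum μ i) (1 / 2) with h | h
  · nlinarith [mul_pos h5 (sub_pos.2 h6)]
  · nlinarith [mul_pos h5 (sub_pos.2 h6)]

lemma hitVar_pos (hC : Chain K μ) (hn : 1 ≤ n) : 0 < hitVar K μ M := by
  have h1 := hC.one_le_gap_sq_mul_sepVar hn
  have h2 := hC.sepVar_le (M := M)
  have h3 := hC.meanGap_sq_le (M := M)
  have h4 := (hC.gap_spec hn).1
  by_contra hcon
  have : sepVar K μ ≤ 0 := by linarith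
  nlinarith [sq_nonneg (spectralGap K)]

/-- In the monotone case the variances of the discrete hitting times do not vanish. -/
lemma hitMean_lt_hitVar (hC : Chain K μ) (hn : 1 ≤ n)
    (hmono : ∀ i : Fin n, K i.castSucc i.succ + K i.succ i.castSucc ≤ 1) :
    hitMean K μ M < hitVar K μ M := by
  have h1 : ∀ i, far μ M i / flow K μ i < far μ M i ^ 2 / (flow K μ i * flow K μ i) := by
    intro i
    have hw := hC.flow_pos i
    have hf := hC.far_pos (M := M) i
    -- Both transition probabilities across the edge are positive with sum at most one, so each is
    -- strictly less than one.
    have hlt : flow K μ i < far μ M i := by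
      unfold far
      split_ifs
      · refine lt_of_lt_of_le ?_ (hC.le_cum i)
        exact mul_lt_of_lt_one_right (hC.pos _) (by linarith [hC.down_pos i, hmono i])
      · refine lt_of_lt_of_le ?_ (hC.le_one_sub_cum i)
        rw [hC.flow_eq]
        exact mul_lt_of_lt_one_right (hC.pos _) (by linarith [hC.up_pos i, hmono i])
    rw [div_lt_div_iff₀ hw (mul_pos hw hw)]
    nlinarith [mul_pos hf hw]
  have : Nonempty (Fin n) := ⟨⟨0, hn⟩⟩
  refine (Finset.sum_lt_sum_of_nonempty Finset.univ_nonempty fun i _ => h1 i).trans_le ?_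
  refine Finset.sum_le_sum fun i _ => ?_
  have h2 := Finset.single_le_sum (f := fun k => if SameSide M i k then
    min (far μ M i) (far μ M k) ^ 2 / (flow K μ i * flow K μ k) else 0) (fun k _ => by
      have := hC.flow_pos i
      have := hC.flow_pos k
      split_ifs <;> positivity) (Finset.mem_univ i)
  simpa [SameSide] using h2

end Chain

end Hitting

/-! ### Chebyshev's inequality for a tail function and its iterated sums or integrals -/

section Chebyshev

variable {m v : ℝ}

/-- If `F` is the tail of a random time, `U` and `Z` are its first and second iterated tail
integrals, `m` is the mean and `v` the variance. No random time is constructed; monotonicity of two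
auxiliary functions replaces it. -/
lemma chebyshev_continuous {F F' U Z : ℝ → ℝ} (hF : ∀ t, HasDerivAt F (F' t) t)
    (hU : ∀ t, HasDerivAt U (-F t) t) (hZ : ∀ t, HasDerivAt Z (-U t) t)
    (hF' : ∀ t, 0 ≤ t → F' t ≤ 0) (hU0 : ∀ t, 0 ≤ t → 0 ≤ U t) (hZ0 : ∀ t, 0 ≤ t → 0 ≤ Z t)
    (hF0 : F 0 = 1) (hm : U 0 = m) (hv : 2 * Z 0 = v + m ^ 2) {t : ℝ} (ht : 0 ≤ t) :
    (m ≤ t → (t - m) ^ 2 * F t ≤ v) ∧ (t ≤ m → (t - m) ^ 2 * (1 - F t) ≤ v) := by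
  -- This is the part of the variance carried by values beyond `t`, integrated by parts twice.
  set V : ℝ → ℝ := fun t => (t - m) ^ 2 * F t + 2 * (t - m) * U t + 2 * Z t with hV
  have hlin : ∀ t, HasDerivAt (fun t : ℝ => t - m) 1 t := fun t => (hasDerivAt_id t).sub_const m
  have hsq : ∀ t, HasDerivAt (fun t : ℝ => (t - m) ^ 2) (2 * (t - m)) t := by
    intro t
    simpa using (hlin t).fun_pow 2
  have hVd : ∀ t, HasDerivAt V ((t - m) ^ 2 * F' t) t := by
    intro t
    have := (((hsq t).mul (hF t)).add (((hlin t).const_mul 2).mul (hU t))).add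
      ((hZ t).const_mul 2)
    exact this.congr_deriv (by ring)
  have hVanti : AntitoneOn V (Set.Ici 0) := by
    refine antitoneOn_of_deriv_nonpos (convex_Ici 0)
      (fun t _ => (hVd t).continuousAt.continuousWithinAt)
      (fun t _ => (hVd t).differentiableAt.differentiableWithinAt) fun t ht => ?_
    rw [(hVd t).deriv]
    rw [interior_Ici] at ht
    exact mul_nonpos_of_nonneg_of_nonpos (sq_nonneg _) (hF' t ht.le)
  have hV0 : V 0 = v := by
    simp only [hV, hF0, hm]
    linarith
  have hFanti : AntitoneOn F (Set.Ici 0) := by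
    refine antitoneOn_of_deriv_nonpos (convex_Ici 0)
      (fun t _ => (hF t).continuousAt.continuousWithinAt)
      (fun t _ => (hF t).differentiableAt.differentiableWithinAt) fun t ht => ?_
    rw [(hF t).deriv]
    rw [interior_Ici] at ht
    exact hF' t ht.le
  constructor
  · intro hmt
    have h1 : V t ≤ v := hV0 ▸ hVanti Set.self_mem_Ici ht ht
    have h2 := mul_nonneg (mul_nonneg zero_le_two (sub_nonneg.2 hmt)) (hU0 t ht)
    have h3 := hZ0 t ht
    simp only [hV] at h1
    linarith
  · intro htm
    -- The contribution of values before `t` is replaced by its lower bound, their probability times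
    -- the least squared distance to `m`.
    set D : ℝ → ℝ := fun t => V t + (t - m) ^ 2 * (1 - F t) with hD
    have hDd : ∀ t, HasDerivAt D (2 * (t - m) * (1 - F t)) t := by
      intro t
      have := (hVd t).add ((hsq t).mul ((hF t).const_sub 1))
      exact this.congr_deriv (by ring)
    have hDanti : AntitoneOn D (Set.Icc 0 m) := by
      refine antitoneOn_of_deriv_nonpos (convex_Icc 0 m)
        (fun t _ => (hDd t).continuousAt.continuousWithinAt)
        (fun t _ => (hDd t).differentiableAt.differentiableWithinAt) fun t ht => ?_
      rw [(hDd t).deriv]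
      rw [interior_Icc] at ht
      have h1 : F t ≤ 1 := hF0 ▸ hFanti Set.self_mem_Ici ht.1.le ht.1.le
      have := mul_nonneg (sub_nonneg.2 ht.2.le) (sub_nonneg.2 h1)
      linarith
    have h1 := hDanti ⟨le_rfl, ht.trans htm⟩ ⟨ht, htm⟩ ht
    have h2 : D 0 = v := by simp [hD, hV0, hF0]
    have h3 : 0 ≤ V t := by
      have h4 := hVanti ht (ht.trans htm) htm
      have h5 := hZ0 m (ht.trans htm)
      refine le_trans ?_ h4
      simp only [hV, sub_self]
      linarith
    rw [h2] at h1
    simp only [hD] at h1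
    linarith

/-- Here `2 * Z 0` corresponds to `E[T (T + 1)]` instead of `E[T ^ 2]`, so the variance is `v - m`.
A time exceeding `k` is at least `k + 1`, which explains the shift in the upper estimate. -/
lemma chebyshev_discrete {F U Z : ℕ → ℝ} (hU : ∀ k, U (k + 1) = U k - F k)
    (hZ : ∀ k, Z (k + 1) = Z k - U k) (hF : ∀ k, F (k + 1) ≤ F k) (hFnn : ∀ k, 0 ≤ F k)
    (hU0 : ∀ k, 0 ≤ U k) (hZ0 : ∀ k, 0 ≤ Z k)
    (hF0 : F 0 = 1) (hm : U 0 = m) (hv : 2 * Z 0 = v + m ^ 2) (k : ℕ) :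
    (m ≤ k + 1 → (k + 1 - m) ^ 2 * F k ≤ v - m) ∧
      (k ≤ m → (k - m) ^ 2 * (1 - F k) ≤ v - m) := by
  -- The variance carried by values greater than `k`, after two summations by parts.
  set V : ℕ → ℝ := fun k => (k + 1 - m) ^ 2 * F k + (2 * (k + 1 - m) + 1) * U (k + 1) +
    2 * Z (k + 2) with hV
  have hstep : ∀ k, V (k + 1) = V k - (k + 1 - m) ^ 2 * (F k - F (k + 1)) := by
    intro k
    simp only [hV, hZ (k + 2), hU (k + 1)]
    push_cast
    ring
  have hVanti : Antitone V := by
    refine antitone_nat_of_succ_le fun k => ?_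
    rw [hstep]
    nlinarith [mul_nonneg (sq_nonneg ((k : ℝ) + 1 - m)) (sub_nonneg.2 (hF k))]
  have hV0 : V 0 = v - m := by
    simp only [hV, hZ 1, hZ 0, hU 0, hF0, hm, zero_add]
    push_cast
    linarith
  have hlow : ∀ k : ℕ, m ≤ k + 1 → (k + 1 - m) ^ 2 * F k ≤ V k := by
    intro k hk
    have h2 : 0 ≤ (2 * ((k : ℝ) + 1 - m) + 1) * U (k + 1) :=
      mul_nonneg (by linarith) (hU0 _)
    have h3 := hZ0 (k + 2)
    simp only [hV]
    linarith
  have hVnn : ∀ k, 0 ≤ V k := by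
    intro k
    obtain ⟨j, hj⟩ := exists_nat_ge m
    refine le_trans ?_ (hVanti (le_max_left k j))
    refine le_trans (mul_nonneg (sq_nonneg _) (hFnn _)) (hlow (max k j) ?_)
    have : (j : ℝ) ≤ (max k j : ℕ) := by exact_mod_cast le_max_right k j
    linarith
  refine ⟨fun hk => (hlow k hk).trans (hV0 ▸ hVanti (Nat.zero_le k)), fun hk => ?_⟩
  have key : ∀ k : ℕ, k ≤ m → (k - m) ^ 2 * (1 - F k) ≤ v - m - V k := by
    intro k
    induction k with
    | zero => intro _; simp [hV0, hF0]
    | succ k ih =>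
      intro hk
      push_cast at hk ⊢
      have h1 := ih (by linarith)
      have hF1 : F k ≤ 1 := hF0 ▸ (antitone_nat_of_succ_le hF) (Nat.zero_le k)
      rw [hstep]
      have h2 : ((k : ℝ) + 1 - m) ^ 2 ≤ (k - m) ^ 2 := by nlinarith
      nlinarith [mul_le_mul_of_nonneg_right h2 (sub_nonneg.2 hF1)]
  linarith [key k hk, hVnn k]

end Chebyshev

/-! ### Reversible operators preserving decreasing functions. -/

section Semigroup

variable {n : ℕ} {K : Matrix (Fin (n + 1)) (Fin (n + 1)) ℝ} {μ : Fin (n + 1) → ℝ}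

/-- A transition operator, reversible with respect to `μ`, that preserves decreasing functions and
commutes with `K`. -/
structure MonotoneOp (K : Matrix (Fin (n + 1)) (Fin (n + 1)) ℝ) (μ : Fin (n + 1) → ℝ)
    (A : Matrix (Fin (n + 1)) (Fin (n + 1)) ℝ) : Prop where
  reversible : ∀ x y, μ x * A x y = μ y * A y x
  map_one : ∀ x, ∑ y, A x y = 1
  antitone : ∀ f : Fin (n + 1) → ℝ, Antitone f → Antitone (A.mulVec f)
  comm : Commute A K

namespace MonotoneOp

variable {A : Matrix (Fin (n + 1)) (Fin (n + 1)) ℝ}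

lemma gen_mulVec (hA : MonotoneOp K μ A) (f : Fin (n + 1) → ℝ) :
    gen K (A.mulVec f) = A.mulVec (gen K f) := by
  unfold gen
  rw [Matrix.mulVec_mulVec, Matrix.mulVec_mulVec, mul_sub, sub_mul, hA.comm.eq]
  simp

lemma sum_mul_mulVec (hA : MonotoneOp K μ A) (f : Fin (n + 1) → ℝ) :
    ∑ x, μ x * A.mulVec f x = ∑ x, μ x * f x := by
  simp only [Matrix.mulVec, dotProduct, Finset.mul_sum]
  rw [Finset.sum_comm]
  refine Finset.sum_congr rfl fun y _ => ?_
  simp only [← mul_assoc, hA.reversible _ y, ← Finset.sum_mul, ← Finset.mul_sum, hA.map_one,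
    mul_one]

/-- The image of `f` is decreasing with mean zero, so its last value, the smallest, lies below its
mean. -/
lemma last_nonpos (hC : Chain K μ) (hA : MonotoneOp K μ A) {f : Fin (n + 1) → ℝ}
    (hf : Antitone f) (h0 : ∑ x, μ x * f x = 0) : A.mulVec f (Fin.last n) ≤ 0 := by
  have h1 := hA.sum_mul_mulVec f
  rw [h0] at h1
  rw [← h1, ← one_mul (A.mulVec f (Fin.last n)), ← hC.sum_eq_one, Finset.sum_mul]
  exact Finset.sum_le_sum fun x _ =>
    mul_le_mul_of_nonneg_left (hA.antitone f hf (Fin.le_last x)) (hC.pos x).le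

lemma gen_last_nonpos (hC : Chain K μ) {f : Fin (n + 1) → ℝ} (hf : Antitone f) :
    gen K f (Fin.last n) ≤ 0 := by
  rw [hC.gen_eq_sum_grad]
  refine Finset.sum_nonpos fun i _ => ?_
  have h1 : Fin.last n ≠ i.castSucc := (Fin.castSucc_lt_last i).ne'
  have h2 := antitone_iff_grad_nonneg.1 hf i
  have h3 := hC.down_pos i
  rw [if_neg h1]
  split_ifs
  · nlinarith
  · simp

lemma mulVec_startDensity (hA : MonotoneOp K μ A) (x : Fin (n + 1)) :
    A.mulVec (startDensity μ) x = A x 0 / μ 0 - 1 := by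
  simp [Matrix.mulVec, dotProduct, startDensity, mul_sub, hA.map_one, div_eq_mul_inv]

lemma one_sub_div (hC : Chain K μ) (hA : MonotoneOp K μ A) (x : Fin (n + 1)) :
    1 - A 0 x / μ x = -A.mulVec (startDensity μ) x := by
  rw [hA.mulVec_startDensity]
  have h1 := hA.reversible 0 x
  have h2 := (hC.pos 0).ne'
  have h3 := (hC.pos x).ne'
  have : A 0 x / μ x = A x 0 / μ 0 := by
    field_simp
    linarith
  rw [this]; ring

lemma startDensity_antitone (hC : Chain K μ) : Antitone (startDensity μ) := by
  obtain ⟨u, z, h, -⟩ := hC.exists_potentials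
  exact h

/-- The density of `A(0,·)` is the image of a decreasing density, hence smallest at the right end.
-/
lemma sep_eq (hC : Chain K μ) (hA : MonotoneOp K μ A) :
    sep (A 0) μ = -A.mulVec (startDensity μ) (Fin.last n) := by
  unfold sep
  simp only [hA.one_sub_div hC]
  refine le_antisymm (ciSup_le fun x => ?_) ?_
  · exact neg_le_neg (hA.antitone _ (startDensity_antitone hC) (Fin.le_last x))
  · exact le_ciSup (f := fun x => -A.mulVec (startDensity μ) x)
      (Set.finite_range _).bddAbove (Fin.last n)

/-- By definition of separation `σ`, the law `A(0,·)` dominates `(1 - σ) μ`. Integrating the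
nonnegative function `f 0 - f` against both gives `(1 - σ) f 0 ≤ (1 - a) f 0`. -/
lemma le_sep (hC : Chain K μ) (hA : MonotoneOp K μ A) {f : Fin (n + 1) → ℝ} {a : ℝ}
    (hf : Antitone f) (h0 : ∑ x, μ x * f x = 0) (hpos : 0 < f 0) (ha : A.mulVec f = a • f) :
    a ≤ sep (A 0) μ := by
  set σ := sep (A 0) μ with hσ
  have h1 : ∀ x, (1 - σ) * μ x ≤ A 0 x := by
    intro x
    have : 1 - A 0 x / μ x ≤ σ :=
      le_ciSup (f := fun x => 1 - A 0 x / μ x) (Set.finite_range _).bddAbove x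
    have h2 : 1 - σ ≤ A 0 x / μ x := by linarith
    exact (le_div_iff₀ (hC.pos x)).1 h2
  have h2 : f 0 - a * f 0 = ∑ x, A 0 x * (f 0 - f x) := by
    have : A.mulVec f 0 = a * f 0 := by rw [ha]; rfl
    simp only [mul_sub, Finset.sum_sub_distrib, ← Finset.sum_mul, hA.map_one, one_mul]
    rw [← this]; rfl
  have h3 : (1 - σ) * f 0 = ∑ x, (1 - σ) * μ x * (f 0 - f x) := by
    simp only [mul_assoc, ← Finset.mul_sum, mul_sub (μ _), Finset.sum_sub_distrib,
      ← Finset.sum_mul, hC.sum_eq_one, h0]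
    ring
  have h4 : (1 - σ) * f 0 ≤ f 0 - a * f 0 := by
    rw [h2, h3]
    exact Finset.sum_le_sum fun x _ =>
      mul_le_mul_of_nonneg_right (h1 x) (sub_nonneg.2 (hf (Fin.zero_le x)))
  nlinarith

lemma one (K : Matrix (Fin (n + 1)) (Fin (n + 1)) ℝ) (μ : Fin (n + 1) → ℝ) :
    MonotoneOp K μ 1 where
  reversible x y := by
    by_cases h : x = y
    · rw [h]
    · rw [Matrix.one_apply_ne h, Matrix.one_apply_ne (Ne.symm h), mul_zero, mul_zero]
  map_one x := by simp [Matrix.one_apply]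
  antitone f hf := by rwa [Matrix.one_mulVec]
  comm := Commute.one_left K

lemma mul {B : Matrix (Fin (n + 1)) (Fin (n + 1)) ℝ} (hA : MonotoneOp K μ A)
    (hB : MonotoneOp K μ B) (hAB : Commute A B) : MonotoneOp K μ (A * B) where
  reversible x y := by
    have : (A * B) y x = (B * A) y x := by rw [hAB.eq]
    rw [this, Matrix.mul_apply, Matrix.mul_apply, Finset.mul_sum, Finset.mul_sum]
    refine Finset.sum_congr rfl fun z _ => ?_
    rw [← mul_assoc, hA.reversible x z, mul_right_comm, hB.reversible z y]; ring
  map_one x := by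
    simp only [Matrix.mul_apply]
    rw [Finset.sum_comm]
    simp only [← Finset.mul_sum, hB.map_one, mul_one, hA.map_one]
  antitone f hf := by
    rw [← Matrix.mulVec_mulVec]
    exact hA.antitone _ (hB.antitone f hf)
  comm := hA.comm.mul_left hB.comm

lemma pow (hA : MonotoneOp K μ A) (k : ℕ) : MonotoneOp K μ (A ^ k) := by
  induction k with
  | zero => rw [pow_zero]; exact one K μ
  | succ k ih => rw [pow_succ]; exact ih.mul hA ((Commute.refl A).pow_left k)

end MonotoneOp

lemma Chain.reversible (hC : Chain K μ) (x y : Fin (n + 1)) : μ x * K x y = μ y * K y x := by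
  rcases lt_trichotomy ((x : ℕ) + 1) y with h | h | h
  · rw [hC.nearest x y (Or.inl h), hC.nearest y x (Or.inr h), mul_zero, mul_zero]
  · have hx : (x : ℕ) < n := by have := y.2; omega
    have h1 : x = (⟨x, hx⟩ : Fin n).castSucc := rfl
    have h2 : y = (⟨x, hx⟩ : Fin n).succ := by ext; simp [← h]
    rw [h1, h2, hC.balance]
  · rcases lt_trichotomy ((y : ℕ) + 1) x with h' | h' | h'
    · rw [hC.nearest x y (Or.inr h'), hC.nearest y x (Or.inl h'), mul_zero, mul_zero]
    · have hy : (y : ℕ) < n := by have := x.2; omega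
      have h1 : y = (⟨y, hy⟩ : Fin n).castSucc := rfl
      have h2 : x = (⟨y, hy⟩ : Fin n).succ := by ext; simp [← h']
      rw [h1, h2, hC.balance]
    · have : x = y := by ext; omega
      rw [this]

lemma Chain.gen_castSucc_le (hC : Chain K μ) {f : Fin (n + 1) → ℝ} (hf : Antitone f)
    (i : Fin n) : gen K f i.castSucc ≤ grad f i * K i.castSucc i.succ := by
  rw [hC.gen_eq_sum_grad]
  have h : ∀ k, grad f k * ((if i.castSucc = k.castSucc then K k.castSucc k.succ else 0) -
      if i.castSucc = k.succ then K k.succ k.castSucc else 0) ≤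
      if i = k then grad f i * K i.castSucc i.succ else 0 := by
    intro k
    have h1 := antitone_iff_grad_nonneg.1 hf k
    have h2 := mul_nonneg h1 (hC.down_pos k).le
    by_cases hik : i = k
    · subst hik
      rw [if_pos rfl, if_pos rfl]
      split_ifs <;> nlinarith
    · rw [if_neg hik, if_neg (fun e => hik (Fin.castSucc_injective _ e))]
      split_ifs <;> nlinarith
  refine (Finset.sum_le_sum fun k _ => h k).trans ?_
  simp

lemma Chain.le_gen_succ (hC : Chain K μ) {f : Fin (n + 1) → ℝ} (hf : Antitone f)
    (i : Fin n) : -(grad f i * K i.succ i.castSucc) ≤ gen K f i.succ := by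
  rw [hC.gen_eq_sum_grad]
  have h : ∀ k, (if i = k then -(grad f i * K i.succ i.castSucc) else 0) ≤
      grad f k * ((if i.succ = k.castSucc then K k.castSucc k.succ else 0) -
      if i.succ = k.succ then K k.succ k.castSucc else 0) := by
    intro k
    have h1 := antitone_iff_grad_nonneg.1 hf k
    have h2 := mul_nonneg h1 (hC.up_pos k).le
    by_cases hik : i = k
    · subst hik
      rw [if_pos rfl, if_pos rfl]
      split_ifs <;> nlinarith
    · rw [if_neg hik, if_neg (fun e => hik (Fin.succ_injective _ e))]
      split_ifs <;> nlinarith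
  refine le_trans ?_ (Finset.sum_le_sum fun k _ => h k)
  simp

/-- `a + (1 - a) K` preserves decreasing functions if `K` is sufficiently lazy. -/
lemma Chain.antitone_sub_gen (hC : Chain K μ) {a : ℝ} (ha : 0 ≤ a)
    (hmono : ∀ i : Fin n, a * (K i.castSucc i.succ + K i.succ i.castSucc) ≤ 1)
    {f : Fin (n + 1) → ℝ} (hf : Antitone f) : Antitone (fun x => f x - a * gen K f x) := by
  refine antitone_iff_grad_nonneg.2 fun i => ?_
  have h1 := hC.gen_castSucc_le hf i
  have h2 := hC.le_gen_succ hf i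
  have h3 := antitone_iff_grad_nonneg.1 hf i
  have h4 := mul_nonneg h3 (sub_nonneg.2 (hmono i))
  have h5 : grad (fun x => f x - a * gen K f x) i =
      grad f i - a * (gen K f i.castSucc - gen K f i.succ) := by
    simp only [grad]; ring
  rw [h5]
  have h6 : a * (gen K f i.castSucc - gen K f i.succ) ≤
      a * (grad f i * (K i.castSucc i.succ + K i.succ i.castSucc)) :=
    mul_le_mul_of_nonneg_left (by linarith) ha
  nlinarith

lemma Chain.monotoneOp (hC : Chain K μ)
    (hmono : ∀ i : Fin n, K i.castSucc i.succ + K i.succ i.castSucc ≤ 1) :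
    MonotoneOp K μ K where
  reversible := hC.reversible
  map_one := hC.row_sum
  antitone f hf := by
    have := hC.antitone_sub_gen zero_le_one (by simpa using hmono) hf
    simpa [gen_eq] using this
  comm := Commute.refl K

end Semigroup

/-! ### The heat semigroup as a Poisson mixture of lazy steps. -/

section Heat

variable {n : ℕ} {K : Matrix (Fin (n + 1)) (Fin (n + 1)) ℝ} {μ : Fin (n + 1) → ℝ}

open scoped Matrix.Norms.Operator in
lemma hasSum_matrix_exp (A : Matrix (Fin (n + 1)) (Fin (n + 1)) ℝ) :
    HasSum (fun k => ((k.factorial : ℝ)⁻¹) • A ^ k) (NormedSpace.exp A) :=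
  NormedSpace.exp_series_hasSum_exp' (𝕂 := ℝ) A

/-- The functional `A ↦ (A v) x`. -/
def evalAt (v : Fin (n + 1) → ℝ) (x : Fin (n + 1)) :
    Matrix (Fin (n + 1)) (Fin (n + 1)) ℝ →ₗ[ℝ] ℝ where
  toFun A := A.mulVec v x
  map_add' A B := by simp [Matrix.add_mulVec]
  map_smul' a A := by simp [Matrix.smul_mulVec]

lemma hasSum_functional_exp (ℓ : Matrix (Fin (n + 1)) (Fin (n + 1)) ℝ →ₗ[ℝ] ℝ)
    (A : Matrix (Fin (n + 1)) (Fin (n + 1)) ℝ) :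
    HasSum (fun k => ((k.factorial : ℝ)⁻¹) * ℓ (A ^ k)) (ℓ (NormedSpace.exp A)) := by
  have := (hasSum_matrix_exp A).map ℓ ℓ.continuous_of_finiteDimensional
  simpa [Function.comp_def] using this

lemma exp_mulVec_eigenvector {A : Matrix (Fin (n + 1)) (Fin (n + 1)) ℝ} {f : Fin (n + 1) → ℝ}
    {a : ℝ} (h : A.mulVec f = a • f) :
    (NormedSpace.exp A).mulVec f = Real.exp a • f := by
  have hpow : ∀ k, (A ^ k).mulVec f = a ^ k • f := by
    intro k
    induction k with
    | zero => simp
    | succ k ih => rw [pow_succ', ← Matrix.mulVec_mulVec, ih, Matrix.mulVec_smul, h, smul_smul,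
        ← pow_succ]
  funext x
  have h1 := hasSum_functional_exp (evalAt f x) A
  have h2 := (NormedSpace.exp_series_hasSum_exp' (𝕂 := ℝ) a).mul_right (f x)
  rw [← Real.exp_eq_exp_ℝ] at h2
  have h3 : (fun k => ((k.factorial : ℝ)⁻¹) * evalAt f x (A ^ k)) =
      fun k => (k.factorial : ℝ)⁻¹ • a ^ k * f x := by
    funext k
    change _ * (A ^ k).mulVec f x = _
    rw [hpow]
    simp [mul_assoc]
  rw [h3] at h1
  exact h1.unique h2

/-- The lazy chain `(I + K) / 2`. -/
noncomputable def lazy (K : Matrix (Fin (n + 1)) (Fin (n + 1)) ℝ) :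
    Matrix (Fin (n + 1)) (Fin (n + 1)) ℝ := (1 / 2 : ℝ) • (1 + K)

lemma lazy_mulVec (f : Fin (n + 1) → ℝ) :
    (lazy K).mulVec f = fun x => f x - (1 / 2) * gen K f x := by
  funext x
  simp only [lazy, Matrix.smul_mulVec, Matrix.add_mulVec, Matrix.one_mulVec, Pi.smul_apply,
    Pi.add_apply, smul_eq_mul, gen_eq]
  ring

lemma Chain.monotoneOp_lazy (hC : Chain K μ) : MonotoneOp K μ (lazy K) where
  reversible x y := by
    have h1 := hC.reversible x y
    have h2 := (MonotoneOp.one K μ).reversible x y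
    simp only [lazy, Matrix.smul_apply, Matrix.add_apply, smul_eq_mul]
    linarith
  map_one x := by
    simp only [lazy, Matrix.smul_apply, Matrix.add_apply, smul_eq_mul, ← Finset.mul_sum,
      Finset.sum_add_distrib, hC.row_sum, (MonotoneOp.one K μ).map_one]
    norm_num
  antitone f hf := by
    rw [lazy_mulVec]
    refine hC.antitone_sub_gen (by norm_num) (fun i => ?_) hf
    linarith [hC.le_one i.castSucc i.succ, hC.le_one i.succ i.castSucc]
  comm := by
    unfold lazy
    exact ((Commute.one_left K).add_left (Commute.refl K)).smul_left _

/-- Since `I - K = 2 (I - lazy K)`, the semigroup runs the lazy chain at rate 2. The lazy chain is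
monotone without further hypotheses, so continuous time needs none. -/
lemma heat_eq (K : Matrix (Fin (n + 1)) (Fin (n + 1)) ℝ) (t : ℝ) :
    heat K t = Real.exp (-(2 * t)) • NormedSpace.exp ((2 * t) • lazy K) := by
  have h1 : (-t) • (1 - K) = (-(2 * t)) • (1 : Matrix (Fin (n + 1)) (Fin (n + 1)) ℝ) +
      (2 * t) • lazy K := by
    rw [lazy, smul_smul, smul_add, smul_sub, add_left_comm, ← add_assoc, ← add_smul]
    module
  have h2 : NormedSpace.exp ((-(2 * t)) • (1 : Matrix (Fin (n + 1)) (Fin (n + 1)) ℝ)) =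
      Real.exp (-(2 * t)) • 1 := by
    refine Matrix.ext_of_mulVec_single fun i => ?_
    rw [exp_mulVec_eigenvector (a := -(2 * t)), Matrix.smul_mulVec, Matrix.one_mulVec]
    rw [Matrix.smul_mulVec, Matrix.one_mulVec]
  rw [heat, h1, Matrix.exp_add_of_commute, h2, smul_mul_assoc, one_mul]
  exact ((Commute.one_left _).smul_left _).smul_right _

/-- The exponential series has nonnegative coefficients, so any linear inequality valid for all
powers passes to the exponential. Reversibility and monotonicity of `heat` are both obtained in this
way. -/
lemma functional_exp_nonneg (ℓ : Matrix (Fin (n + 1)) (Fin (n + 1)) ℝ →ₗ[ℝ] ℝ)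
    {A : Matrix (Fin (n + 1)) (Fin (n + 1)) ℝ} {c : ℝ} (hc : 0 ≤ c)
    (h : ∀ k, 0 ≤ ℓ (A ^ k)) : 0 ≤ ℓ (NormedSpace.exp (c • A)) := by
  refine (hasSum_functional_exp ℓ (c • A)).nonneg fun k => ?_
  rw [smul_pow, map_smul, smul_eq_mul]
  have := h k
  positivity

lemma heat_mulVec_eigenvector {f : Fin (n + 1) → ℝ} {l : ℝ} (h : gen K f = l • f) (t : ℝ) :
    (heat K t).mulVec f = Real.exp (-t * l) • f := by
  refine exp_mulVec_eigenvector ?_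
  rw [Matrix.smul_mulVec, mul_smul, ← h]
  rfl

lemma Chain.monotoneOp_heat (hC : Chain K μ) {t : ℝ} (ht : 0 ≤ t) : MonotoneOp K μ (heat K t) where
  reversible x y := by
    let ℓ : Matrix (Fin (n + 1)) (Fin (n + 1)) ℝ →ₗ[ℝ] ℝ :=
      { toFun := fun A => μ x * A x y - μ y * A y x
        map_add' := fun A B => by simp only [Matrix.add_apply]; ring
        map_smul' := fun a A => by
          simp only [Matrix.smul_apply, smul_eq_mul, RingHom.id_apply]; ring }
    have h0 : ∀ k, ℓ (lazy K ^ k) = 0 := fun k =>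
      sub_eq_zero.2 ((hC.monotoneOp_lazy.pow k).reversible x y)
    have h1 : ℓ (NormedSpace.exp ((2 * t) • lazy K)) = 0 := by
      refine le_antisymm ?_ ?_
      · have := functional_exp_nonneg (-ℓ) (A := lazy K) (c := 2 * t) (by linarith)
          (fun k => by simp [h0])
        simpa using this
      · exact functional_exp_nonneg ℓ (by linarith) (fun k => (h0 k).ge)
    have h2 : ℓ (heat K t) = 0 := by rw [heat_eq, map_smul, h1, smul_zero]
    exact sub_eq_zero.1 h2
  map_one x := by
    have h1 : gen K (fun _ => 1) = (0 : ℝ) • (fun _ => 1) := by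
      funext x
      simp [gen_eq, Matrix.mulVec, dotProduct, hC.row_sum]
    have := congrFun (heat_mulVec_eigenvector h1 t) x
    simpa [Matrix.mulVec, dotProduct] using this
  antitone f hf := by
    refine antitone_iff_grad_nonneg.2 fun i => ?_
    have h1 := functional_exp_nonneg (evalAt f i.castSucc - evalAt f i.succ) (A := lazy K)
      (c := 2 * t) (by linarith)
      (fun k => antitone_iff_grad_nonneg.1 ((hC.monotoneOp_lazy.pow k).antitone f hf) i)
    rw [heat_eq, Matrix.smul_mulVec]
    have h2 : grad (Real.exp (-(2 * t)) • (NormedSpace.exp ((2 * t) • lazy K)).mulVec f) i =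
        Real.exp (-(2 * t)) * (evalAt f i.castSucc - evalAt f i.succ)
          (NormedSpace.exp ((2 * t) • lazy K)) := by
      simp [grad, evalAt, mul_sub]
    rw [h2]
    exact mul_nonneg (Real.exp_pos _).le h1
  comm := by
    open scoped Matrix.Norms.Operator in
    exact Commute.exp_left (((Commute.one_left K).sub_left (Commute.refl K)).smul_left (-t))

open scoped Matrix.Norms.Operator in
lemma hasDerivAt_heat (v : Fin (n + 1) → ℝ) (x : Fin (n + 1)) (t : ℝ) :
    HasDerivAt (fun t => (heat K t).mulVec v x) (-(heat K t).mulVec (gen K v) x) t := by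
  have h1 := hasDerivAt_exp_smul_const (-(1 - K)) t
  have h2 := (evalAt v x).toContinuousLinearMap.hasFDerivAt.comp_hasDerivAt t h1
  have h3 : ∀ t : ℝ, heat K t = NormedSpace.exp (t • -(1 - K)) := by
    intro t
    rw [heat, smul_neg, neg_smul]
  simp only [h3]
  refine (h2.congr_deriv ?_)
  change (_ * -(1 - K)).mulVec v x = _
  rw [mul_neg, Matrix.neg_mulVec, ← Matrix.mulVec_mulVec]
  rfl

lemma heat_zero (K : Matrix (Fin (n + 1)) (Fin (n + 1)) ℝ) : heat K 0 = 1 := by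
  simp [heat]

end Heat

/-! ### Two-sided bounds on mixing times at a fixed `n`. -/

section MixingTimes

variable {n : ℕ} {K : Matrix (Fin (n + 1)) (Fin (n + 1)) ℝ} {μ : Fin (n + 1) → ℝ} {ε r : ℝ}

namespace Chain

lemma sepMean_nonneg (hC : Chain K μ) : 0 ≤ sepMean K μ :=
  Finset.sum_nonneg fun i _ => div_nonneg
    (mul_nonneg (hC.cum_pos i).le (sub_nonneg.2 (hC.cum_lt_one i).le)) (hC.flow_pos i).le

lemma startDensity_last (hn : 1 ≤ n) : startDensity μ (Fin.last n) = -1 := by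
  have : Fin.last n ≠ 0 := by
    simp only [ne_eq, Fin.ext_iff, Fin.val_last, Fin.val_zero]; omega
  simp [startDensity, this]

lemma sep_heat_chebyshev (hC : Chain K μ) (hn : 1 ≤ n) {t : ℝ} (ht : 0 ≤ t) :
    (sepMean K μ ≤ t → (t - sepMean K μ) ^ 2 * sep (heat K t 0) μ ≤ sepVar K μ) ∧
      (t ≤ sepMean K μ → (t - sepMean K μ) ^ 2 * (1 - sep (heat K t 0) μ) ≤ sepVar K μ) := by
  obtain ⟨u, z, hh, hu, hz, h0, hu0, hz0, hgu, hgz, hm, hv⟩ := hC.exists_potentials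
  have hd : ∀ v t, HasDerivAt (fun t => -(heat K t).mulVec v (Fin.last n))
      ((heat K t).mulVec (gen K v) (Fin.last n)) t := fun v t => by
    simpa using (hasDerivAt_heat (K := K) v (Fin.last n) t).fun_neg
  have hop : ∀ t, 0 ≤ t → MonotoneOp K μ (heat K t) := fun t ht => hC.monotoneOp_heat ht
  have := chebyshev_continuous (m := sepMean K μ) (v := sepVar K μ)
    (F := fun t => -(heat K t).mulVec (startDensity μ) (Fin.last n))
    (U := fun t => -(heat K t).mulVec u (Fin.last n))
    (Z := fun t => -(heat K t).mulVec z (Fin.last n))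
    (hd (startDensity μ)) (fun t => by simpa [hgu] using hd u t)
    (fun t => by simpa [hgz] using hd z t)
    (fun t ht => by
      rw [← (hop t ht).gen_mulVec]
      exact MonotoneOp.gen_last_nonpos hC ((hop t ht).antitone _ hh))
    (fun t ht => neg_nonneg.2 ((hop t ht).last_nonpos hC hu hu0))
    (fun t ht => neg_nonneg.2 ((hop t ht).last_nonpos hC hz hz0))
    (by simp [heat_zero, startDensity_last hn]) (by simpa [heat_zero] using hm)
    (by simpa [heat_zero] using hv) ht
  rwa [(hop t ht).sep_eq hC]

lemma sep_pow_chebyshev (hC : Chain K μ) (hn : 1 ≤ n)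
    (hmono : ∀ i : Fin n, K i.castSucc i.succ + K i.succ i.castSucc ≤ 1) (k : ℕ) :
    (sepMean K μ ≤ k + 1 →
        (k + 1 - sepMean K μ) ^ 2 * sep ((K ^ k) 0) μ ≤ sepVar K μ - sepMean K μ) ∧
      (k ≤ sepMean K μ →
        (k - sepMean K μ) ^ 2 * (1 - sep ((K ^ k) 0) μ) ≤ sepVar K μ - sepMean K μ) := by
  obtain ⟨u, z, hh, hu, hz, h0, hu0, hz0, hgu, hgz, hm, hv⟩ := hC.exists_potentials
  have hop : ∀ k, MonotoneOp K μ (K ^ k) := fun k => (hC.monotoneOp hmono).pow k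
  have hstep : ∀ v k, (K ^ (k + 1)).mulVec v (Fin.last n) =
      (K ^ k).mulVec v (Fin.last n) - (K ^ k).mulVec (gen K v) (Fin.last n) := by
    intro v k
    rw [pow_succ, ← Matrix.mulVec_mulVec, gen, Matrix.sub_mulVec, Matrix.one_mulVec,
      Matrix.mulVec_sub, Pi.sub_apply]
    ring
  have := chebyshev_discrete (m := sepMean K μ) (v := sepVar K μ)
    (F := fun k => -(K ^ k).mulVec (startDensity μ) (Fin.last n))
    (U := fun k => -(K ^ k).mulVec u (Fin.last n))
    (Z := fun k => -(K ^ k).mulVec z (Fin.last n))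
    (fun k => by rw [hstep, hgu]; ring) (fun k => by rw [hstep, hgz]; ring)
    (fun k => by
      have := MonotoneOp.gen_last_nonpos hC ((hop k).antitone _ hh)
      rw [(hop k).gen_mulVec] at this
      rw [hstep]; linarith)
    (fun k => neg_nonneg.2 ((hop k).last_nonpos hC hh h0))
    (fun k => neg_nonneg.2 ((hop k).last_nonpos hC hu hu0))
    (fun k => neg_nonneg.2 ((hop k).last_nonpos hC hz hz0))
    (by simp [startDensity_last hn]) (by simpa using hm) (by simpa using hv) k
  rwa [(hop k).sep_eq hC]

lemma exp_le_sep_heat (hC : Chain K μ) (hn : 1 ≤ n) {t : ℝ} (ht : 0 ≤ t) :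
    Real.exp (-t * spectralGap K) ≤ sep (heat K t 0) μ := by
  obtain ⟨-, ⟨f, hf, hf0, hpos, hgen, -⟩, -⟩ := hC.gap_spec hn
  exact (hC.monotoneOp_heat ht).le_sep hC hf hf0 hpos (heat_mulVec_eigenvector hgen t)

lemma pow_le_sep_pow (hC : Chain K μ) (hn : 1 ≤ n)
    (hmono : ∀ i : Fin n, K i.castSucc i.succ + K i.succ i.castSucc ≤ 1) (k : ℕ) :
    (1 - spectralGap K) ^ k ≤ sep ((K ^ k) 0) μ := by
  obtain ⟨-, ⟨f, hf, hf0, hpos, hgen, -⟩, -⟩ := hC.gap_spec hn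
  refine ((hC.monotoneOp hmono).pow k).le_sep hC hf hf0 hpos ?_
  have hK : K.mulVec f = (1 - spectralGap K) • f := by
    have : K.mulVec f = f - gen K f := by
      rw [gen, Matrix.sub_mulVec, Matrix.one_mulVec]; abel
    rw [this, hgen, sub_smul, one_smul]
  induction k with
  | zero => simp
  | succ k ih => rw [pow_succ', ← Matrix.mulVec_mulVec, ih, Matrix.mulVec_smul, hK, smul_smul,
      ← pow_succ]

lemma exists_sep_heat_le (hC : Chain K μ) (hn : 1 ≤ n) (hr : 0 < r)
    (h1 : sepVar K μ ≤ ε * r ^ 2) : sep (heat K (sepMean K μ + r) 0) μ ≤ ε := by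
  have := (hC.sep_heat_chebyshev hn (add_nonneg hC.sepMean_nonneg hr.le)).1 (by linarith)
  rw [add_sub_cancel_left] at this
  have h2 : 0 < r ^ 2 := by positivity
  nlinarith

lemma exists_sep_pow_le (hC : Chain K μ) (hn : 1 ≤ n)
    (hmono : ∀ i : Fin n, K i.castSucc i.succ + K i.succ i.castSucc ≤ 1) (hε : 0 < ε)
    (hr : 0 < r) (h1 : sepVar K μ - sepMean K μ ≤ ε * r ^ 2) :
    sep ((K ^ ⌈sepMean K μ + r⌉₊) 0) μ ≤ ε := by
  set k := ⌈sepMean K μ + r⌉₊ with hk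
  have hk1 : sepMean K μ + r ≤ k := Nat.le_ceil _
  have := (hC.sep_pow_chebyshev hn hmono k).1 (by linarith)
  have h2 : r ^ 2 ≤ ((k : ℝ) + 1 - sepMean K μ) ^ 2 := by
    exact pow_le_pow_left₀ hr.le (by linarith) 2
  have h3 : 0 < r ^ 2 := by positivity
  have h4 : ε * r ^ 2 ≤ ε * ((k : ℝ) + 1 - sepMean K μ) ^ 2 :=
    mul_le_mul_of_nonneg_left h2 hε.le
  by_contra hcon
  rw [not_le] at hcon
  have h5 := mul_lt_mul_of_pos_left hcon (h3.trans_le h2)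
  linarith

lemma abs_sepTimeC_sub_le (hC : Chain K μ) (hn : 1 ≤ n) (hε1 : ε < 1) (hr : 0 < r)
    (h1 : sepVar K μ ≤ ε * r ^ 2) (h2 : sepVar K μ ≤ (1 - ε) * r ^ 2) :
    |sepTimeC K μ 0 ε - sepMean K μ| ≤ r := by
  have hmem : sepMean K μ + r ∈ {t : ℝ | 0 ≤ t ∧ sep (heat K t 0) μ ≤ ε} :=
    ⟨add_nonneg hC.sepMean_nonneg hr.le, hC.exists_sep_heat_le hn hr h1⟩
  rw [abs_le]
  constructor
  · have : sepMean K μ - r ≤ sepTimeC K μ 0 ε := by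
      refine le_csInf ⟨_, hmem⟩ ?_
      rintro t ⟨ht, hsep⟩
      by_contra hcon
      have h3 := (hC.sep_heat_chebyshev hn ht).2 (by linarith)
      have h4 : r ^ 2 < (t - sepMean K μ) ^ 2 := by nlinarith
      have h5 : (1 - ε) * r ^ 2 < (1 - ε) * (t - sepMean K μ) ^ 2 :=
        mul_lt_mul_of_pos_left h4 (by linarith)
      nlinarith [mul_le_mul_of_nonneg_left (sub_le_sub_left hsep 1)
        (sq_nonneg (t - sepMean K μ))]
    linarith
  · have : sepTimeC K μ 0 ε ≤ sepMean K μ + r := csInf_le ⟨0, fun t ht => ht.1⟩ hmem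
    linarith

lemma neg_log_le_sepTimeC (hC : Chain K μ) (hn : 1 ≤ n) (hε : 0 < ε) :
    -Real.log ε ≤ spectralGap K * sepTimeC K μ 0 ε := by
  have hgap := (hC.gap_spec hn).1
  -- The infimum of an empty set of reals is `0`, so the lower bound requires that level `ε` is
  -- reached.
  have hne : {t : ℝ | 0 ≤ t ∧ sep (heat K t 0) μ ≤ ε}.Nonempty := by
    set r := Real.sqrt (sepVar K μ / ε) + 1 with hr
    have hr0 : 0 < r := by positivity
    refine ⟨_, add_nonneg hC.sepMean_nonneg hr0.le, hC.exists_sep_heat_le hn hr0 ?_⟩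
    have h0 : 0 ≤ sepVar K μ := by
      by_contra hcon
      nlinarith [hC.one_le_gap_sq_mul_sepVar hn, sq_nonneg (spectralGap K)]
    have h1 : sepVar K μ / ε ≤ r ^ 2 := by
      have := Real.sq_sqrt (div_nonneg h0 hε.le)
      have h3 := Real.sqrt_nonneg (sepVar K μ / ε)
      nlinarith
    rwa [div_le_iff₀' hε] at h1
  have : -Real.log ε / spectralGap K ≤ sepTimeC K μ 0 ε := by
    refine le_csInf hne ?_
    rintro t ⟨ht, hsep⟩
    have h1 := (Real.le_log_iff_exp_le hε).2 ((hC.exp_le_sep_heat hn ht).trans hsep)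
    rw [div_le_iff₀ hgap]
    linarith
  rwa [div_le_iff₀' hgap] at this

/-- As in continuous time; the additional 1 pays for rounding up to an integer. -/
lemma abs_sepTime_sub_le (hC : Chain K μ) (hn : 1 ≤ n)
    (hmono : ∀ i : Fin n, K i.castSucc i.succ + K i.succ i.castSucc ≤ 1)
    (hε : 0 < ε) (hε1 : ε < 1) (hr : 0 < r)
    (h1 : sepVar K μ - sepMean K μ ≤ ε * r ^ 2)
    (h2 : sepVar K μ - sepMean K μ ≤ (1 - ε) * r ^ 2) :
    |(sepTime K μ 0 ε : ℝ) - sepMean K μ| ≤ r + 1 := by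
  have hmem : ⌈sepMean K μ + r⌉₊ ∈ {k : ℕ | sep ((K ^ k) 0) μ ≤ ε} :=
    hC.exists_sep_pow_le hn hmono hε hr h1
  rw [abs_le]
  constructor
  · have hsep : sep ((K ^ sepTime K μ 0 ε) 0) μ ≤ ε := Nat.sInf_mem ⟨_, hmem⟩
    set k := sepTime K μ 0 ε
    by_contra hcon
    have h3 := (hC.sep_pow_chebyshev hn hmono k).2 (by linarith)
    have h4 : r ^ 2 < ((k : ℝ) - sepMean K μ) ^ 2 := by nlinarith
    have h5 : (1 - ε) * r ^ 2 < (1 - ε) * ((k : ℝ) - sepMean K μ) ^ 2 :=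
      mul_lt_mul_of_pos_left h4 (by linarith)
    nlinarith [mul_le_mul_of_nonneg_left (sub_le_sub_left hsep 1)
      (sq_nonneg ((k : ℝ) - sepMean K μ))]
  · have h3 : sepTime K μ 0 ε ≤ ⌈sepMean K μ + r⌉₊ := Nat.sInf_le hmem
    have h4 : (sepTime K μ 0 ε : ℝ) ≤ ⌈sepMean K μ + r⌉₊ := by exact_mod_cast h3
    have h5 := Nat.ceil_lt_add_one (add_nonneg hC.sepMean_nonneg hr.le)
    linarith

lemma neg_log_le_sepTime (hC : Chain K μ) (hn : 1 ≤ n)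
    (hmono : ∀ i : Fin n, K i.castSucc i.succ + K i.succ i.castSucc ≤ 1)
    (hε : 0 < ε) (hgap2 : spectralGap K ≤ 1 / 2) :
    -Real.log ε ≤ 2 * (spectralGap K * sepTime K μ 0 ε) := by
  have hgap := (hC.gap_spec hn).1
  have hne : {k : ℕ | sep ((K ^ k) 0) μ ≤ ε}.Nonempty := by
    set r := Real.sqrt (max (sepVar K μ - sepMean K μ) 0 / ε) + 1 with hr
    refine ⟨_, hC.exists_sep_pow_le hn hmono hε (r := r) (by positivity) ?_⟩
    have h0 : 0 ≤ max (sepVar K μ - sepMean K μ) 0 := le_max_right _ _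
    have h1 : max (sepVar K μ - sepMean K μ) 0 / ε ≤ r ^ 2 := by
      have := Real.sq_sqrt (div_nonneg h0 hε.le)
      have h3 := Real.sqrt_nonneg (max (sepVar K μ - sepMean K μ) 0 / ε)
      nlinarith
    rw [div_le_iff₀' hε] at h1
    exact (le_max_left _ _).trans h1
  have hsep : sep ((K ^ sepTime K μ 0 ε) 0) μ ≤ ε := Nat.sInf_mem hne
  set k := sepTime K μ 0 ε
  -- Since `(1 - λ)(1 + 2λ) ≥ 1` exactly when `0 ≤ λ ≤ 1/2`; this is the reason for the restriction
  -- on the gap and the factor 2.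
  have h1 : Real.exp (-(2 * spectralGap K)) ≤ 1 - spectralGap K := by
    rw [Real.exp_neg, inv_le_iff_one_le_mul₀ (Real.exp_pos _)]
    nlinarith [Real.add_one_le_exp (2 * spectralGap K)]
  have h2 : Real.exp (k * -(2 * spectralGap K)) ≤ ε := by
    rw [Real.exp_nat_mul]
    exact (pow_le_pow_left₀ (Real.exp_pos _).le h1 k).trans
      ((hC.pow_le_sep_pow hn hmono k).trans hsep)
  have h3 := (Real.le_log_iff_exp_le hε).2 h2
  linarith

end Chain

end MixingTimes

/-! ### Abstract cutoff criterion for sequences. -/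

section Sequences

variable {T : ℕ → ℝ → ℝ} {s β lam : ℕ → ℝ} {C : ℝ}

/-- The hypothesis rewrites as `(β / s) ^ 2 ≤ C / (s * lam)`. -/
lemma tendsto_window_div (hlam : ∀ n, 1 ≤ n → 0 < lam n) (hs : ∀ n, 1 ≤ n → 0 < s n)
    (hB : ∀ n, 1 ≤ n → lam n * β n ^ 2 ≤ C * s n)
    (h : Tendsto (fun n => s n * lam n) atTop atTop) :
    Tendsto (fun n => β n / s n) atTop (𝓝 0) := by
  have h1 : Tendsto (fun n => C * (s n * lam n)⁻¹) atTop (𝓝 0) := by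
    simpa using h.inv_tendsto_atTop.const_mul C
  have h2 : Tendsto (fun n => (β n / s n) ^ 2) atTop (𝓝 0) := by
    refine squeeze_zero' (Eventually.of_forall fun n => sq_nonneg _) ?_ h1
    filter_upwards [eventually_ge_atTop 1] with n hn
    have h3 := hlam n hn
    have h4 := hs n hn
    rw [div_pow, div_le_iff₀ (by positivity)]
    have h5 := hB n hn
    have h6 : C * (s n * lam n)⁻¹ * s n ^ 2 = C * s n / lam n := by
      field_simp
    rw [h6, le_div_iff₀ h3]
    linarith
  have h3 := (Real.continuous_sqrt.tendsto 0).comp h2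
  simp only [Function.comp_def, Real.sqrt_sq_eq_abs, Real.sqrt_zero] at h3
  exact (tendsto_zero_iff_abs_tendsto_zero _).2 h3

lemma tendsto_div_one (hs : ∀ n, 1 ≤ n → 0 < s n) {D : ℝ} {t : ℕ → ℝ}
    (hW : ∀ n, 1 ≤ n → |t n - s n| ≤ D * β n)
    (h : Tendsto (fun n => β n / s n) atTop (𝓝 0)) :
    Tendsto (fun n => t n / s n) atTop (𝓝 1) := by
  have h1 : Tendsto (fun n => D * (β n / s n)) atTop (𝓝 0) := by simpa using h.const_mul D
  rw [tendsto_iff_norm_sub_tendsto_zero]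
  refine squeeze_zero' (Eventually.of_forall fun n => norm_nonneg _) ?_ h1
  filter_upwards [eventually_ge_atTop 1] with n hn
  have h4 := hs n hn
  rw [Real.norm_eq_abs, div_sub_one h4.ne', abs_div, abs_of_pos h4, ← mul_div_assoc]
  exact div_le_div_of_nonneg_right (hW n hn) h4.le

/-- The product condition gives a cutoff with the given window. -/
lemma hasCutoffWindow_of_tendsto (hlam : ∀ n, 1 ≤ n → 0 < lam n) (hs : ∀ n, 1 ≤ n → 0 < s n)
    (hβ : ∀ n, 1 ≤ n → 0 < β n)
    (hB : ∀ n, 1 ≤ n → lam n * β n ^ 2 ≤ C * s n)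
    (hW : ∀ ε : ℝ, 0 < ε → ε < 1 → ∃ D : ℝ, ∀ n, 1 ≤ n → |T n ε - s n| ≤ D * β n)
    (h : Tendsto (fun n => s n * lam n) atTop atTop) : HasCutoffWindow T s β := by
  have h0 := tendsto_window_div hlam hs hB h
  refine ⟨⟨s, hs, fun ε h1 h2 => ?_⟩, hs, hβ, h0, fun ε h1 h2 => ?_⟩
  · obtain ⟨D, hD⟩ := hW ε h1 h2
    exact tendsto_div_one hs hD h0
  · obtain ⟨D, hD⟩ := hW ε h1 h2
    refine ⟨D, ?_⟩
    filter_upwards [eventually_ge_atTop 1] with n hn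
    exact (div_le_iff₀ (hβ n hn)).2 (hD n hn)

/-- A cutoff forces the product condition. -/
lemma tendsto_of_hasCutoff (hlam : ∀ n, 1 ≤ n → 0 < lam n) (hs : ∀ n : ℕ, 1 ≤ n → (n : ℝ) ≤ s n)
    (hB : ∀ n, 1 ≤ n → lam n * β n ^ 2 ≤ C * s n)
    (hW : ∀ ε : ℝ, 0 < ε → ε < 1 → ∃ D : ℝ, ∀ n, 1 ≤ n → |T n ε - s n| ≤ D * β n)
    (hL : ∀ ε : ℝ, 0 < ε → ε < 1 → ∀ n, 1 ≤ n → lam n ≤ 1 / 2 →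
      -Real.log ε ≤ 2 * (lam n * T n ε))
    (h : HasCutoff T) : Tendsto (fun n => s n * lam n) atTop atTop := by
  obtain ⟨t, ht, hT⟩ := h
  by_contra hcon
  rw [tendsto_atTop] at hcon
  push Not at hcon
  obtain ⟨B, hB'⟩ := hcon
  obtain ⟨D, hD⟩ := hW (1 / 2) (by norm_num) (by norm_num)
  -- When `s * lam ≤ |B|`, the product `lam * β` is bounded through its square, and `E` bounds `lam
  -- * T (1/2)`. The level `exp (-(6E + 1))` is chosen so that `hL` gives `6E + 1 ≤ 2 * lam * T`,
  -- whereas a cutoff forces `T ≤ 3 * T (1/2)` and hence `2 * lam * T ≤ 6E`.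
  set E : ℝ := |B| + |D| * (1 + |C| * |B|) with hE
  have hE0 : 0 ≤ E := by positivity
  have hε : 0 < Real.exp (-(6 * E + 1)) := Real.exp_pos _
  have hε1 : Real.exp (-(6 * E + 1)) < 1 := by
    rw [Real.exp_lt_one_iff]; linarith
  have e1 := (hT _ hε hε1).eventually_lt_const (u := 3 / 2) (by norm_num)
  have e2 := (hT (1 / 2) (by norm_num) (by norm_num)).eventually_const_lt (u := 1 / 2) (by norm_num)
  obtain ⟨j, hj⟩ := exists_nat_ge (2 * |B|)
  obtain ⟨n, hn, h1, h2, hn1, hnj⟩ := (hB'.and_eventually (e1.and (e2.and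
    ((eventually_ge_atTop 1).and (eventually_ge_atTop j))))).exists
  have htn := ht n hn1
  have hl := hlam n hn1
  have hsn := hs n hn1
  have hn0 : (1 : ℝ) ≤ n := by exact_mod_cast hn1
  have hnj' : (j : ℝ) ≤ n := by exact_mod_cast hnj
  have hBn : s n * lam n ≤ |B| := hn.le.trans (le_abs_self B)
  rw [div_lt_iff₀ htn] at h1
  rw [lt_div_iff₀ htn] at h2
  -- From `n * lam n ≤ s n * lam n ≤ |B|` and `n ≥ 2|B|`.
  have hl2 : lam n ≤ 1 / 2 := by
    have h3 : (n : ℝ) * lam n ≤ n * (1 / 2) := by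
      have : (n : ℝ) * lam n ≤ s n * lam n := mul_le_mul_of_nonneg_right hsn hl.le
      linarith
    exact le_of_mul_le_mul_left h3 (by linarith)
  have h3 := hL _ hε hε1 n hn1 hl2
  rw [Real.log_exp] at h3
  have h4 : lam n * T n (1 / 2) ≤ E := by
    have h5 : (lam n * β n) ^ 2 ≤ |C| * |B| := by
      have h6 : lam n * (lam n * β n ^ 2) ≤ lam n * (|C| * s n) := by
        refine mul_le_mul_of_nonneg_left ((hB n hn1).trans ?_) hl.le
        exact mul_le_mul_of_nonneg_right (le_abs_self C) (by linarith)
      have h7 : |C| * (s n * lam n) ≤ |C| * |B| := mul_le_mul_of_nonneg_left hBn (abs_nonneg C)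
      nlinarith
    have h6 : |lam n * β n| ≤ 1 + |C| * |B| := by
      have := sq_abs (lam n * β n)
      nlinarith [sq_nonneg (|lam n * β n| - 1), abs_nonneg (lam n * β n)]
    have h7 : lam n * (D * β n) ≤ |D| * (1 + |C| * |B|) := by
      calc lam n * (D * β n) = D * (lam n * β n) := by ring
        _ ≤ |D * (lam n * β n)| := le_abs_self _
        _ = |D| * |lam n * β n| := abs_mul _ _
        _ ≤ _ := mul_le_mul_of_nonneg_left h6 (abs_nonneg D)
    have h8 := (abs_le.1 (hD n hn1)).2
    have h9 : lam n * T n (1 / 2) ≤ lam n * (s n + D * β n) :=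
      mul_le_mul_of_nonneg_left (by linarith) hl.le
    linarith
  have h5 : lam n * T n (Real.exp (-(6 * E + 1))) ≤ lam n * (3 * T n (1 / 2)) :=
    mul_le_mul_of_nonneg_left (by linarith) hl.le
  linarith

end Sequences

/-! ### Cutoff for both families, in terms of the edge sums. -/

section Families

variable {K : (n : ℕ) → Matrix (Fin (n + 1)) (Fin (n + 1)) ℝ} {μ : (n : ℕ) → Fin (n + 1) → ℝ}
  {M : (n : ℕ) → Fin (n + 1)} {δ : ℝ} {lam s b c : ℕ → ℝ}

lemma abs_sub_hitMean_le {n : ℕ} {K : Matrix (Fin (n + 1)) (Fin (n + 1)) ℝ}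
    {μ : Fin (n + 1) → ℝ} (hC : Chain K μ) (M : Fin (n + 1)) {t r : ℝ}
    (h : |t - sepMean K μ| ≤ r) : |t - hitMean K μ M| ≤ r + meanGap K μ M := by
  have h1 := Chain.sepMean_add_meanGap K μ M
  have h2 := hC.meanGap_nonneg (M := M)
  rw [abs_le] at *
  constructor <;> linarith [h.1, h.2]

theorem continuous_cutoff (hC : ∀ n, 1 ≤ n → Chain (K n) (μ n)) (hδ : 0 < δ)
    (hl : ∀ n, 1 ≤ n → δ ≤ ∑ i ∈ Finset.Iic (M n), μ n i)
    (hr : ∀ n, 1 ≤ n → δ ≤ ∑ i ∈ Finset.Ici (M n), μ n i)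
    (hlam : ∀ n, lam n = spectralGap (K n))
    (hs : ∀ n, 1 ≤ n → s n = hitMean (K n) (μ n) (M n))
    (hb : ∀ n, 1 ≤ n → b n = Real.sqrt (hitVar (K n) (μ n) (M n))) :
    (HasCutoff (fun n ε => sepTimeC (K n) (μ n) 0 ε) ↔
      Tendsto (fun n => s n * lam n) atTop atTop) ∧
    (Tendsto (fun n => s n * lam n) atTop atTop ↔ Tendsto (fun n => s n / b n) atTop atTop) ∧
    (Tendsto (fun n => s n / b n) atTop atTop →
      HasCutoffWindow (fun n ε => sepTimeC (K n) (μ n) 0 ε) s b) := by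
  have hlpos : ∀ n, 1 ≤ n → 0 < lam n := fun n hn => hlam n ▸ ((hC n hn).gap_spec hn).1
  have hsn : ∀ n : ℕ, 1 ≤ n → (n : ℝ) ≤ s n := fun n hn => hs n hn ▸ (hC n hn).le_hitMean
  have hspos : ∀ n, 1 ≤ n → 0 < s n := fun n hn =>
    (by exact_mod_cast hn : (0 : ℝ) < n).trans_le (hsn n hn)
  have hvpos : ∀ n, 1 ≤ n → 0 < hitVar (K n) (μ n) (M n) := fun n hn => (hC n hn).hitVar_pos hn
  have hbpos : ∀ n, 1 ≤ n → 0 < b n := fun n hn => hb n hn ▸ Real.sqrt_pos.2 (hvpos n hn)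
  have hbsq : ∀ n, 1 ≤ n → b n ^ 2 = hitVar (K n) (μ n) (M n) := fun n hn => by
    rw [hb n hn, Real.sq_sqrt (hvpos n hn).le]
  have hB : ∀ n, 1 ≤ n → lam n * b n ^ 2 ≤ 2 / δ * s n := by
    intro n hn
    have := (hC n hn).gap_mul_hitVar_le hn hδ (hl n hn) (hr n hn)
    rw [hbsq n hn, hs n hn, hlam, div_mul_eq_mul_div, le_div_iff₀ hδ]
    linarith
  have hv3 : ∀ n, 1 ≤ n → sepVar (K n) (μ n) ≤ 3 * b n ^ 2 := by
    intro n hn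
    rw [hbsq n hn]
    linarith [(hC n hn).sepVar_le (M := M n), (hC n hn).meanGap_sq_le (M := M n)]
  have hW : ∀ ε : ℝ, 0 < ε → ε < 1 → ∃ D : ℝ, ∀ n, 1 ≤ n →
      |sepTimeC (K n) (μ n) 0 ε - s n| ≤ D * b n := by
    intro ε h0 h1
    have h1' : 0 < 1 - ε := sub_pos.2 h1
    -- Chosen so that `ε R ^ 2` and `(1 - ε) R ^ 2` are both at least 3, the ratio bound of `sepVar`
    -- to `b ^ 2`. The further `2 b` pays for recentring from `sepMean` to `s`.
    set R := Real.sqrt (3 / ε + 3 / (1 - ε)) with hR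
    have hR0 : 0 < R := Real.sqrt_pos.2 (by positivity)
    have hRsq : R ^ 2 = 3 / ε + 3 / (1 - ε) := Real.sq_sqrt (by positivity)
    refine ⟨R + 2, fun n hn => ?_⟩
    have hbn := hbpos n hn
    have h2 : sepVar (K n) (μ n) ≤ ε * (R * b n) ^ 2 := by
      refine (hv3 n hn).trans ?_
      rw [mul_pow, ← mul_assoc, hRsq]
      refine mul_le_mul_of_nonneg_right ?_ (sq_nonneg _)
      rw [mul_add, mul_div_cancel₀ _ h0.ne']
      have : 0 ≤ ε * (3 / (1 - ε)) := by positivity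
      linarith
    have h3 : sepVar (K n) (μ n) ≤ (1 - ε) * (R * b n) ^ 2 := by
      refine (hv3 n hn).trans ?_
      rw [mul_pow, ← mul_assoc, hRsq]
      refine mul_le_mul_of_nonneg_right ?_ (sq_nonneg _)
      rw [mul_add, mul_div_cancel₀ _ h1'.ne']
      have : 0 ≤ (1 - ε) * (3 / ε) := by positivity
      linarith
    have h4 := abs_sub_hitMean_le (hC n hn) (M n)
      ((hC n hn).abs_sepTimeC_sub_le hn h1 (mul_pos hR0 hbn) h2 h3)
    have h5 : meanGap (K n) (μ n) (M n) ≤ 2 * b n := by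
      refine abs_le_of_sq_le_sq' ?_ (by positivity) |>.2
      have := (hC n hn).meanGap_sq_le (M := M n)
      rw [← hbsq n hn] at this
      nlinarith [sq_nonneg (b n)]
    rw [hs n hn]
    linarith
  have hL : ∀ ε : ℝ, 0 < ε → ε < 1 → ∀ n, 1 ≤ n → lam n ≤ 1 / 2 →
      -Real.log ε ≤ 2 * (lam n * sepTimeC (K n) (μ n) 0 ε) := by
    intro ε h0 h1 n hn _
    have h2 := (hC n hn).neg_log_le_sepTimeC hn h0
    have h3 := Real.log_nonpos h0.le h1.le
    rw [hlam]
    linarith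
  have hiff : Tendsto (fun n => s n * lam n) atTop atTop ↔
      Tendsto (fun n => s n / b n) atTop atTop := by
    constructor
    · intro h
      have h1 := tendsto_window_div hlpos hspos hB h
      have h2 : Tendsto (fun n => b n / s n) atTop (𝓝[>] 0) := by
        refine tendsto_nhdsWithin_iff.2 ⟨h1, ?_⟩
        filter_upwards [eventually_ge_atTop 1] with n hn
        exact div_pos (hbpos n hn) (hspos n hn)
      simpa [Function.comp_def] using tendsto_inv_nhdsGT_zero.comp h2
    · intro h
      have h1 : Tendsto (fun n => (1 / 2) * (s n / b n)) atTop atTop :=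
        h.const_mul_atTop (by norm_num)
      refine tendsto_atTop_mono' _ ?_ h1
      filter_upwards [eventually_ge_atTop 1] with n hn
      have h2 := (hC n hn).one_le_gap_sq_mul_sepVar hn
      have h3 := hv3 n hn
      have h4 := hbpos n hn
      have h5 := hspos n hn
      have h6 := hlpos n hn
      rw [← hlam] at h2
      -- The chain `1 ≤ λ² * sepVar ≤ 3 (λ b)²` gives it, whence `s λ ≥ s / (2 b)`.
      have h7 : 1 ≤ 2 * (lam n * b n) := by
        have : lam n ^ 2 * sepVar (K n) (μ n) ≤ lam n ^ 2 * (3 * b n ^ 2) :=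
          mul_le_mul_of_nonneg_left h3 (sq_nonneg _)
        by_contra hcon
        have h8 := mul_pos h6 h4
        nlinarith
      rw [← mul_div_assoc, div_le_iff₀ h4]
      nlinarith
  refine ⟨⟨tendsto_of_hasCutoff hlpos hsn hB hW hL, fun h =>
    (hasCutoffWindow_of_tendsto hlpos hspos hbpos hB hW h).cutoff⟩, hiff, fun h =>
    hasCutoffWindow_of_tendsto hlpos hspos hbpos hB hW (hiff.2 h)⟩

theorem discrete_cutoff (hC : ∀ n, 1 ≤ n → Chain (K n) (μ n)) (hδ : 0 < δ)
    (hl : ∀ n, 1 ≤ n → δ ≤ ∑ i ∈ Finset.Iic (M n), μ n i)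
    (hr : ∀ n, 1 ≤ n → δ ≤ ∑ i ∈ Finset.Ici (M n), μ n i)
    (hlam : ∀ n, lam n = spectralGap (K n))
    (hs : ∀ n, 1 ≤ n → s n = hitMean (K n) (μ n) (M n))
    (hc : ∀ n, 1 ≤ n →
      c n = Real.sqrt (hitVar (K n) (μ n) (M n) - hitMean (K n) (μ n) (M n)))
    (hmono : ∀ n, 1 ≤ n → ∀ i : Fin n, K n i.castSucc i.succ + K n i.succ i.castSucc ≤ 1) :
    (HasCutoff (fun n ε => (sepTime (K n) (μ n) 0 ε : ℝ)) ↔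
      Tendsto (fun n => s n * lam n) atTop atTop) ∧
    (Tendsto (fun n => s n * lam n) atTop atTop ↔ Tendsto (fun n => s n / c n) atTop atTop) ∧
    (Tendsto (fun n => s n / c n) atTop atTop →
      HasCutoffWindow (fun n ε => (sepTime (K n) (μ n) 0 ε : ℝ)) s
        (fun n => max (c n) (1 / lam n))) := by
  have hlpos : ∀ n, 1 ≤ n → 0 < lam n := fun n hn => hlam n ▸ ((hC n hn).gap_spec hn).1
  have hsn : ∀ n : ℕ, 1 ≤ n → (n : ℝ) ≤ s n := fun n hn => hs n hn ▸ (hC n hn).le_hitMean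
  have hspos : ∀ n, 1 ≤ n → 0 < s n := fun n hn =>
    (by exact_mod_cast hn : (0 : ℝ) < n).trans_le (hsn n hn)
  have hcv : ∀ n, 1 ≤ n → 0 < hitVar (K n) (μ n) (M n) - hitMean (K n) (μ n) (M n) :=
    fun n hn => sub_pos.2 ((hC n hn).hitMean_lt_hitVar hn (hmono n hn))
  have hcpos : ∀ n, 1 ≤ n → 0 < c n := fun n hn => hc n hn ▸ Real.sqrt_pos.2 (hcv n hn)
  have hcsq : ∀ n, 1 ≤ n → c n ^ 2 = hitVar (K n) (μ n) (M n) - s n := fun n hn => by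
    rw [hc n hn, Real.sq_sqrt (hcv n hn).le, hs n hn]
  have hβpos : ∀ n, 1 ≤ n → 0 < max (c n) (1 / lam n) := fun n hn =>
    (hcpos n hn).trans_le (le_max_left _ _)
  have hVB : ∀ n, 1 ≤ n → lam n * hitVar (K n) (μ n) (M n) ≤ 2 / δ * s n := by
    intro n hn
    have := (hC n hn).gap_mul_hitVar_le hn hδ (hl n hn) (hr n hn)
    rw [hs n hn, hlam, div_mul_eq_mul_div, le_div_iff₀ hδ]
    linarith
  have hone : ∀ n, 1 ≤ n → 1 ≤ 3 * (lam n ^ 2 * hitVar (K n) (μ n) (M n)) := by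
    intro n hn
    have h1 := (hC n hn).one_le_gap_sq_mul_sepVar hn
    have h2 := (hC n hn).sepVar_le (M := M n)
    have h3 := (hC n hn).meanGap_sq_le (M := M n)
    rw [← hlam] at h1
    nlinarith [mul_le_mul_of_nonneg_left (h2.trans (add_le_add_right h3 _)) (sq_nonneg (lam n))]
  have hB : ∀ n, 1 ≤ n → lam n * max (c n) (1 / lam n) ^ 2 ≤ 6 / δ * s n := by
    intro n hn
    have h1 := hVB n hn
    have h2 := hlpos n hn
    have h3 := hspos n hn
    have h4 : 6 / δ * s n = 3 * (2 / δ * s n) := by ring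
    have h5 : 0 < 2 / δ * s n := by positivity
    rw [h4]
    rcases max_choice (c n) (1 / lam n) with h | h <;> rw [h]
    · rw [hcsq n hn]
      nlinarith
    · have h6 : lam n * (1 / lam n) ^ 2 = 1 / lam n := by field_simp
      rw [h6, div_le_iff₀ h2]
      have := hone n hn
      nlinarith
  have hW : ∀ ε : ℝ, 0 < ε → ε < 1 → ∃ D : ℝ, ∀ n, 1 ≤ n →
      |(sepTime (K n) (μ n) 0 ε : ℝ) - s n| ≤ D * max (c n) (1 / lam n) := by
    intro ε h0 h1
    have h1' : 0 < 1 - ε := sub_pos.2 h1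
    -- The discrete variance satisfies `sepVar - sepMean ≤ c ^ 2 + A + A ^ 2` with `A = meanGap ≤
    -- (2/δ) β`. The linear term is absorbed using `1 ≤ 2 β`, giving the three summands.
    set E := 1 + 4 / δ + (2 / δ) ^ 2 with hE
    have hE0 : 0 < E := by positivity
    set R := Real.sqrt (E / ε + E / (1 - ε)) with hR
    have hR0 : 0 < R := Real.sqrt_pos.2 (by positivity)
    have hRsq : R ^ 2 = E / ε + E / (1 - ε) := Real.sq_sqrt (by positivity)
    refine ⟨R + 2 + 2 / δ, fun n hn => ?_⟩
    set β := max (c n) (1 / lam n) with hβ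
    have hβn : 0 < β := hβpos n hn
    have hlβ : 1 / lam n ≤ β := le_max_right _ _
    have hA0 := (hC n hn).meanGap_nonneg (M := M n)
    have hl2 := (hC n hn).gap_le_two hn
    rw [← hlam] at hl2
    have hβ1 : 1 ≤ 2 * β := by
      have : 1 / 2 ≤ 1 / lam n := one_div_le_one_div_of_le (hlpos n hn) hl2
      linarith
    have hA : meanGap (K n) (μ n) (M n) ≤ 2 / δ * β := by
      have h2 := (hC n hn).gap_mul_meanGap_le hn hδ (hl n hn) (hr n hn)
      rw [← hlam] at h2
      have h3 := hlpos n hn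
      have h4 : meanGap (K n) (μ n) (M n) ≤ 2 / δ * (1 / lam n) := by
        rw [div_mul_div_comm, mul_one, le_div_iff₀ (by positivity)]
        linarith
      exact h4.trans (mul_le_mul_of_nonneg_left hlβ (by positivity))
    have hv : sepVar (K n) (μ n) - sepMean (K n) (μ n) ≤ E * β ^ 2 := by
      have h2 := (hC n hn).sepVar_le (M := M n)
      have h3 := Chain.sepMean_add_meanGap (K n) (μ n) (M n)
      have h4 := hcsq n hn
      have h5 : c n ^ 2 ≤ β ^ 2 := pow_le_pow_left₀ (hcpos n hn).le (le_max_left _ _) 2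
      have h6 : meanGap (K n) (μ n) (M n) ^ 2 ≤ (2 / δ * β) ^ 2 := pow_le_pow_left₀ hA0 hA 2
      have h7 : meanGap (K n) (μ n) (M n) ≤ 4 / δ * β ^ 2 := by
        have : 2 / δ * β * 1 ≤ 2 / δ * β * (2 * β) :=
          mul_le_mul_of_nonneg_left hβ1 (by positivity)
        calc _ ≤ 2 / δ * β * (2 * β) := by linarith
          _ = _ := by ring
      rw [hs n hn] at h4
      rw [mul_pow] at h6
      have h8 : E * β ^ 2 = β ^ 2 + 4 / δ * β ^ 2 + (2 / δ) ^ 2 * β ^ 2 := by rw [hE]; ring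
      linarith
    have h2 : sepVar (K n) (μ n) - sepMean (K n) (μ n) ≤ ε * (R * β) ^ 2 := by
      refine hv.trans ?_
      rw [mul_pow, ← mul_assoc, hRsq]
      refine mul_le_mul_of_nonneg_right ?_ (sq_nonneg _)
      rw [mul_add, mul_div_cancel₀ _ h0.ne']
      have : 0 ≤ ε * (E / (1 - ε)) := by positivity
      linarith
    have h3 : sepVar (K n) (μ n) - sepMean (K n) (μ n) ≤ (1 - ε) * (R * β) ^ 2 := by
      refine hv.trans ?_
      rw [mul_pow, ← mul_assoc, hRsq]
      refine mul_le_mul_of_nonneg_right ?_ (sq_nonneg _)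
      rw [mul_add, mul_div_cancel₀ _ h1'.ne']
      have : 0 ≤ (1 - ε) * (E / ε) := by positivity
      linarith
    have h4 := abs_sub_hitMean_le (hC n hn) (M n)
      ((hC n hn).abs_sepTime_sub_le hn (hmono n hn) h0 h1 (mul_pos hR0 hβn) h2 h3)
    rw [hs n hn]
    linarith
  have hL : ∀ ε : ℝ, 0 < ε → ε < 1 → ∀ n, 1 ≤ n → lam n ≤ 1 / 2 →
      -Real.log ε ≤ 2 * (lam n * (sepTime (K n) (μ n) 0 ε : ℝ)) := by
    intro ε h0 _ n hn hln
    rw [hlam] at hln ⊢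
    exact (hC n hn).neg_log_le_sepTime hn (hmono n hn) h0 hln
  have hiff : Tendsto (fun n => s n * lam n) atTop atTop ↔
      Tendsto (fun n => s n / c n) atTop atTop := by
    constructor
    · intro h
      have h1 := tendsto_window_div hlpos hspos hB h
      have h2 : Tendsto (fun n => max (c n) (1 / lam n) / s n) atTop (𝓝[>] 0) := by
        refine tendsto_nhdsWithin_iff.2 ⟨h1, ?_⟩
        filter_upwards [eventually_ge_atTop 1] with n hn
        exact div_pos (hβpos n hn) (hspos n hn)
      have h3 := tendsto_inv_nhdsGT_zero.comp h2
      simp only [Function.comp_def, inv_div] at h3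
      refine tendsto_atTop_mono' _ ?_ h3
      filter_upwards [eventually_ge_atTop 1] with n hn
      exact div_le_div_of_nonneg_left (hspos n hn).le (hcpos n hn) (le_max_left _ _)
    · intro h
      -- Because `hitVar = c ^ 2 + s`, the bound `1 ≤ 3 λ² * hitVar` says that `1 / (s λ) ^ 2` is at
      -- most this quantity. The extra term `1 / s` vanishes since `s n ≥ n`.
      have h1 : Tendsto (fun n => 3 * ((s n / c n)⁻¹ ^ 2 + (s n)⁻¹)) atTop (𝓝 0) := by
        have hst : Tendsto s atTop atTop := by
          refine tendsto_atTop_mono' _ ?_ tendsto_natCast_atTop_atTop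
          filter_upwards [eventually_ge_atTop 1] with n hn using hsn n hn
        have := ((h.inv_tendsto_atTop.pow 2).add hst.inv_tendsto_atTop).const_mul 3
        simpa using this
      refine tendsto_atTop.2 fun B => ?_
      have hB1 : 0 < ((|B| + 1) ^ 2)⁻¹ := by positivity
      filter_upwards [eventually_ge_atTop 1, h1.eventually_lt_const hB1] with n hn h2
      have h3 := hone n hn
      have h4 := hcsq n hn
      have h5 := hspos n hn
      have h6 := hcpos n hn
      have h7 := hlpos n hn
      have h8 : 3 * ((s n / c n)⁻¹ ^ 2 + (s n)⁻¹) =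
          3 * (hitVar (K n) (μ n) (M n)) / s n ^ 2 := by
        rw [show hitVar (K n) (μ n) (M n) = c n ^ 2 + s n by linarith]
        field_simp
      rw [h8, inv_eq_one_div, div_lt_div_iff₀ (by positivity) (by positivity)] at h2
      have h9 : (|B| + 1) ^ 2 ≤ (s n * lam n) ^ 2 := by
        have h10 : lam n ^ 2 * (3 * hitVar (K n) (μ n) (M n) * (|B| + 1) ^ 2) ≤
            lam n ^ 2 * (1 * s n ^ 2) := mul_le_mul_of_nonneg_left h2.le (sq_nonneg _)
        have h11 := mul_le_mul_of_nonneg_right h3 (sq_nonneg (|B| + 1))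
        nlinarith
      have h10 := (abs_le_of_sq_le_sq' h9 (by positivity)).2
      linarith [le_abs_self B]
  refine ⟨⟨tendsto_of_hasCutoff hlpos hsn hB hW hL, fun h =>
    (hasCutoffWindow_of_tendsto hlpos hspos hβpos hB hW h).cutoff⟩, hiff, fun h =>
    hasCutoffWindow_of_tendsto hlpos hspos hβpos hB hW (hiff.2 h)⟩

end Families

/-! ### Potentials for the hitting time of `M`. -/

section HittingPotentials

variable {n : ℕ} {K : Matrix (Fin (n + 1)) (Fin (n + 1)) ℝ} {μ : Fin (n + 1) → ℝ}
  {M : Fin (n + 1)}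

/-- The coefficient of the gradient across edge `i` in the increment of a function from `M` to
`j`. -/
def pathCoeff (M : Fin (n + 1)) (i : Fin n) (j : Fin (n + 1)) : ℝ := below i j - below i M

lemma eq_sum_pathCoeff {f : Fin (n + 1) → ℝ} (h : f M = 0) (j : Fin (n + 1)) :
    f j = ∑ i, pathCoeff M i j * grad f i := by
  rw [← sub_zero (f j), ← h, eq_last_add_sum_grad f j, eq_last_add_sum_grad f M]
  simp only [pathCoeff, sub_mul, Finset.sum_sub_distrib]
  ring

lemma below_of_lt {i : Fin n} (h : i.castSucc < M) : below i M = 0 := by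
  simp [below, not_le.2 h]

lemma below_of_not_lt {i : Fin n} (h : ¬ i.castSucc < M) : below i M = 1 := by
  simp [below, not_lt.1 h]

namespace Chain

/-- The counterpart of `cov` for functions vanishing at `M` instead of having mean zero. Up to sign,
each `pathCoeff` is the indicator of the far side of its edge, so opposite sides do not interact. -/
lemma sum_pathCoeff_mul (hC : Chain K μ) (i k : Fin n) :
    ∑ j, μ j * pathCoeff M k j * pathCoeff M i j =
      if SameSide M i k then min (far μ M i) (far μ M k) else 0 := by
  have h1 : ∑ j, μ j * pathCoeff M k j * pathCoeff M i j =
      min (cum μ k) (cum μ i) - below k M * cum μ i - below i M * cum μ k +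
        below k M * below i M := by
    rw [← hC.sum_below_mul_below]
    have : ∀ j, μ j * pathCoeff M k j * pathCoeff M i j = μ j * below k j * below i j -
        below k M * (μ j * below i j) - below i M * (μ j * below k j) +
        below k M * below i M * μ j := by
      intro j; simp only [pathCoeff]; ring
    simp only [this, Finset.sum_add_distrib, Finset.sum_sub_distrib, ← Finset.mul_sum,
      hC.sum_eq_one, cum, mul_one]
  have hmono : ∀ {i k : Fin n}, i.castSucc < M → ¬ k.castSucc < M → cum μ i ≤ cum μ k := by
    intro i k hi hk
    exact hC.cum_mono (Fin.castSucc_le_castSucc_iff.1 (hi.trans_le (not_lt.1 hk)).le)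
  rw [h1]
  unfold SameSide far
  by_cases hi : i.castSucc < M <;> by_cases hk : k.castSucc < M
  · simp [hi, hk, below_of_lt hi, below_of_lt hk, min_comm]
  · simp [hi, hk, below_of_lt hi, below_of_not_lt hk, hmono hi hk]
  · simp [hi, hk, below_of_not_lt hi, below_of_lt hk, hmono hk hi]
  · simp only [hi, hk, below_of_not_lt hi, below_of_not_lt hk, if_true, if_false,
      min_sub_sub_left, iff_self]
    rw [min_comm]
    linarith [min_add_max (cum μ i) (cum μ k)]

/-- The functions `g` and `g₂` solve the Dirichlet problems whose probabilistic meaning, by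
`hasSum_avoid`, is the sum of the tails and the sum of `m + 1` times the tails of the hitting time.
-/
lemma exists_hitting_potentials (hC : Chain K μ) (M : Fin (n + 1)) :
    ∃ g g₂ : Fin (n + 1) → ℝ, (∀ x, 0 ≤ g x) ∧ (∀ x, 0 ≤ g₂ x) ∧ g M = 0 ∧ g₂ M = 0 ∧
      (∀ x, x ≠ M → gen K g x = 1) ∧ (∀ x, x ≠ M → gen K g₂ x = g x) ∧
      g 0 + g (Fin.last n) = hitMean K μ M ∧
      2 * (g₂ 0 + g₂ (Fin.last n)) - g 0 ^ 2 - g (Fin.last n) ^ 2 = hitVar K μ M := by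
  set σ : Fin n → ℝ := fun i => if i.castSucc < M then 1 else -1 with hσ
  have hσφ : ∀ i, σ i * far μ M i = cum μ i - below i M := by
    intro i
    simp only [hσ, far]
    split_ifs with h
    · rw [below_of_lt h]; ring
    · rw [below_of_not_lt h]; ring
  have hσκ : ∀ i j, 0 ≤ pathCoeff M i j * σ i := by
    intro i j
    simp only [pathCoeff, hσ]
    split_ifs with h
    · rw [below_of_lt h]; linarith [below_nonneg i j]
    · rw [below_of_not_lt h]; linarith [below_le_one i j]
  have hσ2 : ∀ i, σ i * σ i = 1 := by
    intro i; simp only [hσ]; split_ifs <;> norm_num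
  have hend : ∀ i, pathCoeff M i 0 + pathCoeff M i (Fin.last n) = σ i := by
    intro i
    simp only [pathCoeff, hσ, below_zero, below_last]
    split_ifs with h
    · rw [below_of_lt h]; ring
    · rw [below_of_not_lt h]; ring
  have hendsq : ∀ i k, pathCoeff M i 0 * pathCoeff M k 0 +
      pathCoeff M i (Fin.last n) * pathCoeff M k (Fin.last n) =
      if SameSide M i k then σ i * σ k else 0 := by
    intro i k
    unfold SameSide
    simp only [pathCoeff, hσ, below_zero, below_last]
    by_cases hi : i.castSucc < M <;> by_cases hk : k.castSucc < M
    · simp [hi, hk, below_of_lt hi, below_of_lt hk]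
    · simp [hi, hk, below_of_lt hi, below_of_not_lt hk]
    · simp [hi, hk, below_of_not_lt hi, below_of_lt hk]
    · simp [hi, hk, below_of_not_lt hi, below_of_not_lt hk]
  set B : Fin n → Fin n → ℝ := fun i k =>
    if SameSide M i k then min (far μ M i) (far μ M k) else 0 with hB
  have hBnn : ∀ i k, 0 ≤ B i k := by
    intro i k
    simp only [hB]
    split_ifs
    · exact (lt_min (hC.far_pos i) (hC.far_pos k)).le
    · exact le_rfl
  have hBσ : ∀ i k, σ k * B i k = σ i * B i k := by
    intro i k
    simp only [hB]
    split_ifs with h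
    · unfold SameSide at h
      simp only [hσ, h]
    · simp
  obtain ⟨g, hg, hgM⟩ := exists_grad_eq (fun i => σ i * far μ M i / flow K μ i) M
  obtain ⟨g₂, hg₂, hg₂M⟩ := exists_grad_eq
    (fun i => (∑ k, σ k * far μ M k / flow K μ k * B i k) / flow K μ i) M
  have hMne := (hC.pos M).ne'
  -- A point sink at `M`, where nothing is prescribed, makes the source have mean zero; the same
  -- device serves for `g₂`.
  have hgen : gen K g = fun x => 1 - if x = M then 1 / μ M else 0 := by
    refine hC.gen_eq_of_grad ?_ fun i => ?_
    · simp [mul_sub, hC.sum_eq_one, hMne]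
    · rw [hg, hσφ]
      congr 1
      simp [mul_sub, sub_mul, hMne, cum]
  have hgen₂ : gen K g₂ = fun x => g x - if x = M then (∑ j, μ j * g j) / μ M else 0 := by
    refine hC.gen_eq_of_grad ?_ fun i => ?_
    · simp [mul_sub, mul_div_cancel₀ _ hMne]
    · rw [hg₂]
      congr 1
      have h1 : ∑ j, μ j * (g j - if j = M then (∑ j, μ j * g j) / μ M else 0) * below i j =
          ∑ j, μ j * g j * pathCoeff M i j := by
        simp only [pathCoeff, mul_sub, sub_mul, Finset.sum_sub_distrib, ← Finset.sum_mul,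
          mul_ite, ite_mul, mul_zero, zero_mul, Finset.sum_ite_eq', Finset.mem_univ, if_true,
          mul_div_cancel₀ _ hMne]
      rw [h1]
      have h2 : ∀ j, μ j * g j * pathCoeff M i j = ∑ k, σ k * far μ M k / flow K μ k *
          (μ j * pathCoeff M k j * pathCoeff M i j) := by
        intro j
        rw [eq_sum_pathCoeff hgM j, Finset.mul_sum, Finset.sum_mul]
        refine Finset.sum_congr rfl fun k _ => ?_
        rw [hg]; ring
      rw [Finset.sum_congr rfl fun j _ => h2 j, Finset.sum_comm]
      refine Finset.sum_congr rfl fun k _ => ?_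
      rw [← Finset.mul_sum, hC.sum_pathCoeff_mul]
  have hg₂' : ∀ i, grad g₂ i = σ i * (∑ k, far μ M k / flow K μ k * B i k) / flow K μ i := by
    intro i
    rw [hg₂, Finset.mul_sum]
    congr 1
    refine Finset.sum_congr rfl fun k _ => ?_
    have := hBσ i k
    calc _ = far μ M k / flow K μ k * (σ k * B i k) := by ring
      _ = _ := by rw [this]; ring
  refine ⟨g, g₂, fun x => ?_, fun x => ?_, hgM, hg₂M, fun x hx => ?_, fun x hx => ?_, ?_, ?_⟩
  · rw [eq_sum_pathCoeff hgM]
    refine Finset.sum_nonneg fun i _ => ?_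
    rw [hg, mul_div_assoc, ← mul_assoc]
    exact mul_nonneg (hσκ i x) (div_nonneg (hC.far_pos i).le (hC.flow_pos i).le)
  · rw [eq_sum_pathCoeff hg₂M]
    refine Finset.sum_nonneg fun i _ => ?_
    rw [hg₂', mul_div_assoc, ← mul_assoc]
    refine mul_nonneg (hσκ i x) (div_nonneg (Finset.sum_nonneg fun k _ => ?_) (hC.flow_pos i).le)
    exact mul_nonneg (div_nonneg (hC.far_pos k).le (hC.flow_pos k).le) (hBnn i k)
  · rw [hgen]; simp [hx]
  · rw [hgen₂]; simp [hx]
  · rw [eq_sum_pathCoeff hgM 0, eq_sum_pathCoeff hgM (Fin.last n), ← Finset.sum_add_distrib,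
      hitMean]
    refine Finset.sum_congr rfl fun i _ => ?_
    rw [← add_mul, hend, hg, mul_div_assoc, ← mul_assoc, hσ2, one_mul]
  · have h1 : g₂ 0 + g₂ (Fin.last n) = ∑ i, ∑ k,
        far μ M k * B i k / (flow K μ i * flow K μ k) := by
      rw [eq_sum_pathCoeff hg₂M 0, eq_sum_pathCoeff hg₂M (Fin.last n), ← Finset.sum_add_distrib]
      refine Finset.sum_congr rfl fun i _ => ?_
      rw [← add_mul, hend, hg₂', mul_div_assoc, ← mul_assoc, hσ2, one_mul, Finset.sum_div]
      refine Finset.sum_congr rfl fun k _ => ?_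
      rw [div_mul_eq_mul_div, div_div, mul_comm (flow K μ k)]
    have h2 : g₂ 0 + g₂ (Fin.last n) = ∑ i, ∑ k,
        far μ M i * B i k / (flow K μ i * flow K μ k) := by
      rw [h1, Finset.sum_comm]
      refine Finset.sum_congr rfl fun i _ => Finset.sum_congr rfl fun k _ => ?_
      have : B k i = B i k := by
        by_cases h : SameSide M i k
        · have h' : SameSide M k i := h.symm
          simp only [hB, h, h', if_true, min_comm]
        · have h' : ¬ SameSide M k i := fun h' => h h'.symm
          simp only [hB, h, h', if_false]
      rw [this, mul_comm (flow K μ i)]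
    have h3 : g 0 ^ 2 + g (Fin.last n) ^ 2 = ∑ i, ∑ k, (if SameSide M i k then
        far μ M i * far μ M k else 0) / (flow K μ i * flow K μ k) := by
      rw [eq_sum_pathCoeff hgM 0, eq_sum_pathCoeff hgM (Fin.last n), sq, sq, Finset.sum_mul_sum,
        Finset.sum_mul_sum, ← Finset.sum_add_distrib]
      refine Finset.sum_congr rfl fun i _ => ?_
      rw [← Finset.sum_add_distrib]
      refine Finset.sum_congr rfl fun k _ => ?_
      rw [hg, hg]
      have h4 := hendsq i k
      calc _ = (pathCoeff M i 0 * pathCoeff M k 0 +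
            pathCoeff M i (Fin.last n) * pathCoeff M k (Fin.last n)) * (σ i * σ k) *
            (far μ M i * far μ M k) / (flow K μ i * flow K μ k) := by
            rw [← div_mul_div_comm]; ring
        _ = _ := by
            rw [h4]
            congr 1
            split_ifs
            · rw [mul_mul_mul_comm (σ i), hσ2, hσ2]; ring
            · ring
    rw [sub_sub, h3, two_mul]
    nth_rewrite 1 [h1]
    rw [h2, hitVar, ← Finset.sum_add_distrib, ← Finset.sum_sub_distrib]
    refine Finset.sum_congr rfl fun i _ => ?_
    rw [← Finset.sum_add_distrib, ← Finset.sum_sub_distrib]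
    refine Finset.sum_congr rfl fun k _ => ?_
    rw [← add_div, ← sub_div]
    simp only [hB]
    split_ifs with h
    · congr 1
      -- For same-side far masses `p` and `q`, `(p + q) * min p q - p * q = (min p q) ^ 2`.
      rcases le_total (far μ M i) (far μ M k) with h5 | h5
      · rw [min_eq_left h5]; ring
      · rw [min_eq_right h5]; ring
    · simp

end Chain

end HittingPotentials

/-! ### Tails of the discrete hitting time through the chain killed at `M`. -/

section DiscreteHitting

variable {n : ℕ} {K : Matrix (Fin (n + 1)) (Fin (n + 1)) ℝ} {μ : Fin (n + 1) → ℝ}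
  {M j : Fin (n + 1)} {Ω : Type*} {X : ℕ → Ω → Fin (n + 1)}

/-- The event that `M` is not visited up to time `m`. -/
def avoid (X : ℕ → Ω → Fin (n + 1)) (M : Fin (n + 1)) (m : ℕ) : Set Ω :=
  {ω | ∀ k ≤ m, X k ω ≠ M}

lemma lt_hit_iff (ω : Ω) (m : ℕ) : (m : ℝ≥0∞) < hit X M ω ↔ ω ∈ avoid X M m := by
  constructor
  · intro h k hk hX
    refine absurd h (not_lt.2 ?_)
    exact (iInf₂_le k hX).trans (by exact_mod_cast hk)
  · intro h
    refine lt_of_lt_of_le (b := ((m + 1 : ℕ) : ℝ≥0∞)) (by exact_mod_cast Nat.lt_succ_self m) ?_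
    refine le_iInf₂ fun k hX => ?_
    have : ¬ k ≤ m := fun hk => h k hk hX
    exact_mod_cast (by omega : m + 1 ≤ k)

lemma hit_eq_top_or_nat (ω : Ω) : hit X M ω = ∞ ∨ ∃ N : ℕ, hit X M ω = N := by
  by_cases h : ∃ k, X k ω = M
  · right
    classical
    refine ⟨Nat.find h, le_antisymm (iInf₂_le (f := fun (m : ℕ) (_ : X m ω = M) => (m : ℝ≥0∞)) _
      (Nat.find_spec h)) ?_⟩
    refine le_iInf₂ fun k hX => ?_
    exact_mod_cast Nat.find_min' h hX
  · left
    push Not at h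
    simp [hit, h]

variable [MeasurableSpace Ω] {P : Measure Ω}

lemma measurable_hit (hX : ∀ m, Measurable (X m)) : Measurable (hit X M) := by
  unfold hit
  refine Measurable.iInf fun m => ?_
  simp only [iInf_eq_if]
  exact Measurable.ite (hX m (measurableSet_singleton M)) measurable_const measurable_const

lemma measurableSet_avoid (hX : ∀ m, Measurable (X m)) (m : ℕ) :
    MeasurableSet (avoid X M m) := by
  have : avoid X M m = ⋂ k, ⋂ (_ : k ≤ m), X k ⁻¹' {M}ᶜ := by
    ext ω; simp [avoid]
  rw [this]
  exact MeasurableSet.iInter fun k => MeasurableSet.iInter fun _ =>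
    hX k (measurableSet_singleton M).compl

lemma measure_inter_eq_sum {α : Type*} [Fintype α] [MeasurableSpace α]
    [MeasurableSingletonClass α] {Y : Ω → α} (hY : Measurable Y) (S : Finset α) (B : Set Ω)
    (hB : MeasurableSet B) :
    P (Y ⁻¹' S ∩ B) = ∑ p ∈ S, P (Y ⁻¹' {p} ∩ B) := by
  rw [← measure_biUnion_finset]
  · congr 1
    ext ω
    simp
  · intro p _ q _ hpq
    refine Set.disjoint_left.2 ?_
    rintro ω ⟨h1, -⟩ ⟨h2, -⟩
    exact hpq (h1.symm.trans h2)
  · exact fun p _ => (hY (measurableSet_singleton p)).inter hB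

/-- The Markov property on the event that `M` has not been visited. -/
lemma IsMarkovChain.measure_avoid_step (hX : IsMarkovChain K j X P) (m : ℕ)
    (y z : Fin (n + 1)) :
    P (avoid X M m ∩ {ω | X m ω = y} ∩ {ω | X (m + 1) ω = z}) =
      P (avoid X M m ∩ {ω | X m ω = y}) * ENNReal.ofReal (K y z) := by
  classical
  set Y : Ω → Fin (m + 1) → Fin (n + 1) := fun ω k => X k ω with hYdef
  have hY : Measurable Y := measurable_pi_lambda _ fun k => hX.measurable k
  have hz : MeasurableSet {ω | X (m + 1) ω = z} :=
    hX.measurable (m + 1) (measurableSet_singleton z)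
  set S : Finset (Fin (m + 1) → Fin (n + 1)) :=
    Finset.univ.filter fun p => (∀ k, p k ≠ M) ∧ p (Fin.last m) = y with hS
  have hset : avoid X M m ∩ {ω | X m ω = y} = Y ⁻¹' S := by
    ext ω
    simp only [avoid, hS, hYdef, Set.mem_inter_iff, Set.mem_ofPred_eq, Set.mem_preimage,
      Finset.coe_filter, Finset.mem_univ, true_and, Fin.val_last]
    refine and_congr_left fun _ => ⟨fun h k => h k (by omega), fun h k hk => h ⟨k, by omega⟩⟩
  have hpath : ∀ p : Fin (m + 1) → Fin (n + 1),
      P (Y ⁻¹' {p} ∩ {ω | X (m + 1) ω = z}) =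
        P (Y ⁻¹' {p}) * ENNReal.ofReal (K (p (Fin.last m)) z) := by
    intro p
    set x : ℕ → Fin (n + 1) := fun k => if h : k < m + 1 then p ⟨k, h⟩ else z with hx
    have h1 : {ω | ∀ k ≤ m, X k ω = x k} = Y ⁻¹' {p} := by
      ext ω
      simp only [Set.mem_ofPred_eq, Set.mem_preimage, Set.mem_singleton_iff, funext_iff, hYdef, hx]
      constructor
      · intro h k
        have := h k (by omega)
        rwa [dif_pos k.2] at this
      · intro h k hk
        rw [dif_pos (by omega)]
        exact h ⟨k, by omega⟩
    have h2 : {ω | ∀ k ≤ m + 1, X k ω = x k} = Y ⁻¹' {p} ∩ {ω | X (m + 1) ω = z} := by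
      rw [← h1]
      ext ω
      have hxm : x (m + 1) = z := by simp [hx]
      simp only [Set.mem_ofPred_eq, Set.mem_inter_iff]
      constructor
      · exact fun h => ⟨fun k hk => h k (by omega), by rw [← hxm]; exact h (m + 1) le_rfl⟩
      · rintro ⟨h3, h4⟩ k hk
        rcases Nat.lt_or_ge m k with h5 | h5
        · obtain rfl : k = m + 1 := by omega
          rw [hxm, h4]
        · exact h3 k h5
    have h3 := hX.step m x
    rw [h2, h1] at h3
    rw [h3]
    simp [hx, Fin.last]
  rw [hset, measure_inter_eq_sum hY S _ hz]
  have h4 := measure_inter_eq_sum (P := P) hY S Set.univ MeasurableSet.univ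
  simp only [Set.inter_univ] at h4
  rw [h4, Finset.sum_mul]
  refine Finset.sum_congr rfl fun p hp => ?_
  rw [hpath, (Finset.mem_filter.1 hp).2.2]

/-- The sub-probability of being at `x` at time `m` without having visited `M`. -/
noncomputable def killed (X : ℕ → Ω → Fin (n + 1)) (M : Fin (n + 1)) (P : Measure Ω) (m : ℕ)
    (x : Fin (n + 1)) : ℝ := P.real (avoid X M m ∩ {ω | X m ω = x})

lemma killed_self (m : ℕ) : killed X M P m M = 0 := by
  have : avoid X M m ∩ {ω | X m ω = M} = ∅ := by
    ext ω
    simp only [avoid, Set.mem_inter_iff, Set.mem_ofPred_eq, Set.mem_empty_iff_false, iff_false]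
    exact fun h => h.1 m le_rfl h.2
  rw [killed, this]
  simp

variable [IsProbabilityMeasure P]

lemma measureReal_eq_sum (hX : ∀ m, Measurable (X m)) (m : ℕ) {B : Set Ω}
    (hB : MeasurableSet B) : P.real B = ∑ x, P.real (B ∩ {ω | X m ω = x}) := by
  have := measure_inter_eq_sum (P := P) (hX m) Finset.univ B hB
  simp only [Finset.coe_univ, Set.preimage_univ, Set.univ_inter] at this
  rw [measureReal_def, this, ENNReal.toReal_sum (fun _ _ => measure_ne_top _ _)]
  refine Finset.sum_congr rfl fun x _ => ?_
  rw [Set.inter_comm]; rfl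

lemma killed_succ (hnn : ∀ x y, 0 ≤ K x y) (hX : IsMarkovChain K j X P) (m : ℕ)
    {z : Fin (n + 1)} (hz : z ≠ M) :
    killed X M P (m + 1) z = ∑ y, killed X M P m y * K y z := by
  have hset : avoid X M (m + 1) ∩ {ω | X (m + 1) ω = z} =
      avoid X M m ∩ {ω | X (m + 1) ω = z} := by
    ext ω
    simp only [avoid, Set.mem_inter_iff, Set.mem_ofPred_eq]
    refine and_congr_left fun h => ⟨fun h' k hk => h' k (by omega), fun h' k hk => ?_⟩
    rcases Nat.lt_or_ge m k with h5 | h5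
    · obtain rfl : k = m + 1 := by omega
      rwa [h]
    · exact h' k h5
  have hm : MeasurableSet (avoid X M m ∩ {ω | X (m + 1) ω = z}) :=
    (measurableSet_avoid hX.measurable m).inter (hX.measurable _ (measurableSet_singleton z))
  rw [killed, hset, measureReal_eq_sum hX.measurable m hm]
  refine Finset.sum_congr rfl fun y _ => ?_
  rw [killed, Set.inter_right_comm, measureReal_def, hX.measure_avoid_step, ENNReal.toReal_mul,
    ENNReal.toReal_ofReal (hnn y z)]
  rfl

lemma sum_killed_zero (hX : IsMarkovChain K j X P) {f : Fin (n + 1) → ℝ} (hf : f M = 0) :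
    ∑ x, killed X M P 0 x * f x = f j := by
  have h0 : ∀ x, x ≠ M → killed X M P 0 x = if x = j then 1 else 0 := by
    intro x hx
    have h1 : avoid X M 0 ∩ {ω | X 0 ω = x} = {ω | X 0 ω = x} := by
      ext ω
      simp only [avoid, Set.mem_inter_iff, Set.mem_ofPred_eq, nonpos_iff_eq_zero, forall_eq,
        and_iff_right_iff_imp]
      rintro rfl
      exact hx
    rw [killed, h1]
    split_ifs with h
    · have h2 : ({ω | X 0 ω = x} : Set Ω) =ᵐ[P] Set.univ := by
        refine Filter.eventuallyEq_set.2 ?_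
        filter_upwards [hX.init] with ω hω
        simp [hω, h]
      rw [measureReal_congr h2, probReal_univ]
    · have h2 : ({ω | X 0 ω = x} : Set Ω) =ᵐ[P] (∅ : Set Ω) := by
        refine Filter.eventuallyEq_set.2 ?_
        filter_upwards [hX.init] with ω hω
        simp [hω, Ne.symm h]
      rw [measureReal_congr h2, measureReal_empty]
  calc _ = ∑ x, if x = j then f x else 0 := by
        refine Finset.sum_congr rfl fun x _ => ?_
        by_cases hx : x = M
        · rw [hx, hf, mul_zero, ite_self]
        · rw [h0 x hx]; simp
    _ = f j := by simp

lemma sum_killed (hX : ∀ m, Measurable (X m)) (m : ℕ) :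
    ∑ x, killed X M P m x = P.real (avoid X M m) :=
  (measureReal_eq_sum hX m (measurableSet_avoid hX m)).symm

/-- Killing at `M` is invisible to functions vanishing there, so their killed expectation drops at
each step by that of `(I - K) f`. -/
lemma sum_killed_succ (hnn : ∀ x y, 0 ≤ K x y) (hX : IsMarkovChain K j X P)
    {f : Fin (n + 1) → ℝ} (hf : f M = 0) (m : ℕ) :
    ∑ x, killed X M P (m + 1) x * f x =
      ∑ x, killed X M P m x * f x - ∑ x, killed X M P m x * gen K f x := by
  have h1 : ∀ z, killed X M P (m + 1) z * f z = ∑ y, killed X M P m y * (K y z * f z) := by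
    intro z
    by_cases hz : z = M
    · simp [hz, hf]
    · rw [killed_succ hnn hX m hz, Finset.sum_mul]
      simp only [mul_assoc]
  rw [Finset.sum_congr rfl fun z _ => h1 z, Finset.sum_comm, ← Finset.sum_sub_distrib]
  refine Finset.sum_congr rfl fun y _ => ?_
  rw [gen_eq, ← Finset.mul_sum, mul_sub, sub_sub_cancel]
  rfl

/-- The first two moments of the hitting time of `M`, through the tails. -/
lemma hasSum_avoid (hC : Chain K μ) (hX : IsMarkovChain K j X P) {g g₂ : Fin (n + 1) → ℝ}
    (hg : ∀ x, 0 ≤ g x) (hg₂ : ∀ x, 0 ≤ g₂ x) (hgM : g M = 0) (hg₂M : g₂ M = 0)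
    (hgen : ∀ x, x ≠ M → gen K g x = 1) (hgen₂ : ∀ x, x ≠ M → gen K g₂ x = g x) :
    HasSum (fun m => P.real (avoid X M m)) (g j) ∧
      HasSum (fun m : ℕ => ((m : ℝ) + 1) * P.real (avoid X M m)) (g₂ j) := by
  set q : ℕ → ℝ := fun m => P.real (avoid X M m) with hq
  have hq0 : ∀ m, 0 ≤ q m := fun m => measureReal_nonneg
  have hk0 : ∀ m x, 0 ≤ killed X M P m x := fun m x => measureReal_nonneg
  set D : (Fin (n + 1) → ℝ) → ℕ → ℝ := fun f m => ∑ x, killed X M P m x * f x with hD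
  have hDnn : ∀ f m, (∀ x, 0 ≤ f x) → 0 ≤ D f m := fun f m hf =>
    Finset.sum_nonneg fun x _ => mul_nonneg (hk0 m x) (hf x)
  have hcongr : ∀ f f' m, (∀ x, x ≠ M → f x = f' x) → D f m = D f' m := by
    intro f f' m h
    refine Finset.sum_congr rfl fun x _ => ?_
    by_cases hx : x = M
    · rw [hx, killed_self, zero_mul, zero_mul]
    · rw [h x hx]
  have h1 : ∀ m, D g (m + 1) = D g m - q m := by
    intro m
    have := sum_killed_succ hC.nonneg hX hgM m
    have h2 : D (gen K g) m = q m := by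
      rw [hcongr (gen K g) (fun _ => 1) m hgen]
      simp only [hD, mul_one]
      exact sum_killed hX.measurable m
    rw [← h2]; exact this
  have h2 : ∀ m, D g₂ (m + 1) = D g₂ m - D g m := by
    intro m
    have := sum_killed_succ hC.nonneg hX hg₂M m
    have h3 := hcongr (gen K g₂) g m hgen₂
    rw [← h3]; exact this
  have hbound : ∀ f : Fin (n + 1) → ℝ, ∃ B, 0 ≤ B ∧ ∀ m, D f m ≤ B * q m := by
    intro f
    refine ⟨∑ x, |f x|, Finset.sum_nonneg fun _ _ => abs_nonneg _, fun m => ?_⟩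
    have hqm : q m = ∑ x, killed X M P m x := (sum_killed hX.measurable m).symm
    rw [hqm, Finset.mul_sum]
    refine Finset.sum_le_sum fun x _ => ?_
    rw [mul_comm]
    refine mul_le_mul_of_nonneg_right ((le_abs_self _).trans ?_) (hk0 m x)
    exact Finset.single_le_sum (f := fun x => |f x|) (fun _ _ => abs_nonneg _) (Finset.mem_univ x)
  have hsum : ∀ N, ∑ m ∈ Finset.range N, q m = g j - D g N := by
    intro N
    induction N with
    | zero => simp [hD, sum_killed_zero hX hgM]
    | succ N ih => rw [Finset.sum_range_succ, ih, h1]; ring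
  have hsum₂ : ∀ N : ℕ, ∑ m ∈ Finset.range N, ((m : ℝ) + 1) * q m =
      g₂ j - (D g₂ N + N * D g N) := by
    intro N
    induction N with
    | zero => simp [hD, sum_killed_zero hX hg₂M]
    | succ N ih =>
      rw [Finset.sum_range_succ, ih, h1, h2]
      push_cast; ring
  have hq₂0 : ∀ m : ℕ, 0 ≤ ((m : ℝ) + 1) * q m := fun m => mul_nonneg (by positivity) (hq0 m)
  -- Telescoping and nonnegativity bound the partial sums by `g₂ j`. Summability then gives `(m + 1)
  -- * q m → 0`, which kills the remainders because each `D f m` is at most a constant times `q m`.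
  have hs₂ : Summable fun m : ℕ => ((m : ℝ) + 1) * q m := by
    refine summable_of_sum_range_le (c := g₂ j) hq₂0 fun N => ?_
    rw [hsum₂]
    have := hDnn g₂ N hg₂
    have := mul_nonneg (Nat.cast_nonneg (α := ℝ) N) (hDnn g N hg)
    linarith
  have hlim₂ := hs₂.tendsto_atTop_zero
  obtain ⟨B, hB0, hB⟩ := hbound g
  obtain ⟨B₂, hB₂0, hB₂⟩ := hbound g₂
  constructor
  · rw [hasSum_iff_tendsto_nat_of_nonneg hq0]
    simp only [hsum]
    have : Tendsto (fun N => D g N) atTop (𝓝 0) := by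
      refine squeeze_zero (fun N => hDnn g N hg) (fun N => ?_) (by simpa using hlim₂.const_mul B)
      refine (hB N).trans (mul_le_mul_of_nonneg_left ?_ hB0)
      have := mul_nonneg (Nat.cast_nonneg (α := ℝ) N) (hq0 N)
      linarith
    simpa using tendsto_const_nhds.sub this
  · rw [hasSum_iff_tendsto_nat_of_nonneg hq₂0]
    simp only [hsum₂]
    have : Tendsto (fun N : ℕ => D g₂ N + N * D g N) atTop (𝓝 0) := by
      refine squeeze_zero (fun N => add_nonneg (hDnn g₂ N hg₂)
        (mul_nonneg (Nat.cast_nonneg (α := ℝ) N) (hDnn g N hg))) (fun N => ?_)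
        (by simpa using hlim₂.const_mul (B₂ + B))
      have e1 := hB₂ N
      have e2 := mul_le_mul_of_nonneg_left (hB N) (Nat.cast_nonneg (α := ℝ) N)
      have e3 := mul_nonneg (mul_nonneg (Nat.cast_nonneg (α := ℝ) N) (hq0 N)) hB₂0
      have e4 := mul_nonneg (hq0 N) hB0
      nlinarith
    simpa using tendsto_const_nhds.sub this

end DiscreteHitting

/-! ### Moments of random times from tail sums. -/

section Moments

variable {Ω : Type*} [MeasurableSpace Ω] {P : Measure Ω}

lemma eq_tsum_tail {τ : ℝ≥0∞} (h : τ = ∞ ∨ ∃ N : ℕ, τ = N) :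
    τ = ∑' m : ℕ, if (m : ℝ≥0∞) < τ then 1 else 0 := by
  rcases h with rfl | ⟨N, rfl⟩
  · simp
  · rw [tsum_eq_sum (s := Finset.range N)]
    · rw [Finset.sum_congr rfl (g := fun _ => 1)]
      · simp
      · intro m hm
        rw [if_pos (by exact_mod_cast Finset.mem_range.1 hm)]
    · intro m hm
      rw [if_neg]
      rw [Finset.mem_range] at hm
      exact_mod_cast hm

lemma sq_eq_tsum_tail {τ : ℝ≥0∞} (h : τ = ∞ ∨ ∃ N : ℕ, τ = N) :
    τ ^ 2 = ∑' m : ℕ, if (m : ℝ≥0∞) < τ then (2 * m + 1 : ℝ≥0∞) else 0 := by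
  rcases h with rfl | ⟨N, rfl⟩
  · simp only [ENNReal.natCast_lt_top, if_true]
    rw [ENNReal.top_pow two_ne_zero, eq_comm, eq_top_iff,
      ← ENNReal.tsum_const_eq_top_of_ne_zero (α := ℕ) (c := 1) one_ne_zero]
    exact ENNReal.tsum_le_tsum fun m => le_add_self
  · rw [tsum_eq_sum (s := Finset.range N)]
    · rw [Finset.sum_congr rfl (g := fun m : ℕ => (2 * m + 1 : ℝ≥0∞))]
      · induction N with
        | zero => simp
        | succ N ih =>
          rw [Finset.sum_range_succ, ← ih]
          push_cast; ring
      · intro m hm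
        rw [if_pos (by exact_mod_cast Finset.mem_range.1 hm)]
    · intro m hm
      rw [if_neg]
      rw [Finset.mem_range] at hm
      exact_mod_cast hm

lemma moments_of_lintegral [IsProbabilityMeasure P] {τ : Ω → ℝ≥0∞} (hτ : AEMeasurable τ P)
    {a B : ℝ} (ha : 0 ≤ a) (hB : 0 ≤ B) (h1 : ∫⁻ ω, τ ω ∂P = ENNReal.ofReal a)
    (h2 : ∫⁻ ω, τ ω ^ 2 ∂P = ENNReal.ofReal B) :
    HasMeanVar τ P ∧ mean τ P = a ∧ var τ P = B - a ^ 2 := by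
  have hfin : ∀ᵐ ω ∂P, τ ω < ∞ := ae_lt_top' hτ (by rw [h1]; exact ENNReal.ofReal_ne_top)
  have hfin2 : ∀ᵐ ω ∂P, τ ω ^ 2 < ∞ :=
    ae_lt_top' (hτ.pow_const 2) (by rw [h2]; exact ENNReal.ofReal_ne_top)
  have hsq : ∀ ω, (τ ω).toReal ^ 2 = (τ ω ^ 2).toReal := fun ω => (ENNReal.toReal_pow _ _).symm
  have hL2 : MemLp (fun ω => (τ ω).toReal) 2 P := by
    rw [memLp_two_iff_integrable_sq hτ.ennreal_toReal.aestronglyMeasurable]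
    simp only [hsq]
    exact integrable_toReal_of_lintegral_ne_top (hτ.pow_const 2)
      (by rw [h2]; exact ENNReal.ofReal_ne_top)
  have hmean : ∫ ω, (τ ω).toReal ∂P = a := by
    rw [integral_toReal hτ hfin, h1, ENNReal.toReal_ofReal ha]
  refine ⟨⟨hfin.mono fun ω h => h.ne, hL2⟩, hmean, ?_⟩
  rw [var, variance_eq_sub hL2, hmean]
  congr 1
  simp only [Pi.pow_apply, hsq]
  rw [integral_toReal (hτ.pow_const 2) hfin2, h2, ENNReal.toReal_ofReal hB]

end Moments

/-! ### Moments of the hitting times in discrete and continuous time. -/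

section HittingMoments

variable {n : ℕ} {M : Fin (n + 1)} {Ω : Type*} {X : ℕ → Ω → Fin (n + 1)} {N : ℝ≥0 → Ω → ℕ}

lemma tsum_ofReal_eq {f : ℕ → ℝ} {a : ℝ} (hf : ∀ m, 0 ≤ f m) (h : HasSum f a) :
    ∑' m, ENNReal.ofReal (f m) = ENNReal.ofReal a := by
  rw [← ENNReal.ofReal_tsum_of_nonneg hf h.summable, h.tsum_eq]

/-- At least `k + 1` arrivals up to time `t` means that the arrival `S k` is one of them. -/
lemma lt_ncard_arrivals_iff {S : ℕ → ℝ≥0} (hmono : StrictMono S) (hlim : Tendsto S atTop atTop)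
    (t : ℝ≥0) (k : ℕ) : k < {k : ℕ | S k ≤ t}.ncard ↔ S k ≤ t := by
  classical
  have hex : ∃ m, t < S m := (hlim.eventually_gt_atTop t).exists
  have hset : {k : ℕ | S k ≤ t} = Set.Iio (Nat.find hex) := by
    ext k
    simp only [Set.mem_ofPred_eq, Set.mem_Iio, Nat.lt_find_iff, not_lt]
    exact ⟨fun h m hm => (hmono.monotone hm).trans h, fun h => h k le_rfl⟩
  have hcard : {k : ℕ | S k ≤ t}.ncard = Nat.find hex := by
    rw [hset, Set.ncard_eq_toFinset_card']
    simp
  rw [hcard]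
  have : k ∈ {k : ℕ | S k ≤ t} ↔ k ∈ Set.Iio (Nat.find hex) := by rw [hset]
  exact this.symm

/-- A counting path starts at `0`, takes every integer value and attains each at an arrival time. By
time `t` the continuous chain has therefore visited exactly the first `N t` steps of `X`, and the
infimum is attained. -/
lemma hitC_le_iff {ω : Ω} (h : ∃ S : ℕ → ℝ≥0, 0 < S 0 ∧ StrictMono S ∧ Tendsto S atTop atTop ∧
    ∀ t, N t ω = {k : ℕ | S k ≤ t}.ncard) (t : ℝ≥0) :
    hitC X N M ω ≤ t ↔ ω ∉ avoid X M (N t ω) := by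
  obtain ⟨S, hS0, hmono, hlim, hN⟩ := h
  have hlt : ∀ t k, k < N t ω ↔ S k ≤ t := fun t k => by
    rw [hN]; exact lt_ncard_arrivals_iff hmono hlim t k
  have hattain : ∀ k, k ≤ N t ω → ∃ u ≤ t, N u ω = k := by
    intro k hk
    rcases k with _ | k
    · refine ⟨0, zero_le, ?_⟩
      by_contra h
      exact absurd ((hlt 0 0).1 (Nat.pos_of_ne_zero h)) (not_le.2 hS0)
    · refine ⟨S k, (hlt t k).1 hk, le_antisymm ?_ ((hlt _ _).2 le_rfl)⟩
      by_contra h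
      exact absurd ((hlt (S k) (k + 1)).1 (not_le.1 h)) (not_le.2 (hmono (Nat.lt_succ_self k)))
  constructor
  · intro hle hav
    -- Arrivals are indexed from `0`, so `S (N t)` is the first arrival after `t`. If `M` is avoided
    -- so far, it cannot be hit before then.
    have h1 : t < S (N t ω) := not_le.1 fun h => absurd ((hlt _ _).2 h) (lt_irrefl _)
    have h2 : ((S (N t ω) : ℝ≥0) : ℝ≥0∞) ≤ hitC X N M ω := by
      refine le_iInf₂ fun u hu => ?_
      rw [ENNReal.coe_le_coe, ← hlt]
      by_contra h3
      exact hav _ (not_lt.1 h3) hu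
    exact absurd (ENNReal.coe_le_coe.1 (h2.trans hle)) (not_le.2 h1)
  · intro hav
    simp only [avoid, Set.mem_ofPred_eq, not_forall, not_not] at hav
    obtain ⟨k, hk, hX⟩ := hav
    obtain ⟨u, hut, hu⟩ := hattain k hk
    refine (iInf₂_le (f := fun (t : ℝ≥0) (_ : X (N t ω) ω = M) => (t : ℝ≥0∞)) u ?_).trans
      (ENNReal.coe_le_coe.2 hut)
    rw [hu, hX]

lemma hitC_ne_top {ω : Ω} (h : ∃ S : ℕ → ℝ≥0, 0 < S 0 ∧ StrictMono S ∧ Tendsto S atTop atTop ∧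
    ∀ t, N t ω = {k : ℕ | S k ≤ t}.ncard) (hhit : hit X M ω ≠ ∞) : hitC X N M ω ≠ ∞ := by
  obtain ⟨k, hk⟩ : ∃ k, X k ω = M := by
    by_contra hcon
    push Not at hcon
    exact hhit (by simp [hit, hcon])
  have h' := h
  obtain ⟨S, hS0, hmono, hlim, hN⟩ := h'
  refine ne_top_of_le_ne_top ENNReal.coe_ne_top ((hitC_le_iff h (S k)).2 fun hav => hav k ?_ hk)
  rw [hN]
  exact ((lt_ncard_arrivals_iff hmono hlim _ _).2 le_rfl).le

variable [MeasurableSpace Ω] {P : Measure Ω}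

lemma IsPoissonProcess.measure_eq (hN : IsPoissonProcess N P) (t : ℝ≥0) (k : ℕ) :
    P {ω | N t ω = k} = ENNReal.ofReal (Real.exp (-t) * t ^ k / k.factorial) := by
  have h1 := hN.law 0 t zero_le
  have h2 : (fun ω => N t ω - N 0 ω) =ᵐ[P] N t := by
    filter_upwards [hN.counting] with ω hω
    obtain ⟨S, hS0, hmono, -, hNS⟩ := hω
    have : {k : ℕ | S k ≤ 0} = ∅ := by
      ext k
      simp only [Set.mem_ofPred_eq, Set.mem_empty_iff_false, iff_false, not_le]
      exact hS0.trans_le (hmono.monotone (Nat.zero_le k))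
    rw [hNS 0, this, Set.ncard_empty, Nat.sub_zero]
  rw [Measure.map_congr h2, tsub_zero] at h1
  have h3 : P {ω | N t ω = k} = P.map (N t) {k} := by
    rw [Measure.map_apply (hN.measurable t) (measurableSet_singleton k)]; rfl
  rw [h3, h1, poissonMeasure_singleton]

lemma lintegral_exp_mul_pow (k : ℕ) :
    ∫⁻ t in Set.Ioi (0 : ℝ), ENNReal.ofReal (Real.exp (-t) * t ^ k / k.factorial) = 1 := by
  have h1 := Real.GammaIntegral_convergent (s := (k : ℝ) + 1) (by positivity)
  have h2 := Real.Gamma_eq_integral (s := (k : ℝ) + 1) (by positivity)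
  rw [Real.Gamma_nat_eq_factorial] at h2
  simp only [add_sub_cancel_right, Real.rpow_natCast] at h1 h2
  rw [← ofReal_integral_eq_lintegral_ofReal]
  · rw [integral_div, ← h2, div_self (by positivity), ENNReal.ofReal_one]
  · exact h1.div_const _
  · filter_upwards [ae_restrict_mem measurableSet_Ioi] with t ht
    have : (0 : ℝ) < t := ht
    simp only [Pi.zero_apply]
    positivity

variable [IsProbabilityMeasure P]

/-- The second moment is the sum of `2m + 1 = 2(m + 1) - 1` times the tails, that is `2 a₂ - a`. -/
lemma hit_moments (hX : ∀ m, Measurable (X m)) {a a₂ : ℝ}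
    (h1 : HasSum (fun m => P.real (avoid X M m)) a)
    (h2 : HasSum (fun m : ℕ => ((m : ℝ) + 1) * P.real (avoid X M m)) a₂) :
    HasMeanVar (hit X M) P ∧ mean (hit X M) P = a ∧ var (hit X M) P = 2 * a₂ - a - a ^ 2 := by
  classical
  have hq0 : ∀ m, 0 ≤ P.real (avoid X M m) := fun m => measureReal_nonneg
  have h3 : HasSum (fun m : ℕ => (2 * (m : ℝ) + 1) * P.real (avoid X M m)) (2 * a₂ - a) := by
    refine ((h2.mul_left 2).sub h1).congr_fun ?_
    intro m; ring
  have key : ∀ c : ℕ → ℝ≥0∞, ∫⁻ ω, ∑' m : ℕ, (if (m : ℝ≥0∞) < hit X M ω then c m else 0) ∂P =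
      ∑' m, c m * P (avoid X M m) := by
    intro c
    have : ∀ (m : ℕ) ω, (if (m : ℝ≥0∞) < hit X M ω then c m else 0) =
        (avoid X M m).indicator (fun _ => c m) ω := by
      intro m ω
      simp only [lt_hit_iff, Set.indicator]
    simp only [this]
    rw [lintegral_tsum fun m =>
      (measurable_const.indicator (measurableSet_avoid hX m)).aemeasurable]
    simp only [lintegral_indicator_const (measurableSet_avoid hX _)]
  refine moments_of_lintegral (measurable_hit hX).aemeasurable (h1.nonneg hq0)
    (h3.nonneg fun m => mul_nonneg (by positivity) (hq0 m)) ?_ ?_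
  · rw [lintegral_congr fun ω => eq_tsum_tail (hit_eq_top_or_nat ω), key, ← tsum_ofReal_eq hq0 h1]
    refine tsum_congr fun m => ?_
    rw [one_mul, ofReal_measureReal]
  · rw [lintegral_congr fun ω => sq_eq_tsum_tail (hit_eq_top_or_nat ω), key,
      ← tsum_ofReal_eq (fun m => mul_nonneg (by positivity) (hq0 m)) h3]
    refine tsum_congr fun m => ?_
    rw [ENNReal.ofReal_mul (by positivity), ofReal_measureReal]
    congr 1
    rw [ENNReal.ofReal_add (by positivity) zero_le_one, ENNReal.ofReal_mul zero_le_two]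
    simp

/-- By independence the tail at `t` is the Poisson mixture of the discrete tails. Each Poisson
weight integrates to `1` over time, and to `k + 1` against `t`. So the mean agrees with discrete
time and the second moment is `2 a₂`, without the correction `-a`. -/
lemma hitC_moments (hX : ∀ m, Measurable (X m)) (hN : IsPoissonProcess N P)
    (hXN : IndepFun (fun ω (m : ℕ) => X m ω) (fun ω (t : ℝ≥0) => N t ω) P) {a a₂ : ℝ}
    (h1 : HasSum (fun m => P.real (avoid X M m)) a)
    (h2 : HasSum (fun m : ℕ => ((m : ℝ) + 1) * P.real (avoid X M m)) a₂) :
    HasMeanVar (hitC X N M) P ∧ mean (hitC X N M) P = a ∧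
      var (hitC X N M) P = 2 * a₂ - a ^ 2 := by
  have hq0 : ∀ m, 0 ≤ P.real (avoid X M m) := fun m => measureReal_nonneg
  have hfin : ∀ᵐ ω ∂P, hitC X N M ω ≠ ∞ := by
    filter_upwards [hN.counting, (hit_moments hX h1 h2).1.1] with ω hc hh using hitC_ne_top hc hh
  set A : ℝ≥0 → Set Ω := fun t => {ω | ω ∈ avoid X M (N t ω)} with hA
  have hAeq : ∀ t, A t = ⋃ k, avoid X M k ∩ {ω | N t ω = k} := by
    intro t; ext ω; simp [hA]
  have hNm : ∀ t k, MeasurableSet {ω | N t ω = k} := fun t k =>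
    hN.measurable t (measurableSet_singleton k)
  have hAm : ∀ t, MeasurableSet (A t) := fun t => by
    rw [hAeq]
    exact MeasurableSet.iUnion fun k => (measurableSet_avoid hX k).inter (hNm t k)
  have hae : ∀ t : ℝ≥0, {ω | hitC X N M ω ≤ t} =ᵐ[P] (A t)ᶜ := by
    intro t
    refine Filter.eventuallyEq_set.2 ?_
    filter_upwards [hN.counting] with ω hω
    exact hitC_le_iff hω t
  -- The infimum ranges over uncountably many times, and sublevel sets are identified with
  -- measurable events only up to null sets; null measurability is what this yields.
  have hmeas : AEMeasurable (hitC X N M) P := by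
    refine NullMeasurable.aemeasurable ?_
    have h3 : Measurable (fun ω : NullMeasurableSpace Ω P => hitC X N M (ω : Ω)) := by
      refine measurable_of_Iic fun x => ?_
      rcases eq_or_ne x ∞ with rfl | hx
      · simp
      · lift x to ℝ≥0 using hx
        exact NullMeasurableSet.congr (hAm x).compl.nullMeasurableSet (hae x).symm
    exact h3
  have htail : ∀ t : ℝ≥0, P (A t) =
      ∑' k, P (avoid X M k) * ENNReal.ofReal (Real.exp (-t) * t ^ k / k.factorial) := by
    intro t
    rw [hAeq, measure_iUnion]
    · refine tsum_congr fun k => ?_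
      rw [← hN.measure_eq]
      have hs1 : MeasurableSet {x : ℕ → Fin (n + 1) | ∀ i ≤ k, x i ≠ M} := by
        have : {x : ℕ → Fin (n + 1) | ∀ i ≤ k, x i ≠ M} =
            ⋂ i, ⋂ (_ : i ≤ k), (fun x => x i) ⁻¹' {M}ᶜ := by ext; simp
        rw [this]
        exact MeasurableSet.iInter fun i => MeasurableSet.iInter fun _ =>
          measurable_pi_apply i (measurableSet_singleton M).compl
      have hs2 : MeasurableSet {x : ℝ≥0 → ℕ | x t = k} :=
        (measurable_pi_apply t : Measurable fun x : ℝ≥0 → ℕ => x t) (measurableSet_singleton k)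
      exact hXN.measure_inter_preimage_eq_mul _ _ hs1 hs2
    · intro i k hik
      refine Set.disjoint_left.2 ?_
      rintro ω ⟨-, hi⟩ ⟨-, hk⟩
      exact hik (hi.symm.trans hk)
    · exact fun k => (measurableSet_avoid hX k).inter (hNm t k)
  have htail' : ∀ t ∈ Set.Ioi (0 : ℝ), P {ω | t < (hitC X N M ω).toReal} =
      ∑' k, P (avoid X M k) * ENNReal.ofReal (Real.exp (-t) * t ^ k / k.factorial) := by
    intro t ht
    have ht0 : (0 : ℝ) ≤ t := le_of_lt ht
    have h3 : P (A ⟨t, ht0⟩) = ∑' k, P (avoid X M k) *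
      ENNReal.ofReal (Real.exp (-t) * t ^ k / k.factorial) := htail ⟨t, ht0⟩
    rw [← h3]
    refine measure_congr (Filter.eventuallyEq_set.2 ?_)
    filter_upwards [hfin, hN.counting] with ω hω hc
    have h4 : hitC X N M ω ≤ ENNReal.ofReal t ↔ ω ∉ avoid X M (N ⟨t, ht0⟩ ω) := by
      rw [ENNReal.ofReal_eq_coe_nnreal ht0]
      exact hitC_le_iff hc ⟨t, ht0⟩
    rw [Set.mem_ofPred_eq, ← not_iff_not, not_lt]
    rw [ENNReal.le_ofReal_iff_toReal_le hω ht0] at h4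
    exact h4
  have hpow : ∀ (k : ℕ) (t : ℝ), 0 < t → ENNReal.ofReal (Real.exp (-t) * t ^ k / k.factorial) *
      ENNReal.ofReal t = ENNReal.ofReal ((k : ℝ) + 1) *
        ENNReal.ofReal (Real.exp (-t) * t ^ (k + 1) / (k + 1).factorial) := by
    intro k t ht
    rw [← ENNReal.ofReal_mul (by positivity), ← ENNReal.ofReal_mul (by positivity),
      Nat.factorial_succ]
    congr 1
    push_cast
    field_simp
    ring
  have hm : ∀ k : ℕ, Measurable fun t : ℝ =>
      ENNReal.ofReal (Real.exp (-t) * t ^ k / k.factorial) := fun k => by fun_prop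
  have hnn : 0 ≤ᵐ[P] fun ω => (hitC X N M ω).toReal :=
    Eventually.of_forall fun ω => ENNReal.toReal_nonneg
  have hB0 : 0 ≤ 2 * a₂ :=
    mul_nonneg zero_le_two (h2.nonneg fun m => mul_nonneg (by positivity) (hq0 m))
  refine moments_of_lintegral hmeas (h1.nonneg hq0) hB0 ?_ ?_
  · have e1 : ∫⁻ ω, hitC X N M ω ∂P = ∫⁻ ω, ENNReal.ofReal (hitC X N M ω).toReal ∂P := by
      refine lintegral_congr_ae ?_
      filter_upwards [hfin] with ω hω
      rw [ENNReal.ofReal_toReal hω]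
    rw [e1, lintegral_eq_lintegral_meas_lt P hnn hmeas.ennreal_toReal,
      setLIntegral_congr_fun measurableSet_Ioi htail',
      lintegral_tsum fun k => ((hm k).const_mul _).aemeasurable, ← tsum_ofReal_eq hq0 h1]
    refine tsum_congr fun k => ?_
    rw [lintegral_const_mul _ (hm k), lintegral_exp_mul_pow, mul_one, ofReal_measureReal]
  · have e1 : ∫⁻ ω, hitC X N M ω ^ 2 ∂P =
        ∫⁻ ω, ENNReal.ofReal ((hitC X N M ω).toReal ^ (2 : ℝ)) ∂P := by
      refine lintegral_congr_ae ?_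
      filter_upwards [hfin] with ω hω
      rw [← ENNReal.ofReal_rpow_of_nonneg ENNReal.toReal_nonneg zero_le_two,
        ENNReal.ofReal_toReal hω]
      norm_num
    have e2 : ∀ t ∈ Set.Ioi (0 : ℝ), P {ω | t < (hitC X N M ω).toReal} *
        ENNReal.ofReal (t ^ ((2 : ℝ) - 1)) =
        ∑' k : ℕ, P (avoid X M k) * (ENNReal.ofReal ((k : ℝ) + 1) *
          ENNReal.ofReal (Real.exp (-t) * t ^ (k + 1) / (k + 1).factorial)) := by
      intro t ht
      rw [htail' t ht, show (2 : ℝ) - 1 = 1 by norm_num, Real.rpow_one, ← ENNReal.tsum_mul_right]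
      refine tsum_congr fun k => ?_
      rw [mul_assoc, hpow k t ht]
    rw [e1, lintegral_rpow_eq_lintegral_meas_lt_mul P hnn hmeas.ennreal_toReal zero_lt_two,
      setLIntegral_congr_fun measurableSet_Ioi e2,
      lintegral_tsum fun k => (((hm (k + 1)).const_mul _).const_mul _).aemeasurable,
      ENNReal.ofReal_mul zero_le_two,
      ← tsum_ofReal_eq (fun m => mul_nonneg (by positivity) (hq0 m)) h2]
    congr 1
    refine tsum_congr fun k => ?_
    rw [lintegral_const_mul _ ((hm (k + 1)).const_mul _), lintegral_const_mul _ (hm (k + 1)),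
      lintegral_exp_mul_pow, mul_one, mul_comm, ENNReal.ofReal_mul (by positivity),
      ofReal_measureReal]

end HittingMoments

/-- The moments of the hitting times of `M` from the two ends, in terms of flow and masses. -/
lemma end_moments {n : ℕ} {K : Matrix (Fin (n + 1)) (Fin (n + 1)) ℝ} {μ : Fin (n + 1) → ℝ}
    (hC : Chain K μ) {Ω : Type*} [MeasurableSpace Ω] {P : Fin (n + 1) → Measure Ω}
    [∀ j, IsProbabilityMeasure (P j)] {X : ℕ → Ω → Fin (n + 1)} {N : ℝ≥0 → Ω → ℕ}
    (hX : ∀ j, IsMarkovChain K j X (P j)) (hN : ∀ j, IsPoissonProcess N (P j))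
    (hXN : ∀ j, IndepFun (fun ω (m : ℕ) => X m ω) (fun ω (t : ℝ≥0) => N t ω) (P j))
    (M : Fin (n + 1)) :
    (∀ j, HasMeanVar (hitC X N M) (P j) ∧ HasMeanVar (hit X M) (P j)) ∧
      endMean P (hitC X N M) = hitMean K μ M ∧ endMean P (hit X M) = hitMean K μ M ∧
      endDev P (hitC X N M) = √(hitVar K μ M) ∧
      endDev P (hit X M) = √(hitVar K μ M - hitMean K μ M) := by
  obtain ⟨g, g₂, hg, hg₂, hgM, hg₂M, hgen, hgen₂, hmean, hvar⟩ := hC.exists_hitting_potentials M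
  have hsum := fun j => hasSum_avoid hC (hX j) hg hg₂ hgM hg₂M hgen hgen₂
  have hd := fun j => hit_moments (hX j).measurable (hsum j).1 (hsum j).2
  have hc := fun j => hitC_moments (hX j).measurable (hN j) (hXN j) (hsum j).1 (hsum j).2
  refine ⟨fun j => ⟨(hc j).1, (hd j).1⟩, ?_, ?_, ?_, ?_⟩
  · rw [endMean, (hc _).2.1, (hc _).2.1, hmean]
  · rw [endMean, (hd _).2.1, (hd _).2.1, hmean]
  · rw [endDev, (hc _).2.2, (hc _).2.2, ← hvar]
    congr 1
    ring
  · rw [endDev, (hd _).2.2, (hd _).2.2, ← hvar, ← hmean]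
    congr 1
    ring

end BDCutoff

/-! ### The main theorem, assembled from the moment formulas and the two cutoff criteria. -/

theorem theorem1p3
    -- irreducible birth and death chains on `{0, …, n}`, `n ≥ 1`, and their stationary laws
    (K : (n : ℕ) → Matrix (Fin (n + 1)) (Fin (n + 1)) ℝ)
    (μ : (n : ℕ) → Fin (n + 1) → ℝ)
    (hK : ∀ n, 1 ≤ n → BDCutoff.IsBirthDeath (K n))
    (hirr : ∀ n, 1 ≤ n → (K n).IsIrreducible)
    (hμ : ∀ n, 1 ≤ n → BDCutoff.IsStationary (K n) (μ n))
    -- the discrete time chains `X n`, run from each starting state `j` under the law `P n j`,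
    -- and rate one Poisson processes `N n` independent of them
    (Ω : ℕ → Type*) [∀ n, MeasurableSpace (Ω n)]
    (P : (n : ℕ) → Fin (n + 1) → Measure (Ω n))
    [∀ n j, IsProbabilityMeasure (P n j)]
    (X : (n : ℕ) → ℕ → Ω n → Fin (n + 1))
    (N : (n : ℕ) → ℝ≥0 → Ω n → ℕ)
    (hX : ∀ n, 1 ≤ n → ∀ j, BDCutoff.IsMarkovChain (K n) j (X n) (P n j))
    (hN : ∀ n, 1 ≤ n → ∀ j, BDCutoff.IsPoissonProcess (N n) (P n j))
    (hXN : ∀ n, 1 ≤ n → ∀ j,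
      IndepFun (fun ω (m : ℕ) => X n m ω) (fun ω (t : ℝ≥0) => N n t ω) (P n j))
    -- the states `M n`, with mass bounded below on both sides
    (M : (n : ℕ) → Fin (n + 1))
    (hMleft : ∃ δ : ℝ, 0 < δ ∧ ∀ n, 1 ≤ n → δ ≤ ∑ i ∈ Finset.Iic (M n), μ n i)
    (hMright : ∃ δ : ℝ, 0 < δ ∧ ∀ n, 1 ≤ n → δ ≤ ∑ i ∈ Finset.Ici (M n), μ n i)
    -- the constants
    (lam s b c : ℕ → ℝ)
    (hlam : ∀ n, lam n = BDCutoff.spectralGap (K n))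
    (hs : ∀ n, s n = BDCutoff.endMean (P n) (BDCutoff.hitC (X n) (N n) (M n)))
    (hb : ∀ n, b n = BDCutoff.endDev (P n) (BDCutoff.hitC (X n) (N n) (M n)))
    (hc : ∀ n, c n = BDCutoff.endDev (P n) (BDCutoff.hit (X n) (M n))) :
    -- the means and variances are meaningful, and `s n` is the same in discrete time
    (∀ n, 1 ≤ n → ∀ j, j = 0 ∨ j = Fin.last n →
      BDCutoff.HasMeanVar (BDCutoff.hitC (X n) (N n) (M n)) (P n j) ∧
      BDCutoff.HasMeanVar (BDCutoff.hit (X n) (M n)) (P n j)) ∧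
    (∀ n, 1 ≤ n → s n = BDCutoff.endMean (P n) (BDCutoff.hit (X n) (M n))) ∧
    -- continuous time
    ((BDCutoff.HasCutoff (fun n ε => BDCutoff.sepTimeC (K n) (μ n) 0 ε) ↔
        Tendsto (fun n => s n * lam n) atTop atTop) ∧
      (Tendsto (fun n => s n * lam n) atTop atTop ↔
        Tendsto (fun n => s n / b n) atTop atTop) ∧
      (Tendsto (fun n => s n / b n) atTop atTop →
        BDCutoff.HasCutoffWindow (fun n ε => BDCutoff.sepTimeC (K n) (μ n) 0 ε) s b)) ∧
    -- discrete time, for monotone chains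
    ((∀ n, 1 ≤ n → ∀ i : Fin n,
        K n i.castSucc i.succ + K n i.succ i.castSucc ≤ 1) →
      (BDCutoff.HasCutoff (fun n ε => (BDCutoff.sepTime (K n) (μ n) 0 ε : ℝ)) ↔
        Tendsto (fun n => s n * lam n) atTop atTop) ∧
      (Tendsto (fun n => s n * lam n) atTop atTop ↔
        Tendsto (fun n => s n / c n) atTop atTop) ∧
      (Tendsto (fun n => s n / c n) atTop atTop →
        BDCutoff.HasCutoffWindow (fun n ε => (BDCutoff.sepTime (K n) (μ n) 0 ε : ℝ)) s
          (fun n => max (c n) (1 / lam n)))) := by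
  have hC : ∀ n, 1 ≤ n → BDCutoff.Chain (K n) (μ n) := fun n hn =>
    BDCutoff.Chain.of_irreducible (hK n hn) (hirr n hn) (hμ n hn)
  have hmom := fun n hn =>
    BDCutoff.end_moments (hC n hn) (hX n hn) (hN n hn) (hXN n hn) (M n)
  have hs' : ∀ n, 1 ≤ n → s n = BDCutoff.hitMean (K n) (μ n) (M n) := fun n hn =>
    (hs n).trans (hmom n hn).2.1
  have hb' : ∀ n, 1 ≤ n → b n = √(BDCutoff.hitVar (K n) (μ n) (M n)) := fun n hn =>
    (hb n).trans (hmom n hn).2.2.2.1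
  have hc' : ∀ n, 1 ≤ n → c n =
      √(BDCutoff.hitVar (K n) (μ n) (M n) - BDCutoff.hitMean (K n) (μ n) (M n)) := fun n hn =>
    (hc n).trans (hmom n hn).2.2.2.2
  obtain ⟨δ₁, hδ₁, hl⟩ := hMleft
  obtain ⟨δ₂, hδ₂, hr⟩ := hMright
  have hδ : 0 < min δ₁ δ₂ := lt_min hδ₁ hδ₂
  have hl' := fun n hn => (min_le_left δ₁ δ₂).trans (hl n hn)
  have hr' := fun n hn => (min_le_right δ₁ δ₂).trans (hr n hn)
  exact ⟨fun n hn j _ => (hmom n hn).1 j, fun n hn => (hs' n hn).trans (hmom n hn).2.2.1.symm,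
    BDCutoff.continuous_cutoff hC hδ hl' hr' hlam hs' hb',
    fun hmono => BDCutoff.discrete_cutoff hC hδ hl' hr' hlam hs' hc' hmono⟩
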